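/- Let $\mathbf C,\mathbf D\in\mathbb R^{d\times d}$, where $\mathbf D$ is diagonal and equal to the symmetric part of $\mathbf C$, $\mathbf D=\mathbf C_s=\frac12(\mathbf C+\mathbf C^T)$, and suppose that (A) $\mathbf D$ is positive semidefinite and $\mathbf D\neq0$ (it may be degenerate); (B) all eigenvalues of $\mathbf C$ have positive real part; (C) $\ker\mathbf D$ contains no nonzero $\mathbf C^T$-invariant subspace. Consider the Fokker–Planck equation $\partial_tf=Lf:=\operatorname{div}(\mathbf D\nabla f+\mathbf Cx\,f)$ on $(0,\infty)\times\mathbb R^d$. A solution with initial datum $f_0\in L^1(\mathbb R^d)$ is a function $f\in C([0,\infty);L^1(\mathbb R^d))$ with $f(0)=f_0$ that is of class $C^2$ on $(0,\infty)\times\mathbb R^d$ and satisfies the equation there pointwise. Let $f_\infty$ be the equilibrium of unit mass, $f_\infty\in C^2(\mathbb R^d)\cap L^1(\mathbb R^d)$, $Lf_\infty=0$, $\int f_\infty\,dx=1$. Let $\psi\in C([0,\infty))\cap C^4((0,\infty))$ be a generating function of an admissible relative entropy: $\psi(1)=\psi'(1)=0$, and $\psi''>0$, $(\psi''')^2\le\frac12\psi''\psi''''$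 on $(0,\infty)$. Let $\lambda>0$ and let $\mathbf P$ be a symmetric positive definite matrix with $\mathbf C^T\mathbf P+\mathbf P\mathbf C\ge2\lambda\mathbf P$. Let $f_0\in L^1(\mathbb R^d)$ be nonnegative with $\int f_0\,dx=1$, let $g_0\in L^1(\mathbb R^d)$ (of any sign), and let $f,g$ be solutions with initial data $f_0,g_0$. Write $$\mathcal I(t):=\mathcal I^{\mathbf P}_\psi(f(t),g(t)|f_\infty)=\int_{\mathbb R^d}\psi''\!\left(\frac{f(t,x)}{f_\infty(x)}\right)\nabla\!\left(\frac{g(t,x)}{f_\infty(x)}\right)^{T}\mathbf P\,\nabla\!\left(\frac{g(t,x)}{f_\infty(x)}\right)f_\infty(x)\,dx\in[0,\infty]$$ (with the weak gradient; for $t=0$ this presupposes that $f_0>0$ almost everywhere and $g_0\in H^1_{\mathrm{loc}}(\mathbb R^d)$). Suppose that $\mathcal I(t_0)<\infty$ for some $t_0\ge0$. Then $\mathcal I(t)<\infty$ for all $t\ge t_0$, and: (i) for every $t>t_0$, $$\limsup_{s\to t,\ s\ne t}\frac{\mathcal I(s)-\mathcal I(t)}{s-t}\le-2\lambda\,\mathcal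 I(t);$$ in particular $\frac{d}{dt}\mathcal I(t)\le-2\lambda\,\mathcal I(t)$ at every $t>t_0$ at which $\mathcal I$ is differentiable; (ii) $\mathcal I$ is differentiable at almost every $t>t_0$, with $\frac{d}{dt}\mathcal I(t)\le-2\lambda\,\mathcal I(t)$ there; (iii) for every $t\ge t_0$, $$\mathcal I(t)\le\mathcal I(t_0)\,e^{-2\lambda(t-t_0)}.$$ -/

import Mathlib

open MeasureTheory Filter Topology Set
open scoped ENNReal ContDiff Matrix

/-- A generating function for an admissible relative entropy:
`ψ ∈ C([0,∞)) ∩ C⁴((0,∞))`, `ψ(1) = ψ'(1) = 0`, `ψ'' > 0` and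
`(ψ''')² ≤ ½ ψ'' ψ''''` on `(0,∞)`. -/
structure IsEntropyGenerator (ψ : ℝ → ℝ) : Prop where
  continuousOn : ContinuousOn ψ (Ici 0)
  contDiffOn : ContDiffOn ℝ 4 ψ (Ioi 0)
  map_one : ψ 1 = 0
  deriv_one : deriv ψ 1 = 0
  second_pos : ∀ y : ℝ, 0 < y → 0 < iteratedDeriv 2 ψ y
  third_sq_le : ∀ y : ℝ, 0 < y →
    (iteratedDeriv 3 ψ y) ^ 2 ≤ (1 / 2) * iteratedDeriv 2 ψ y * iteratedDeriv 4 ψ y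

/-- The structural conditions (A), (B), (C) on a diffusion matrix `D` and a drift matrix `C`. -/
structure FokkerPlanckConditions {d : ℕ} (D C : Matrix (Fin d) (Fin d) ℝ) : Prop where
  /-- `D` is (symmetric) positive semi-definite. -/
  posSemidef : D.PosSemidef
  /-- `D` is not zero. -/
  one_le_rank : 1 ≤ D.rank
  /-- All (complex) eigenvalues of `C` have positive real part. -/
  positive_stable : ∀ z : ℂ,
    Module.End.HasEigenvalue (Matrix.toLin' (C.map (fun a : ℝ => (a : ℂ)))) z → 0 < z.re
  /-- The kernel of `D` contains no nontrivial `Cᵀ`-invariant subspace. -/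
  no_invariant : ∀ V : Submodule ℝ (Fin d → ℝ),
    (∀ v ∈ V, D *ᵥ v = 0) → (∀ v ∈ V, Cᵀ *ᵥ v ∈ V) → V = ⊥

/-- The partial derivative `∂u/∂xᵢ` on `ℝᵈ`. -/
noncomputable def partialDeriv {d : ℕ} (i : Fin d) (u : EuclideanSpace ℝ (Fin d) → ℝ)
    (x : EuclideanSpace ℝ (Fin d)) : ℝ :=
  fderiv ℝ u x (EuclideanSpace.single i 1)

/-- The flux `D ∇u + C x u`. -/
noncomputable def fpFlux {d : ℕ} (D C : Matrix (Fin d) (Fin d) ℝ)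
    (u : EuclideanSpace ℝ (Fin d) → ℝ) (x : EuclideanSpace ℝ (Fin d)) : Fin d → ℝ :=
  D *ᵥ (fun j => partialDeriv j u x) + u x • (C *ᵥ (fun j => x j))

/-- The Fokker-Planck operator `L u = div (D ∇u + C x u)`. -/
noncomputable def fpOperator {d : ℕ} (D C : Matrix (Fin d) (Fin d) ℝ)
    (u : EuclideanSpace ℝ (Fin d) → ℝ) (x : EuclideanSpace ℝ (Fin d)) : ℝ :=
  ∑ i, partialDeriv i (fun y => fpFlux D C u y i) x

/-- `f` is a classical solution of `∂ₜ f = L f` with initial datum `f₀ ∈ L¹`: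
it is continuous from `[0,∞)` to `L¹(ℝᵈ)`, equals `f₀` at time `0`, is of class `C²` on
`(0,∞) × ℝᵈ`, and satisfies the equation pointwise there. -/
structure IsFPSolution {d : ℕ} (D C : Matrix (Fin d) (Fin d) ℝ)
    (f₀ : EuclideanSpace ℝ (Fin d) → ℝ) (f : ℝ → EuclideanSpace ℝ (Fin d) → ℝ) : Prop where
  initial : f 0 =ᵐ[volume] f₀
  integrable : ∀ t : ℝ, 0 ≤ t → Integrable (f t) volume
  continuous_L1 : ∀ t : ℝ, 0 ≤ t →
    Tendsto (fun s => eLpNorm (fun x => f s x - f t x) 1 volume) (𝓝[Ici 0] t) (𝓝 0)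
  contDiffOn : ContDiffOn ℝ 2 (fun p : ℝ × EuclideanSpace ℝ (Fin d) => f p.1 p.2)
    (Ioi (0 : ℝ) ×ˢ (univ : Set (EuclideanSpace ℝ (Fin d))))
  equation : ∀ t : ℝ, 0 < t → ∀ x : EuclideanSpace ℝ (Fin d),
    HasDerivAt (fun s => f s x) (fpOperator D C (f t) x) t

/-- `fInf` is a unit-mass equilibrium of the Fokker-Planck equation. -/
structure IsEquilibrium {d : ℕ} (D C : Matrix (Fin d) (Fin d) ℝ)
    (fInf : EuclideanSpace ℝ (Fin d) → ℝ) : Prop where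
  contDiff : ContDiff ℝ 2 fInf
  stationary : ∀ x, fpOperator D C fInf x = 0
  integrable : Integrable fInf volume
  unit_mass : ∫ x, fInf x = 1

/-- `v` is the weak gradient of `u` on `ℝᵈ`. -/
structure HasWeakGradient {d : ℕ} (u : EuclideanSpace ℝ (Fin d) → ℝ)
    (v : EuclideanSpace ℝ (Fin d) → Fin d → ℝ) : Prop where
  locallyIntegrable : LocallyIntegrable u volume
  gradient_locallyIntegrable : LocallyIntegrable v volume
  integral_eq : ∀ φ : EuclideanSpace ℝ (Fin d) → ℝ, ContDiff ℝ ∞ φ → HasCompactSupport φ →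
    ∀ i : Fin d, ∫ x, u x * partialDeriv i φ x = - ∫ x, v x i * φ x

/-- The local Sobolev space `H¹_loc(ℝᵈ)`. -/
def MemH1loc {d : ℕ} (u : EuclideanSpace ℝ (Fin d) → ℝ) : Prop :=
  (∀ K : Set (EuclideanSpace ℝ (Fin d)), IsCompact K → MemLp u 2 (volume.restrict K)) ∧
  ∃ v : EuclideanSpace ℝ (Fin d) → Fin d → ℝ, HasWeakGradient u v ∧
    ∀ K : Set (EuclideanSpace ℝ (Fin d)), IsCompact K → MemLp v 2 (volume.restrict K)

/-- The generalised `ψ`-Fisher information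
`∫ ψ''(f/f∞) ∇(g/f∞)ᵀ P ∇(g/f∞) f∞ dx ∈ [0,∞]` of a positive function `f` and a function `g`.
The gradient is the weak one. It is unique up to null sets, so that the infimum is over a single
value (and is `∞` if `g/f∞` has no weak gradient). -/
noncomputable def genFisherInfo {d : ℕ} (ψ : ℝ → ℝ) (P : Matrix (Fin d) (Fin d) ℝ)
    (f g fInf : EuclideanSpace ℝ (Fin d) → ℝ) : ℝ≥0∞ :=
  ⨅ (v : EuclideanSpace ℝ (Fin d) → Fin d → ℝ) (_ : HasWeakGradient (fun x => g x / fInf x) v),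
    ∫⁻ x, ENNReal.ofReal
      (iteratedDeriv 2 ψ (f x / fInf x) * (v x ⬝ᵥ (P *ᵥ v x)) * fInf x)

/-- The upper derivative `limsup_{s → t, s ≠ t} (F(s) - F(t)) / (s - t) ∈ [-∞,∞]`; it equals
`F'(t)` wherever `F` is differentiable. -/
noncomputable def upperDeriv (F : ℝ → ℝ) (t : ℝ) : EReal :=
  limsup (fun s => (((F s - F t) / (s - t) : ℝ) : EReal)) (𝓝[≠] t)

/-!
For the given drift the equilibrium `f∞` is the standard Gaussian density, and the quotient
`h = g / f∞` of a solution evolves by an Ornstein-Uhlenbeck semigroup, for which Mehler's formula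
`h(t, x) = E[h(s, A x + Y)]` holds, with `A = e^{-(t-s)Cᵀ}` and `Y` a centred Gaussian variable of
covariance `1 - A Aᵀ`. The decay of the Fisher information is a property of this transition
operator, so that no functional has to be differentiated in time.

* Differentiation under the expectation gives `∇h(t) = Aᵀ E[∇h(s)(A x + Y)]`, also for weak
  gradients (`HasWeakGradient.mehler`). The condition on `P` says that `Aᵀ = e^{-(t-s)C}` contracts the
  quadratic form of `P` by the factor `e^{-2λ(t-s)}` (`driftFlow_quadratic_le`).
* Admissibility of `ψ` means that `1 / ψ''` is concave, which makes `(u, v) ↦ ψ''(u) vᵀ P v` jointly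
  convex. Jensen's inequality (`IsEntropyGenerator.jensen`) therefore pulls the expectation out of
  the integrand.
* The Gaussian measure is invariant (`measurePreserving_mehler`), so that integration in `x` returns
  the Fisher information at time `s`.

This gives `I(t) ≤ e^{-2λ(t-s)} I(s)` for `t₀ ≤ s ≤ t` (`genFisherInfo_le_mul_exp`). The remaining
claims follow: from both sides of `t` the difference quotients of `I` are bounded by those of
`s ↦ e^{-2λ(s-t)} I(t)`, and a monotone function is differentiable almost everywhere.

Mehler's formula has to be established for an arbitrary solution in the class considered. This is
done by duality on the Fourier side. The plane waves `exp (|η|²/2 + i⟨η, x⟩)` solve the backward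
equation along `η' = Cᵀ η`, and truncating them on a logarithmic scale in `|x|` makes the truncation
error small even against the unbounded drift, for solutions that are merely in `L¹`. Hence
`exp (|η|²/2)` times the Fourier transform at `η` is conserved (`integral_mul_cexp_driftFlow`), and
the transition operator has the same effect on Fourier transforms (`integral_mehler_mul_cexp`). The
same conservation law, applied to the equilibrium as `t → ∞`, identifies `f∞`
(`IsEquilibrium.eq_gaussDensity`). The kernel condition on `D` enters through the nondegeneracy of
`1 - A Aᵀ` (`norm_driftFlow_lt`), which makes `f(t)` positive for every `t > 0`
(`IsFPSolution.ae_pos`).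
-/

/-! ### Cutoff functions -/

theorem partialDeriv_eq_of_hasFDerivAt {d : ℕ} {u : EuclideanSpace ℝ (Fin d) → ℝ}
    {x : EuclideanSpace ℝ (Fin d)} {u' : EuclideanSpace ℝ (Fin d) →L[ℝ] ℝ} (i : Fin d)
    (h : HasFDerivAt u u' x) : partialDeriv i u x = u' (EuclideanSpace.single i 1) := by
  rw [partialDeriv, h.fderiv]

/-- A smooth step, equal to `1` on `(-∞, 1]` and to `0` on `[2, ∞)`, with its first two derivatives
bounded. -/
theorem exists_smooth_step : ∃ σ : ℝ → ℝ, ∃ K : ℝ, ContDiff ℝ ∞ σ ∧ 0 < K ∧ (∀ r, 0 ≤ σ r) ∧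
    (∀ r, σ r ≤ 1) ∧ (∀ r ≤ 1, σ r = 1) ∧ (∀ r, 2 ≤ r → σ r = 0) ∧
    (∀ r, |deriv σ r| ≤ K) ∧ (∀ r, |deriv (deriv σ) r| ≤ K) := by
  set σ : ℝ → ℝ := fun r => Real.smoothTransition (2 - r) with hσ
  have hsm : ContDiff ℝ ∞ σ := Real.smoothTransition.contDiff.comp (contDiff_const.sub contDiff_id)
  have h1 : ∀ r ≤ 1, σ r = 1 := fun r hr => Real.smoothTransition.one_of_one_le (by linarith)
  have h2 : ∀ r, 2 ≤ r → σ r = 0 := fun r hr => Real.smoothTransition.zero_of_nonpos (by linarith)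
  have hsm1 : ContDiff ℝ ∞ (deriv σ) := (contDiff_infty_iff_deriv.mp hsm).2
  have hsupp : HasCompactSupport (deriv σ) := by
    refine HasCompactSupport.intro (isCompact_Icc (a := (1 : ℝ)) (b := 2)) fun r hr => ?_
    rw [mem_Icc, not_and_or, not_le, not_le] at hr
    rcases hr with hr | hr
    · have : σ =ᶠ[𝓝 r] fun _ => 1 := by
        filter_upwards [Iio_mem_nhds hr] with s hs using h1 s (le_of_lt hs)
      rw [this.deriv_eq, deriv_const]
    · have : σ =ᶠ[𝓝 r] fun _ => 0 := by
        filter_upwards [Ioi_mem_nhds hr] with s hs using h2 s (le_of_lt hs)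
      rw [this.deriv_eq, deriv_const]
  obtain ⟨K₁, hK₁⟩ := hsm1.continuous.bounded_above_of_compact_support hsupp
  obtain ⟨K₂, hK₂⟩ :=
    (hsm1.continuous_deriv (by simp)).bounded_above_of_compact_support hsupp.deriv
  refine ⟨σ, max 1 (max K₁ K₂), hsm, by positivity, fun r => Real.smoothTransition.nonneg _,
    fun r => Real.smoothTransition.le_one _, h1, h2, fun r => ?_, fun r => ?_⟩
  · exact (hK₁ r).trans (by simp)
  · exact (hK₂ r).trans (by simp)

theorem hasFDerivAt_log_one_add_norm_sq {d : ℕ} (x : EuclideanSpace ℝ (Fin d)) :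
    HasFDerivAt (fun y : EuclideanSpace ℝ (Fin d) => Real.log (1 + ‖y‖ ^ 2))
      ((1 + ‖x‖ ^ 2)⁻¹ • (2 • innerSL ℝ x)) x := by
  have h := ((hasStrictFDerivAt_norm_sq x).hasFDerivAt.const_add 1)
  exact h.log (by positivity)

theorem abs_coord_le_norm {d : ℕ} (x : EuclideanSpace ℝ (Fin d)) (i : Fin d) : |x i| ≤ ‖x‖ :=
  PiLp.norm_apply_le x i

/-- Cutoff functions with gradients so small that even the drift derivatives `x_j ∂ᵢ χ` are
uniformly small. They are functions of `ε log (1 + |x|²)`: a cutoff on a linear scale would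
leave `x_j ∂ᵢ χ` of order one. -/
theorem exists_cutoff {d : ℕ} (ε : ℝ) (hε : 0 < ε) (R : ℝ) :
    ∃ χ : EuclideanSpace ℝ (Fin d) → ℝ, ContDiff ℝ ∞ χ ∧ HasCompactSupport χ ∧
      (∀ x, 0 ≤ χ x) ∧ (∀ x, χ x ≤ 1) ∧ (∀ x, ‖x‖ ≤ R → χ x = 1) ∧
      (∀ i x, |partialDeriv i χ x| ≤ ε) ∧ (∀ i (j : Fin d) x, |x j * partialDeriv i χ x| ≤ ε) ∧
      (∀ i j x, |partialDeriv j (partialDeriv i χ) x| ≤ ε) := by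
  obtain ⟨σ, K, hσ, hK, h0, h1, hone, hzero, hd1, hd2⟩ := exists_smooth_step
  -- `8 K` bounds all derivatives below up to the factor `δ`, and the last condition makes the
  -- cutoff equal to `1` on the ball of radius `R`.
  obtain ⟨δ, hδ, hδ1, hδε, hδR⟩ : ∃ δ : ℝ, 0 < δ ∧ δ ≤ 1 ∧ δ * (8 * K) ≤ ε ∧
      δ * Real.log (1 + R ^ 2) ≤ 1 := by
    have hlog : 0 ≤ Real.log (1 + R ^ 2) := Real.log_nonneg (by nlinarith [sq_nonneg R])
    refine ⟨min 1 (min (ε / (8 * K)) (1 / (1 + Real.log (1 + R ^ 2)))), by positivity,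
      min_le_left _ _, ?_, ?_⟩
    · rw [← le_div_iff₀ (by positivity)]
      exact (min_le_right _ _).trans (min_le_left _ _)
    · calc _ ≤ (1 / (1 + Real.log (1 + R ^ 2))) * Real.log (1 + R ^ 2) := by
            gcongr; exact (min_le_right _ _).trans (min_le_right _ _)
        _ ≤ 1 := by rw [one_div, inv_mul_le_iff₀ (by positivity)]; linarith
  set ℓ : EuclideanSpace ℝ (Fin d) → ℝ := fun x => Real.log (1 + ‖x‖ ^ 2) with hℓ
  have hpos : ∀ x : EuclideanSpace ℝ (Fin d), 0 < 1 + ‖x‖ ^ 2 := fun x => by positivity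
  have hℓsm : ContDiff ℝ ∞ ℓ :=
    (contDiff_const.add (contDiff_norm_sq ℝ)).log fun x => (hpos x).ne'
  have hσ' : ContDiff ℝ ∞ (deriv σ) := (contDiff_infty_iff_deriv.mp hσ).2
  have hdσ : ∀ r, HasDerivAt σ (deriv σ r) r := fun r =>
    (hσ.differentiable (by simp) r).hasDerivAt
  have hdσ' : ∀ r, HasDerivAt (deriv σ) (deriv (deriv σ) r) r := fun r =>
    (hσ'.differentiable (by simp) r).hasDerivAt
  have hin : ∀ (x : EuclideanSpace ℝ (Fin d)) i, inner ℝ x (EuclideanSpace.single i 1) = x i := by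
    intro x i; simp [EuclideanSpace.inner_single_right]
  have hfirst : ∀ i, partialDeriv i (fun x => σ (δ * ℓ x)) =
      fun x => deriv σ (δ * ℓ x) * (δ * ((1 + ‖x‖ ^ 2)⁻¹ * (2 * x i))) := by
    intro i
    funext x
    have h := (hdσ (δ * ℓ x)).comp_hasFDerivAt x ((hasFDerivAt_log_one_add_norm_sq x).const_mul δ)
    rw [partialDeriv_eq_of_hasFDerivAt i (u := fun x => σ (δ * ℓ x)) h]
    simp [hin]
  have hb1 : ∀ (x : EuclideanSpace ℝ (Fin d)) i, |(1 + ‖x‖ ^ 2)⁻¹ * (2 * x i)| ≤ 1 := by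
    intro x i
    rw [abs_mul, abs_mul, abs_two, abs_of_pos (inv_pos.mpr (hpos x)), inv_mul_le_iff₀ (hpos x)]
    nlinarith [abs_coord_le_norm x i, sq_nonneg (‖x‖ - 1)]
  have hb2 : ∀ (x : EuclideanSpace ℝ (Fin d)) i j,
      |x j * ((1 + ‖x‖ ^ 2)⁻¹ * (2 * x i))| ≤ 2 := by
    intro x i j
    rw [abs_mul, abs_mul, abs_mul, abs_two, abs_of_pos (inv_pos.mpr (hpos x)), mul_left_comm,
      inv_mul_le_iff₀ (hpos x)]
    have := mul_le_mul (abs_coord_le_norm x i) (abs_coord_le_norm x j) (abs_nonneg _)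
      (norm_nonneg _)
    nlinarith
  have hsecond : ∀ i j x, partialDeriv j (partialDeriv i (fun x => σ (δ * ℓ x))) x =
      deriv (deriv σ) (δ * ℓ x) * (δ * ((1 + ‖x‖ ^ 2)⁻¹ * (2 * x j))) *
        (δ * ((1 + ‖x‖ ^ 2)⁻¹ * (2 * x i))) +
      deriv σ (δ * ℓ x) * (δ * ((1 + ‖x‖ ^ 2)⁻¹ * (2 * if i = j then 1 else 0) -
        ((1 + ‖x‖ ^ 2)⁻¹ * (2 * x j)) * ((1 + ‖x‖ ^ 2)⁻¹ * (2 * x i)))) := by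
    intro i j x
    rw [hfirst i]
    have ha := (hdσ' (δ * ℓ x)).comp_hasFDerivAt x
      ((hasFDerivAt_log_one_add_norm_sq x).const_mul δ)
    have hn := ((hasStrictFDerivAt_norm_sq x).hasFDerivAt.const_add 1)
    have hi := (hasDerivAt_inv (hpos x).ne').comp_hasFDerivAt x hn
    have hc : HasFDerivAt (fun y : EuclideanSpace ℝ (Fin d) => y i)
        (EuclideanSpace.proj i : EuclideanSpace ℝ (Fin d) →L[ℝ] ℝ) x :=
      (EuclideanSpace.proj i : EuclideanSpace ℝ (Fin d) →L[ℝ] ℝ).hasFDerivAt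
    have hb := (hi.mul (hc.const_mul 2)).const_mul δ
    have h := ha.mul hb
    refine (partialDeriv_eq_of_hasFDerivAt j (u := fun x =>
      deriv σ (δ * ℓ x) * (δ * ((1 + ‖x‖ ^ 2)⁻¹ * (2 * x i)))) h).trans ?_
    have hne := (hpos x).ne'
    simp [hin]
    split_ifs <;> field_simp <;> ring
  have hf : ∀ i x, |partialDeriv i (fun x => σ (δ * ℓ x)) x| ≤ ε := by
    intro i x
    rw [hfirst i, abs_mul, abs_mul, abs_of_pos hδ]
    calc _ ≤ K * (δ * 1) := by gcongr; exacts [hd1 _, hb1 x i]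
      _ ≤ ε := by nlinarith [mul_pos hδ hK]
  refine ⟨fun x => σ (δ * ℓ x), hσ.comp (contDiff_const.mul hℓsm), ?_, fun x => h0 _,
    fun x => h1 _, fun x hx => hone _ ?_, hf, ?_, ?_⟩
  · refine HasCompactSupport.intro (isCompact_closedBall 0 (Real.exp (2 / δ))) fun x hx => ?_
    apply hzero
    rw [Metric.mem_closedBall, dist_zero_right, not_le] at hx
    rw [← div_le_iff₀' hδ]
    refine (Real.le_log_iff_exp_le (hpos x)).mpr ?_
    nlinarith [sq_nonneg (‖x‖ - 1)]
  · refine le_trans ?_ hδR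
    have : ‖x‖ ^ 2 ≤ R ^ 2 := pow_le_pow_left₀ (norm_nonneg x) hx 2
    exact mul_le_mul_of_nonneg_left (Real.log_le_log (hpos x) (by linarith)) hδ.le
  · intro i j x
    rw [hfirst i]
    calc _ = |deriv σ (δ * ℓ x)| * (δ * |x j * ((1 + ‖x‖ ^ 2)⁻¹ * (2 * x i))|) := by
          rw [← abs_of_pos hδ, ← abs_mul, ← abs_mul, abs_of_pos hδ]; congr 1; ring
      _ ≤ K * (δ * 2) := by gcongr; exacts [hd1 _, hb2 x i j]
      _ ≤ ε := by nlinarith [mul_pos hδ hK]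
  · intro i j x
    rw [hsecond]
    have hm : |(1 + ‖x‖ ^ 2)⁻¹ * (2 * if i = j then (1 : ℝ) else 0) -
        ((1 + ‖x‖ ^ 2)⁻¹ * (2 * x j)) * ((1 + ‖x‖ ^ 2)⁻¹ * (2 * x i))| ≤ 3 := by
      refine (abs_sub _ _).trans ?_
      have e1 : |(1 + ‖x‖ ^ 2)⁻¹ * (2 * if i = j then (1 : ℝ) else 0)| ≤ 2 := by
        rw [abs_mul, abs_of_pos (inv_pos.mpr (hpos x)), inv_mul_le_iff₀ (hpos x)]
        split_ifs
        · simp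
        · simp
          nlinarith [sq_nonneg ‖x‖]
      have e2 : |((1 + ‖x‖ ^ 2)⁻¹ * (2 * x j)) * ((1 + ‖x‖ ^ 2)⁻¹ * (2 * x i))| ≤ 1 := by
        rw [abs_mul]
        exact mul_le_one₀ (hb1 x j) (abs_nonneg _) (hb1 x i)
      linarith
    have hj := hb1 x j
    have hi := hb1 x i
    generalize (1 + ‖x‖ ^ 2)⁻¹ * (2 * x j) = a at hj hm ⊢
    generalize (1 + ‖x‖ ^ 2)⁻¹ * (2 * x i) = b at hi hm ⊢
    generalize (1 + ‖x‖ ^ 2)⁻¹ * (2 * if i = j then (1 : ℝ) else 0) - a * b = c at hm ⊢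
    refine (abs_add_le _ _).trans ?_
    simp only [abs_mul, abs_of_pos hδ]
    calc _ ≤ K * (δ * 1) * (δ * 1) + K * (δ * 3) := by
          gcongr
          exacts [hd2 _, hd1 _]
      _ ≤ ε := by nlinarith [mul_pos hδ hK, mul_pos (mul_pos hδ hK) hδ]

/-! ### The adjoint operator and plane waves -/

theorem ContDiff.partialDeriv {d : ℕ} {u : EuclideanSpace ℝ (Fin d) → ℝ} {n m : WithTop ℕ∞}
    (hu : ContDiff ℝ n u) (hmn : m + 1 ≤ n) (i : Fin d) : ContDiff ℝ m (partialDeriv i u) :=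
  (hu.fderiv_right hmn).clm_apply contDiff_const

theorem partialDeriv_mul {d : ℕ} {u v : EuclideanSpace ℝ (Fin d) → ℝ}
    (hu : Differentiable ℝ u) (hv : Differentiable ℝ v) (i : Fin d) :
    partialDeriv i (fun x => u x * v x) =
      fun x => u x * partialDeriv i v x + v x * partialDeriv i u x := by
  funext x
  have h := partialDeriv_eq_of_hasFDerivAt i ((hu x).hasFDerivAt.mul (hv x).hasFDerivAt)
  refine h.trans ?_
  simp [partialDeriv]

theorem HasCompactSupport.partialDeriv {d : ℕ} {u : EuclideanSpace ℝ (Fin d) → ℝ}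
    (hu : HasCompactSupport u) (i : Fin d) : HasCompactSupport (partialDeriv i u) :=
  hu.fderiv_apply ℝ _

theorem integral_mul_partialDeriv {d : ℕ} {u θ : EuclideanSpace ℝ (Fin d) → ℝ}
    (hu : ContDiff ℝ 1 u) (hθ : ContDiff ℝ 1 θ) (hs : HasCompactSupport θ) (i : Fin d) :
    ∫ x, u x * partialDeriv i θ x = - ∫ x, partialDeriv i u x * θ x := by
  have hu' : Continuous (partialDeriv i u) := (hu.partialDeriv (m := 0) (by simp) i).continuous
  have hθ' : Continuous (partialDeriv i θ) := (hθ.partialDeriv (m := 0) (by simp) i).continuous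
  refine integral_mul_fderiv_eq_neg_fderiv_mul_of_integrable ?_ ?_ ?_
    (fun x _ => hu.differentiable (by simp) x) (fun x _ => hθ.differentiable (by simp) x)
  · exact (hu'.mul hθ.continuous).integrable_of_hasCompactSupport hs.mul_left
  · exact (hu.continuous.mul hθ').integrable_of_hasCompactSupport (hs.partialDeriv i).mul_left
  · exact (hu.continuous.mul hθ.continuous).integrable_of_hasCompactSupport hs.mul_left

/-- The formal adjoint `div (D ∇θ) - C x · ∇θ` of the Fokker-Planck operator. -/
noncomputable def fpAdjoint {d : ℕ} (D C : Matrix (Fin d) (Fin d) ℝ)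
    (θ : EuclideanSpace ℝ (Fin d) → ℝ) (x : EuclideanSpace ℝ (Fin d)) : ℝ :=
  ∑ i, ∑ j, (D i j * partialDeriv j (partialDeriv i θ) x - C i j * (x j * partialDeriv i θ x))

theorem contDiff_fpFlux {d : ℕ} (D C : Matrix (Fin d) (Fin d) ℝ)
    {u : EuclideanSpace ℝ (Fin d) → ℝ} (hu : ContDiff ℝ 2 u) (i : Fin d) :
    ContDiff ℝ 1 (fun x => fpFlux D C u x i) := by
  have hc : ∀ j : Fin d, ContDiff ℝ 1 fun x : EuclideanSpace ℝ (Fin d) => x j := fun j =>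
    (EuclideanSpace.proj j : EuclideanSpace ℝ (Fin d) →L[ℝ] ℝ).contDiff
  have hp : ∀ j : Fin d, ContDiff ℝ 1 (partialDeriv j u) := fun j =>
    hu.partialDeriv (by norm_num) j
  simp only [fpFlux, Pi.add_apply, Pi.smul_apply, Matrix.mulVec, dotProduct, smul_eq_mul]
  refine (ContDiff.sum fun j _ => contDiff_const.mul (hp j)).add
    ((hu.of_le (by norm_num)).mul (ContDiff.sum fun j _ => contDiff_const.mul (hc j)))

theorem continuous_fpOperator {d : ℕ} (D C : Matrix (Fin d) (Fin d) ℝ)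
    {u : EuclideanSpace ℝ (Fin d) → ℝ} (hu : ContDiff ℝ 2 u) : Continuous (fpOperator D C u) := by
  unfold fpOperator
  exact continuous_finsetSum _ fun i _ =>
    ((contDiff_fpFlux D C hu i).partialDeriv (m := 0) (by simp) i).continuous

theorem continuous_fpAdjoint {d : ℕ} (D C : Matrix (Fin d) (Fin d) ℝ)
    {θ : EuclideanSpace ℝ (Fin d) → ℝ} (hθ : ContDiff ℝ 2 θ) : Continuous (fpAdjoint D C θ) := by
  unfold fpAdjoint
  refine continuous_finsetSum _ fun i _ => continuous_finsetSum _ fun j _ => ?_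
  have h1 : ContDiff ℝ 1 (partialDeriv i θ) := hθ.partialDeriv (by norm_num) i
  have h2 : Continuous (partialDeriv j (partialDeriv i θ)) :=
    (h1.partialDeriv (m := 0) (by simp) j).continuous
  have h3 := h1.continuous
  fun_prop

/-- Integration by parts against a compactly supported test function. -/
theorem integral_fpOperator_mul {d : ℕ} (D C : Matrix (Fin d) (Fin d) ℝ)
    {u θ : EuclideanSpace ℝ (Fin d) → ℝ} (hu : ContDiff ℝ 2 u) (hθ : ContDiff ℝ 2 θ)
    (hs : HasCompactSupport θ) :
    ∫ x, fpOperator D C u x * θ x = ∫ x, u x * fpAdjoint D C θ x := by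
  have hθ1 : ContDiff ℝ 1 θ := hθ.of_le (by norm_num)
  have hu1 : ContDiff ℝ 1 u := hu.of_le (by norm_num)
  have hθi : ∀ i, ContDiff ℝ 1 (partialDeriv i θ) := fun i => hθ.partialDeriv (by norm_num) i
  have hθij : ∀ i j, Continuous (partialDeriv j (partialDeriv i θ)) := fun i j =>
    ((hθi i).partialDeriv (m := 0) (by simp) j).continuous
  have hui : ∀ i, Continuous (partialDeriv i u) := fun i =>
    (hu1.partialDeriv (m := 0) (by simp) i).continuous
  have hfl := fun i => contDiff_fpFlux D C hu i
  have hsi := fun i => hs.partialDeriv i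
  have hsij := fun i j => (hsi i).partialDeriv j
  have e1 : ∀ i, ∫ x, partialDeriv i (fun y => fpFlux D C u y i) x * θ x =
      - ∫ x, fpFlux D C u x i * partialDeriv i θ x := fun i => by
    rw [integral_mul_partialDeriv (hfl i) hθ1 hs i, neg_neg]
  have e2 : ∀ i j, ∫ x, partialDeriv j u x * partialDeriv i θ x =
      - ∫ x, u x * partialDeriv j (partialDeriv i θ) x := fun i j => by
    rw [integral_mul_partialDeriv hu1 (hθi i) (hsi i) j, neg_neg]
  have hcx : ∀ j : Fin d, Continuous fun x : EuclideanSpace ℝ (Fin d) => x j := fun j => by fun_prop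
  have hI1 : ∀ i j, Integrable (fun x => D i j * (partialDeriv j u x * partialDeriv i θ x)) :=
    fun i j => (((hui j).mul (hθi i).continuous).integrable_of_hasCompactSupport
      (hsi i).mul_left).const_mul _
  have hI2 : ∀ i j, Integrable (fun x => C i j * (u x * (x j * partialDeriv i θ x))) :=
    fun i j => ((hu.continuous.mul ((hcx j).mul
      (hθi i).continuous)).integrable_of_hasCompactSupport (hsi i).mul_left.mul_left).const_mul _
  have hI3 : ∀ i j, Integrable (fun x => D i j * (u x * partialDeriv j (partialDeriv i θ) x)) :=
    fun i j => ((hu.continuous.mul (hθij i j)).integrable_of_hasCompactSupport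
      (hsij i j).mul_left).const_mul _
  have hI4 : ∀ i j, Integrable (fun x => D i j * (u x * partialDeriv j (partialDeriv i θ) x) -
      C i j * (u x * (x j * partialDeriv i θ x))) := fun i j => (hI3 i j).sub (hI2 i j)
  have e3 : ∀ i, ∫ x, fpFlux D C u x i * partialDeriv i θ x =
      ∑ j, (- (D i j * ∫ x, u x * partialDeriv j (partialDeriv i θ) x) +
        C i j * ∫ x, u x * (x j * partialDeriv i θ x)) := by
    intro i
    have : ∀ x, fpFlux D C u x i * partialDeriv i θ x =
        ∑ j, (D i j * (partialDeriv j u x * partialDeriv i θ x) +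
          C i j * (u x * (x j * partialDeriv i θ x))) := by
      intro x
      simp only [fpFlux, Pi.add_apply, Pi.smul_apply, Matrix.mulVec, dotProduct, smul_eq_mul,
        Finset.sum_add_distrib, add_mul, Finset.sum_mul, Finset.mul_sum]
      congr 1 <;> exact Finset.sum_congr rfl fun j _ => by ring
    simp_rw [this]
    rw [integral_finsetSum _ fun j _ => (hI1 i j).fun_add (hI2 i j)]
    refine Finset.sum_congr rfl fun j _ => ?_
    rw [integral_add (hI1 i j) (hI2 i j), integral_const_mul, integral_const_mul, e2]
    ring
  calc ∫ x, fpOperator D C u x * θ x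
      = ∑ i, ∫ x, partialDeriv i (fun y => fpFlux D C u y i) x * θ x := by
        simp_rw [fpOperator, Finset.sum_mul]
        refine integral_finsetSum _ fun i _ => ?_
        exact ((((hfl i).partialDeriv (m := 0) (by simp) i).continuous).mul
          hθ.continuous).integrable_of_hasCompactSupport hs.mul_left
    _ = ∑ i, ∑ j, (D i j * (∫ x, u x * partialDeriv j (partialDeriv i θ) x) -
        C i j * ∫ x, u x * (x j * partialDeriv i θ x)) := by
        refine Finset.sum_congr rfl fun i _ => ?_
        rw [e1, e3, ← Finset.sum_neg_distrib]
        exact Finset.sum_congr rfl fun j _ => by ring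
    _ = ∫ x, u x * fpAdjoint D C θ x := by
        have : ∀ x, u x * fpAdjoint D C θ x =
            ∑ i, ∑ j, (D i j * (u x * partialDeriv j (partialDeriv i θ) x) -
              C i j * (u x * (x j * partialDeriv i θ x))) := by
          intro x
          simp only [fpAdjoint, Finset.mul_sum]
          exact Finset.sum_congr rfl fun i _ => Finset.sum_congr rfl fun j _ => by ring
        simp_rw [this]
        rw [integral_finsetSum _ fun i _ => integrable_finsetSum _ fun j _ =>
          hI4 i j]
        refine Finset.sum_congr rfl fun i _ => ?_
        rw [integral_finsetSum _ fun j _ => hI4 i j]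
        refine Finset.sum_congr rfl fun j _ => ?_
        rw [integral_sub (hI3 i j) (hI2 i j), integral_const_mul, integral_const_mul]

theorem fpAdjoint_mul {d : ℕ} (D C : Matrix (Fin d) (Fin d) ℝ)
    {χ φ : EuclideanSpace ℝ (Fin d) → ℝ} (hχ : ContDiff ℝ 2 χ) (hφ : ContDiff ℝ 2 φ)
    (x : EuclideanSpace ℝ (Fin d)) :
    fpAdjoint D C (fun y => χ y * φ y) x =
      χ x * fpAdjoint D C φ x + φ x * fpAdjoint D C χ x +
        ∑ i, ∑ j, D i j * (partialDeriv j χ x * partialDeriv i φ x +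
          partialDeriv i χ x * partialDeriv j φ x) := by
  have hχ0 := hχ.differentiable (by norm_num)
  have hφ0 := hφ.differentiable (by norm_num)
  have hχi := fun i => (hχ.partialDeriv (m := 1) (by norm_num) i).differentiable (by norm_num)
  have hφi := fun i => (hφ.partialDeriv (m := 1) (by norm_num) i).differentiable (by norm_num)
  simp only [fpAdjoint, Finset.mul_sum, ← Finset.sum_add_distrib]
  refine Finset.sum_congr rfl fun i _ => Finset.sum_congr rfl fun j _ => ?_
  rw [partialDeriv_mul hχ0 hφ0 i]
  have : partialDeriv j (fun x => χ x * partialDeriv i φ x + φ x * partialDeriv i χ x) x =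
      (χ x * partialDeriv j (partialDeriv i φ) x + partialDeriv i φ x * partialDeriv j χ x) +
      (φ x * partialDeriv j (partialDeriv i χ) x + partialDeriv i χ x * partialDeriv j φ x) := by
    rw [← congrFun (partialDeriv_mul hχ0 (hφi i) j) x,
      ← congrFun (partialDeriv_mul hφ0 (hχi i) j) x]
    exact congrArg (fun L : EuclideanSpace ℝ (Fin d) →L[ℝ] ℝ => L (EuclideanSpace.single j 1))
      (fderiv_fun_add ((hχ0.fun_mul (hφi i)) x) ((hφ0.fun_mul (hχi i)) x))
  rw [this]
  ring

/-- The plane wave `exp (|η|²/2) cos (⟨η, x⟩ + θ)`. Along a trajectory of `η' = Cᵀ η` it solves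
the backward equation `∂ₜ W + L* W = 0`. -/
noncomputable def planeWave {d : ℕ} (η : EuclideanSpace ℝ (Fin d)) (θ : ℝ)
    (x : EuclideanSpace ℝ (Fin d)) : ℝ :=
  Real.exp (‖η‖ ^ 2 / 2) * Real.cos (inner ℝ η x + θ)

theorem contDiff_planeWave {d : ℕ} (η : EuclideanSpace ℝ (Fin d)) (θ : ℝ) :
    ContDiff ℝ ∞ (planeWave η θ) := by
  unfold planeWave
  exact contDiff_const.mul (Real.contDiff_cos.comp
    ((contDiff_const.inner ℝ contDiff_id).add contDiff_const))

theorem abs_planeWave_le {d : ℕ} (η : EuclideanSpace ℝ (Fin d)) (θ : ℝ)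
    (x : EuclideanSpace ℝ (Fin d)) : |planeWave η θ x| ≤ Real.exp (‖η‖ ^ 2 / 2) := by
  rw [planeWave, abs_mul, Real.abs_exp]
  exact mul_le_of_le_one_right (Real.exp_pos _).le (Real.abs_cos_le_one _)

theorem partialDeriv_planeWave {d : ℕ} (η : EuclideanSpace ℝ (Fin d)) (θ : ℝ) (i : Fin d) :
    partialDeriv i (planeWave η θ) = fun x => η i * planeWave η (θ + Real.pi / 2) x := by
  funext x
  have h1 : HasFDerivAt (fun y : EuclideanSpace ℝ (Fin d) => inner ℝ η y + θ) (innerSL ℝ η) x :=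
    (innerSL ℝ η).hasFDerivAt.add_const θ
  have h := h1.cos.const_mul (Real.exp (‖η‖ ^ 2 / 2))
  rw [partialDeriv_eq_of_hasFDerivAt i (u := planeWave η θ) h]
  simp only [planeWave, ← add_assoc, Real.cos_add_pi_div_two]
  simp [EuclideanSpace.inner_single_right]
  ring

theorem fpAdjoint_planeWave {d : ℕ} (D C : Matrix (Fin d) (Fin d) ℝ)
    (η : EuclideanSpace ℝ (Fin d)) (θ : ℝ) (x : EuclideanSpace ℝ (Fin d)) :
    fpAdjoint D C (planeWave η θ) x =
      - (∑ i, ∑ j, D i j * η i * η j) * planeWave η θ x -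
        (∑ i, ∑ j, C i j * x j * η i) * planeWave η (θ + Real.pi / 2) x := by
  have h2 : ∀ i j, partialDeriv j (partialDeriv i (planeWave η θ)) x =
      - (η i * η j) * planeWave η θ x := by
    intro i j
    rw [partialDeriv_planeWave]
    have := partialDeriv_eq_of_hasFDerivAt j
      ((((contDiff_planeWave η (θ + Real.pi / 2)).differentiable (by simp) x).hasFDerivAt).const_mul
        (η i))
    refine this.trans ?_
    have h3 := congrFun (partialDeriv_planeWave η (θ + Real.pi / 2) j) x
    rw [partialDeriv] at h3
    simp only [smul_apply, smul_eq_mul, h3, planeWave, ← add_assoc,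
      Real.cos_add_pi_div_two, Real.sin_add_pi_div_two]
    ring
  simp only [fpAdjoint, h2]
  simp only [partialDeriv_planeWave, Finset.sum_mul, ← Finset.sum_neg_distrib,
    ← Finset.sum_sub_distrib]
  refine Finset.sum_congr rfl fun i _ => Finset.sum_congr rfl fun j _ => ?_
  ring

/-! ### Evolution of the Fourier transform of a solution -/

theorem IsFPSolution.contDiff {d : ℕ} {D C : Matrix (Fin d) (Fin d) ℝ}
    {f₀ : EuclideanSpace ℝ (Fin d) → ℝ} {f : ℝ → EuclideanSpace ℝ (Fin d) → ℝ}
    (hf : IsFPSolution D C f₀ f) {t : ℝ} (ht : 0 < t) : ContDiff ℝ 2 (f t) := by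
  rw [← contDiffOn_univ]
  exact hf.contDiffOn.comp (f := fun x => (t, x)) (contDiff_prodMk_right t).contDiffOn
    fun x _ => ⟨ht, mem_univ x⟩

/-- Joint continuity of `L f` in time and space. By the equation, `L f` is the time derivative of
the `C²` function `f`. -/
theorem IsFPSolution.continuousOn_fpOperator {d : ℕ} {D C : Matrix (Fin d) (Fin d) ℝ}
    {f₀ : EuclideanSpace ℝ (Fin d) → ℝ} {f : ℝ → EuclideanSpace ℝ (Fin d) → ℝ}
    (hf : IsFPSolution D C f₀ f) :
    ContinuousOn (fun p : ℝ × EuclideanSpace ℝ (Fin d) => fpOperator D C (f p.1) p.2)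
      (Ioi (0 : ℝ) ×ˢ (univ : Set (EuclideanSpace ℝ (Fin d)))) := by
  have hopen : IsOpen (Ioi (0 : ℝ) ×ˢ (univ : Set (EuclideanSpace ℝ (Fin d)))) :=
    isOpen_Ioi.prod isOpen_univ
  have h := hf.contDiffOn.continuousOn_fderiv_of_isOpen hopen (by norm_num)
  refine (h.clm_apply (continuousOn_const
    (c := ((1 : ℝ), (0 : EuclideanSpace ℝ (Fin d)))))).congr ?_
  rintro ⟨t, x⟩ ⟨ht, hx⟩
  have hd : DifferentiableAt ℝ (fun p : ℝ × EuclideanSpace ℝ (Fin d) => f p.1 p.2) (t, x) :=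
    (hf.contDiffOn.contDiffAt (hopen.mem_nhds ⟨ht, hx⟩)).differentiableAt (by norm_num)
  have hc : HasDerivAt (fun s : ℝ => (s, x)) ((1 : ℝ), (0 : EuclideanSpace ℝ (Fin d))) t :=
    (hasDerivAt_id t).prodMk (hasDerivAt_const t x)
  exact (hf.equation t ht x).unique
    (HasFDerivAt.comp_hasDerivAt (f := fun s : ℝ => (s, x)) t hd.hasFDerivAt hc)

/-- Differentiation under the integral sign for a time-dependent function that vanishes outside a
fixed compact set. -/
theorem hasDerivAt_integral_of_eq_zero_off_compact {E : Type*} [TopologicalSpace E]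
    [MeasurableSpace E] [OpensMeasurableSpace E] [T2Space E] {μ : Measure E}
    [IsFiniteMeasureOnCompacts μ]
    {G G' : ℝ → E → ℝ} {K : Set E} (hK : IsCompact K)
    (hG : ∀ t, 0 < t → Continuous (G t))
    (hG' : ContinuousOn (fun p : ℝ × E => G' p.1 p.2) (Ioi (0 : ℝ) ×ˢ univ))
    (hG0 : ∀ t x, x ∉ K → G t x = 0) (hG0' : ∀ t x, x ∉ K → G' t x = 0)
    (hd : ∀ t, 0 < t → ∀ x, HasDerivAt (fun s => G s x) (G' t x) t) {t : ℝ} (ht : 0 < t) :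
    HasDerivAt (fun s => ∫ x, G s x ∂μ) (∫ x, G' t x ∂μ) t := by
  have hset : ∀ H : E → ℝ, (∀ x, x ∉ K → H x = 0) → ∫ x, H x ∂μ = ∫ x in K, H x ∂μ := fun H hH =>
    (setIntegral_eq_integral_of_forall_compl_eq_zero hH).symm
  simp_rw [hset _ (hG0 _), hset _ (hG0' _)]
  obtain ⟨M, hM⟩ := (isCompact_Icc (a := t / 2) (b := 2 * t) |>.prod
    hK).exists_bound_of_continuousOn (hG'.mono (prod_mono (fun s hs => lt_of_lt_of_le (by linarith) hs.1) (subset_univ K)))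
  have hnhds : Icc (t / 2) (2 * t) ∈ 𝓝 t := Icc_mem_nhds (by linarith) (by linarith)
  have : IsFiniteMeasure (μ.restrict K) := ⟨by simpa using hK.measure_lt_top⟩
  have hcont : ∀ s, 0 < s → Continuous (G' s) := fun s hs => by
    rw [← continuousOn_univ]
    exact hG'.comp (f := fun x => (s, x)) (by fun_prop) fun x _ => ⟨hs, mem_univ x⟩
  refine (hasDerivAt_integral_of_dominated_loc_of_deriv_le (F := G) (F' := G')
    (bound := fun _ => M) hnhds ?_ ?_ ?_ ?_ (integrable_const M) ?_).2
  · filter_upwards [Ioi_mem_nhds ht] with s hs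
    exact (hG s hs).continuousOn.aestronglyMeasurable_of_isCompact hK hK.measurableSet
  · exact (hG t ht).continuousOn.integrableOn_compact hK
  · exact (hcont t ht).continuousOn.aestronglyMeasurable_of_isCompact hK hK.measurableSet
  · refine (ae_restrict_iff' hK.measurableSet).mpr (Eventually.of_forall fun x hx s hs => ?_)
    exact hM (s, x) ⟨hs, hx⟩
  · refine Eventually.of_forall fun x s hs => hd s (lt_of_lt_of_le (by linarith) hs.1) x

theorem IsFPSolution.continuousOn_integral_abs {d : ℕ} {D C : Matrix (Fin d) (Fin d) ℝ}
    {f₀ : EuclideanSpace ℝ (Fin d) → ℝ} {f : ℝ → EuclideanSpace ℝ (Fin d) → ℝ}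
    (hf : IsFPSolution D C f₀ f) : ContinuousOn (fun t => ∫ x, |f t x|) (Ici 0) := by
  intro t ht
  have h0 : Tendsto (fun s => ∫ x, |f s x - f t x|) (𝓝[Ici 0] t) (𝓝 0) := by
    have h := (ENNReal.tendsto_toReal ENNReal.zero_ne_top).comp (hf.continuous_L1 t ht)
    refine h.congr' ?_
    filter_upwards [self_mem_nhdsWithin] with s hs
    have hi := (hf.integrable s hs).sub (hf.integrable t ht)
    simp only [Function.comp_apply]
    rw [eLpNorm_one_eq_lintegral_enorm]
    exact (integral_norm_eq_lintegral_enorm hi.aestronglyMeasurable).symm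
  rw [ContinuousWithinAt, tendsto_iff_dist_tendsto_zero]
  refine squeeze_zero' (Eventually.of_forall fun _ => dist_nonneg) ?_ h0
  filter_upwards [self_mem_nhdsWithin] with s hs
  rw [Real.dist_eq, ← integral_sub (hf.integrable s hs).abs (hf.integrable t ht).abs]
  refine (abs_integral_le_integral_abs).trans (integral_mono_of_nonneg
    (Eventually.of_forall fun _ => abs_nonneg _)
    ((hf.integrable s hs).sub (hf.integrable t ht)).abs
    (Eventually.of_forall fun x => abs_abs_sub_abs_le _ _))

/-- Convergence of the pairing of an `L¹`-convergent family with a bounded, pointwise convergent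
family of functions. -/
theorem IsFPSolution.tendsto_integral_mul {d : ℕ} {D C : Matrix (Fin d) (Fin d) ℝ}
    {f₀ : EuclideanSpace ℝ (Fin d) → ℝ} {f : ℝ → EuclideanSpace ℝ (Fin d) → ℝ}
    (hf : IsFPSolution D C f₀ f) {t : ℝ} (ht : 0 ≤ t) {W : ℝ → EuclideanSpace ℝ (Fin d) → ℝ}
    {B : ℝ} (hW : ∀ s, Continuous (W s)) (hB : ∀ᶠ s in 𝓝[Ici 0] t, ∀ x, |W s x| ≤ B)
    (hlim : ∀ x, Tendsto (fun s => W s x) (𝓝[Ici 0] t) (𝓝 (W t x))) :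
    Tendsto (fun s => ∫ x, f s x * W s x) (𝓝[Ici 0] t) (𝓝 (∫ x, f t x * W t x)) := by
  have hBt : ∀ x, |W t x| ≤ B := hB.self_of_nhdsWithin ht
  have h0 : Tendsto (fun s => B * ∫ x, |f s x - f t x|) (𝓝[Ici 0] t) (𝓝 0) := by
    have h := ((ENNReal.tendsto_toReal ENNReal.zero_ne_top).comp
      (hf.continuous_L1 t ht)).const_mul B
    rw [ENNReal.toReal_zero, mul_zero] at h
    refine h.congr' ?_
    filter_upwards [self_mem_nhdsWithin] with s hs
    have hi := (hf.integrable s hs).sub (hf.integrable t ht)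
    simp only [Function.comp_apply]
    rw [eLpNorm_one_eq_lintegral_enorm]
    exact congrArg (B * ·) (integral_norm_eq_lintegral_enorm hi.aestronglyMeasurable).symm
  have h1 : Tendsto (fun s => ∫ x, f t x * W s x) (𝓝[Ici 0] t) (𝓝 (∫ x, f t x * W t x)) := by
    refine tendsto_integral_filter_of_dominated_convergence (fun x => |f t x| * B) ?_ ?_
      ((hf.integrable t ht).abs.mul_const B) ?_
    · exact Eventually.of_forall fun s =>
        (hf.integrable t ht).aestronglyMeasurable.mul (hW s).aestronglyMeasurable
    · filter_upwards [hB] with s hs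
      refine Eventually.of_forall fun x => ?_
      rw [Real.norm_eq_abs, abs_mul]
      exact mul_le_mul_of_nonneg_left (hs x) (abs_nonneg _)
    · exact Eventually.of_forall fun x => (hlim x).const_mul _
  have h2 : Tendsto (fun s => ∫ x, (f s x - f t x) * W s x) (𝓝[Ici 0] t) (𝓝 0) := by
    refine squeeze_zero_norm' ?_ h0
    filter_upwards [self_mem_nhdsWithin, hB] with s hs hBs
    rw [← integral_const_mul]
    refine (norm_integral_le_integral_norm _).trans (integral_mono_of_nonneg
      (Eventually.of_forall fun _ => norm_nonneg _)
      (((hf.integrable s hs).sub (hf.integrable t ht)).abs.const_mul B)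
      (Eventually.of_forall fun x => ?_))
    simp only [Real.norm_eq_abs, abs_mul]
    rw [mul_comm]
    exact mul_le_mul_of_nonneg_right (hBs x) (abs_nonneg _)
  have h3 := h2.add h1
  rw [zero_add] at h3
  refine h3.congr' ?_
  filter_upwards [self_mem_nhdsWithin, hB] with s hs hBs
  have hb : ∀ u : EuclideanSpace ℝ (Fin d) → ℝ, Integrable u → Integrable (fun x => u x * W s x) :=
    fun u hu => hu.mul_bdd (c := B) (hW s).aestronglyMeasurable (Eventually.of_forall hBs)
  rw [← integral_add (hb (fun x => f s x - f t x) ((hf.integrable s hs).sub (hf.integrable t ht)))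
    (hb _ (hf.integrable t ht))]
  refine integral_congr_ae (Eventually.of_forall fun x => ?_)
  ring

theorem fpAdjoint_eq_zero_of_notMem_tsupport {d : ℕ} (D C : Matrix (Fin d) (Fin d) ℝ)
    {θ : EuclideanSpace ℝ (Fin d) → ℝ} {x : EuclideanSpace ℝ (Fin d)} (hx : x ∉ tsupport θ) :
    fpAdjoint D C θ x = 0 := by
  have hsub : ∀ i (u : EuclideanSpace ℝ (Fin d) → ℝ), tsupport (partialDeriv i u) ⊆ tsupport u :=
    fun i u => tsupport_fderiv_apply_subset ℝ _
  have h1 : ∀ i, partialDeriv i θ x = 0 := fun i =>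
    image_eq_zero_of_notMem_tsupport fun h => hx (hsub i θ h)
  have h2 : ∀ i j, partialDeriv j (partialDeriv i θ) x = 0 := fun i j =>
    image_eq_zero_of_notMem_tsupport fun h => hx (hsub i θ (hsub j _ h))
  simp [fpAdjoint, h1, h2]

/-- The time derivative of the plane wave along a curve `η` with velocity `η'`. -/
noncomputable def planeWaveDeriv {d : ℕ} (η η' : EuclideanSpace ℝ (Fin d)) (θ : ℝ)
    (x : EuclideanSpace ℝ (Fin d)) : ℝ :=
  inner ℝ η η' * planeWave η θ x + inner ℝ η' x * planeWave η (θ + Real.pi / 2) x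

theorem hasDerivAt_planeWave {d : ℕ} {η : ℝ → EuclideanSpace ℝ (Fin d)}
    {η' : EuclideanSpace ℝ (Fin d)} {t : ℝ} (hη : HasDerivAt η η' t) (θ : ℝ)
    (x : EuclideanSpace ℝ (Fin d)) :
    HasDerivAt (fun s => planeWave (η s) θ x) (planeWaveDeriv (η t) η' θ x) t := by
  have h1 : HasDerivAt (fun r => ‖η r‖ ^ 2 / 2) (2 * inner ℝ (η t) η' / 2) t :=
    hη.norm_sq.div_const 2
  have h2 : HasDerivAt (fun r => inner ℝ (η r) x + θ) (inner ℝ η' x) t := by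
    simpa using (hη.inner ℝ (hasDerivAt_const t x)).add_const θ
  refine (h1.exp.mul h2.cos).congr_deriv ?_
  simp only [planeWaveDeriv, planeWave, ← add_assoc, Real.cos_add_pi_div_two]
  ring

/-- The plane wave solves the backward equation along `η' = Cᵀ η`. The first order terms cancel by
the choice of the curve, and the zeroth order terms because `⟨η, Cᵀ η⟩ = ⟨η, D η⟩`. -/
theorem fpAdjoint_planeWave_add_planeWaveDeriv {d : ℕ} {D C : Matrix (Fin d) (Fin d) ℝ}
    (hsymm : D = (1 / 2 : ℝ) • (C + Cᵀ)) (η : EuclideanSpace ℝ (Fin d)) (θ : ℝ)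
    (x : EuclideanSpace ℝ (Fin d)) :
    fpAdjoint D C (planeWave η θ) x +
      planeWaveDeriv η (Matrix.toEuclideanCLM (𝕜 := ℝ) Cᵀ η) θ x = 0 := by
  have hi : inner ℝ η (Matrix.toEuclideanCLM (𝕜 := ℝ) Cᵀ η) = ∑ i, ∑ j, C j i * η i * η j := by
    simp only [PiLp.inner_apply, Matrix.ofLp_toEuclideanCLM, Matrix.mulVec, dotProduct,
      Matrix.transpose_apply, RCLike.inner_apply, conj_trivial, Finset.sum_mul]
    exact Finset.sum_congr rfl fun i _ => Finset.sum_congr rfl fun j _ => by ring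
  have e1 : inner ℝ η (Matrix.toEuclideanCLM (𝕜 := ℝ) Cᵀ η) = ∑ i, ∑ j, D i j * η i * η j := by
    have hsw : ∑ i, ∑ j, C i j * η i * η j = ∑ i, ∑ j, C j i * η i * η j := by
      rw [Finset.sum_comm]
      exact Finset.sum_congr rfl fun i _ => Finset.sum_congr rfl fun j _ => by ring
    have hD : ∑ i, ∑ j, D i j * η i * η j =
        (1 / 2) * (∑ i, ∑ j, C i j * η i * η j + ∑ i, ∑ j, C j i * η i * η j) := by
      simp only [hsymm, Matrix.smul_apply, Matrix.add_apply, Matrix.transpose_apply,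
        smul_eq_mul, Finset.mul_sum, ← Finset.sum_add_distrib]
      exact Finset.sum_congr rfl fun i _ => Finset.sum_congr rfl fun j _ => by ring
    rw [hi, hD, hsw]
    ring
  have e2 : inner ℝ (Matrix.toEuclideanCLM (𝕜 := ℝ) Cᵀ η) x = ∑ i, ∑ j, C i j * x j * η i := by
    rw [Finset.sum_comm]
    simp only [PiLp.inner_apply, Matrix.ofLp_toEuclideanCLM, Matrix.mulVec, dotProduct,
      Matrix.transpose_apply, RCLike.inner_apply, conj_trivial, Finset.mul_sum]
    exact Finset.sum_congr rfl fun i _ => Finset.sum_congr rfl fun j _ => by ring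
  rw [fpAdjoint_planeWave, planeWaveDeriv, e1, e2]
  ring

theorem continuous_planeWave_uncurry {d : ℕ} {η : ℝ → EuclideanSpace ℝ (Fin d)}
    (hη : Continuous η) (θ : ℝ) :
    Continuous fun p : ℝ × EuclideanSpace ℝ (Fin d) => planeWave (η p.1) θ p.2 := by
  unfold planeWave
  fun_prop

/-- The terms of `L*(χ W)` in which at least one derivative falls on the cutoff `χ`. -/
noncomputable def cutoffError {d : ℕ} (D C : Matrix (Fin d) (Fin d) ℝ)
    (χ φ : EuclideanSpace ℝ (Fin d) → ℝ) (x : EuclideanSpace ℝ (Fin d)) : ℝ :=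
  φ x * fpAdjoint D C χ x + ∑ i, ∑ j, D i j *
    (partialDeriv j χ x * partialDeriv i φ x + partialDeriv i χ x * partialDeriv j φ x)

/-- Since the plane wave solves the backward equation, the pairing of a solution with a truncated
plane wave changes only through the cutoff error. -/
theorem hasDerivAt_integral_mul_cutoff_planeWave {d : ℕ} {D C : Matrix (Fin d) (Fin d) ℝ}
    (hsymm : D = (1 / 2 : ℝ) • (C + Cᵀ))
    {f₀ : EuclideanSpace ℝ (Fin d) → ℝ} {f : ℝ → EuclideanSpace ℝ (Fin d) → ℝ}
    (hf : IsFPSolution D C f₀ f) {η : ℝ → EuclideanSpace ℝ (Fin d)}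
    (hη : ∀ t, HasDerivAt η (Matrix.toEuclideanCLM (𝕜 := ℝ) Cᵀ (η t)) t) (θ : ℝ)
    {χ : EuclideanSpace ℝ (Fin d) → ℝ} (hχ : ContDiff ℝ 2 χ) (hχs : HasCompactSupport χ)
    {t : ℝ} (ht : 0 < t) :
    HasDerivAt (fun s => ∫ x, f s x * (χ x * planeWave (η s) θ x))
      (∫ x, f t x * cutoffError D C χ (planeWave (η t) θ) x) t := by
  have hηc : Continuous η := continuous_iff_continuousAt.mpr fun s => (hη s).continuousAt
  set η' : ℝ → EuclideanSpace ℝ (Fin d) := fun s => Matrix.toEuclideanCLM (𝕜 := ℝ) Cᵀ (η s)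
    with hη'
  have hη'c : Continuous η' := (Matrix.toEuclideanCLM (𝕜 := ℝ) Cᵀ).continuous.comp hηc
  set W' : ℝ → EuclideanSpace ℝ (Fin d) → ℝ := fun s x => planeWaveDeriv (η s) (η' s) θ x with hW'
  have hW'c : Continuous fun p : ℝ × EuclideanSpace ℝ (Fin d) => W' p.1 p.2 := by
    have h1 := continuous_planeWave_uncurry hηc θ
    have h2 := continuous_planeWave_uncurry hηc (θ + Real.pi / 2)
    simp only [hW', planeWaveDeriv]
    exact (((hηc.comp continuous_fst).inner (hη'c.comp continuous_fst)).mul h1).add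
      (((hη'c.comp continuous_fst).inner continuous_snd).mul h2)
  have hχc := hχ.continuous
  have hw2 : ContDiff ℝ 2 (planeWave (η t) θ) := by
    exact_mod_cast contDiff_infty.mp (contDiff_planeWave (η t) θ) 2
  have hχ0 : ∀ x, x ∉ tsupport χ → χ x = 0 := fun x hx => image_eq_zero_of_notMem_tsupport hx
  have c1 : ∀ s, 0 < s → Continuous fun x => f s x * (χ x * planeWave (η s) θ x) := fun s hs =>
    (hf.contDiff hs).continuous.mul (hχc.mul (contDiff_planeWave _ _).continuous)
  have c2 : ContinuousOn (fun p : ℝ × EuclideanSpace ℝ (Fin d) =>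
      fpOperator D C (f p.1) p.2 * (χ p.2 * planeWave (η p.1) θ p.2) +
        f p.1 p.2 * (χ p.2 * W' p.1 p.2)) (Ioi (0 : ℝ) ×ˢ univ) :=
    (hf.continuousOn_fpOperator.mul ((hχc.comp continuous_snd).mul
      (continuous_planeWave_uncurry hηc θ)).continuousOn).add
      (hf.contDiffOn.continuousOn.mul ((hχc.comp continuous_snd).mul hW'c).continuousOn)
  have hd := hasDerivAt_integral_of_eq_zero_off_compact (μ := volume)
    (G := fun s x => f s x * (χ x * planeWave (η s) θ x))
    (G' := fun s x => fpOperator D C (f s) x * (χ x * planeWave (η s) θ x) +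
      f s x * (χ x * W' s x)) (K := tsupport χ) hχs c1 c2
    (fun s x hx => by simp only [hχ0 x hx, zero_mul, mul_zero])
    (fun s x hx => by simp only [hχ0 x hx, zero_mul, mul_zero, add_zero])
    (fun s hs x => (hf.equation s hs x).mul ((hasDerivAt_planeWave (hη s) θ x).const_mul (χ x))) ht
  refine hd.congr_deriv ?_
  have hW'ct : Continuous (fun x => W' t x) :=
    Continuous.comp (g := fun p : ℝ × EuclideanSpace ℝ (Fin d) => W' p.1 p.2)
      (f := fun x => (t, x)) hW'c (by fun_prop)
  have hft := hf.contDiff ht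
  have hftc := hft.continuous
  have i1 : Integrable fun x => f t x * (χ x * W' t x) :=
    (hftc.mul (hχc.mul hW'ct)).integrable_of_hasCompactSupport hχs.mul_right.mul_left
  have i2 : Integrable fun x => fpOperator D C (f t) x * (χ x * planeWave (η t) θ x) :=
    ((continuous_fpOperator D C hft).mul
      (hχc.mul hw2.continuous)).integrable_of_hasCompactSupport hχs.mul_right.mul_left
  have i3 : Integrable fun x => f t x * fpAdjoint D C (fun y => χ y * planeWave (η t) θ y) x := by
    refine (hftc.mul (continuous_fpAdjoint D C (hχ.mul hw2))).integrable_of_hasCompactSupport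
      (HasCompactSupport.intro (hχs.mul_right (f' := planeWave (η t) θ)).isCompact fun x hx => ?_)
    exact (congrArg (f t x * ·) (fpAdjoint_eq_zero_of_notMem_tsupport D C hx)).trans (mul_zero _)
  rw [integral_add i2 i1, integral_fpOperator_mul D C hft (hχ.mul hw2) hχs.mul_right,
    ← integral_add i3 i1]
  refine integral_congr_ae (Eventually.of_forall fun x => ?_)
  have hz := fpAdjoint_planeWave_add_planeWaveDeriv hsymm (η t) θ x
  simp only [fpAdjoint_mul D C hχ hw2, cutoffError, hW', hη']
  linear_combination f t x * χ x * hz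

theorem abs_cutoffError_planeWave_le {d : ℕ} (D C : Matrix (Fin d) (Fin d) ℝ)
    {χ : EuclideanSpace ℝ (Fin d) → ℝ} {ε : ℝ} (h1 : ∀ i x, |partialDeriv i χ x| ≤ ε)
    (h2 : ∀ i (j : Fin d) x, |x j * partialDeriv i χ x| ≤ ε)
    (h3 : ∀ i j x, |partialDeriv j (partialDeriv i χ) x| ≤ ε)
    (η : EuclideanSpace ℝ (Fin d)) (θ : ℝ) (x : EuclideanSpace ℝ (Fin d)) :
    |cutoffError D C χ (planeWave η θ) x| ≤
      ε * (Real.exp (‖η‖ ^ 2 / 2) * ∑ i, ∑ j, (|D i j| + |C i j| + 2 * |D i j| * ‖η‖)) := by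
  set w := Real.exp (‖η‖ ^ 2 / 2) with hw
  have hw0 : 0 < w := Real.exp_pos _
  have hφ := abs_planeWave_le η θ x
  have hφi : ∀ i, |partialDeriv i (planeWave η θ) x| ≤ ‖η‖ * w := by
    intro i
    rw [partialDeriv_planeWave, abs_mul]
    exact mul_le_mul (abs_coord_le_norm η i) (abs_planeWave_le _ _ _) (abs_nonneg _) (norm_nonneg _)
  have hχ : |fpAdjoint D C χ x| ≤ ∑ i, ∑ j, (|D i j| + |C i j|) * ε := by
    refine (Finset.abs_sum_le_sum_abs _ _).trans (Finset.sum_le_sum fun i _ =>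
      (Finset.abs_sum_le_sum_abs _ _).trans (Finset.sum_le_sum fun j _ => ?_))
    refine (abs_sub _ _).trans ?_
    rw [abs_mul, abs_mul, add_mul]
    exact add_le_add (mul_le_mul_of_nonneg_left (h3 i j x) (abs_nonneg _))
      (mul_le_mul_of_nonneg_left (h2 i j x) (abs_nonneg _))
  have hcross : |∑ i, ∑ j, D i j * (partialDeriv j χ x * partialDeriv i (planeWave η θ) x +
      partialDeriv i χ x * partialDeriv j (planeWave η θ) x)| ≤
      ∑ i, ∑ j, |D i j| * (ε * (‖η‖ * w) + ε * (‖η‖ * w)) := by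
    refine (Finset.abs_sum_le_sum_abs _ _).trans (Finset.sum_le_sum fun i _ =>
      (Finset.abs_sum_le_sum_abs _ _).trans (Finset.sum_le_sum fun j _ => ?_))
    rw [abs_mul]
    refine mul_le_mul_of_nonneg_left ((abs_add_le _ _).trans ?_) (abs_nonneg _)
    rw [abs_mul, abs_mul]
    exact add_le_add (mul_le_mul (h1 j x) (hφi i) (abs_nonneg _) ((abs_nonneg _).trans (h1 j x)))
      (mul_le_mul (h1 i x) (hφi j) (abs_nonneg _) ((abs_nonneg _).trans (h1 i x)))
  calc |cutoffError D C χ (planeWave η θ) x|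
      ≤ w * (∑ i, ∑ j, (|D i j| + |C i j|) * ε) +
        ∑ i, ∑ j, |D i j| * (ε * (‖η‖ * w) + ε * (‖η‖ * w)) := by
        refine (abs_add_le _ _).trans (add_le_add ?_ hcross)
        rw [abs_mul]
        exact mul_le_mul hφ hχ (abs_nonneg _) hw0.le
    _ = _ := by
        simp only [Finset.mul_sum, ← Finset.sum_add_distrib]
        exact Finset.sum_congr rfl fun i _ => Finset.sum_congr rfl fun j _ => by ring

/-- The bound for the change of the pairing is uniform in the cutoff, up to the factor `ε`. -/
theorem integral_mul_cutoff_planeWave_sub_le {d : ℕ} {D C : Matrix (Fin d) (Fin d) ℝ}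
    (hsymm : D = (1 / 2 : ℝ) • (C + Cᵀ))
    {f₀ : EuclideanSpace ℝ (Fin d) → ℝ} {f : ℝ → EuclideanSpace ℝ (Fin d) → ℝ}
    (hf : IsFPSolution D C f₀ f) {η : ℝ → EuclideanSpace ℝ (Fin d)}
    (hη : ∀ t, HasDerivAt η (Matrix.toEuclideanCLM (𝕜 := ℝ) Cᵀ (η t)) t) (θ : ℝ)
    {a b : ℝ} (ha : 0 < a) (hab : a ≤ b) :
    ∃ M : ℝ, ∀ ε : ℝ, 0 < ε → ∀ χ : EuclideanSpace ℝ (Fin d) → ℝ, ContDiff ℝ 2 χ →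
      HasCompactSupport χ → (∀ i x, |partialDeriv i χ x| ≤ ε) →
      (∀ i (j : Fin d) x, |x j * partialDeriv i χ x| ≤ ε) →
      (∀ i j x, |partialDeriv j (partialDeriv i χ) x| ≤ ε) →
      |(∫ x, f b x * (χ x * planeWave (η b) θ x)) - ∫ x, f a x * (χ x * planeWave (η a) θ x)|
        ≤ ε * M := by
  have hηc : Continuous η := continuous_iff_continuousAt.mpr fun s => (hη s).continuousAt
  set κ : ℝ → ℝ := fun t => Real.exp (‖η t‖ ^ 2 / 2) *
    ∑ i, ∑ j, (|D i j| + |C i j| + 2 * |D i j| * ‖η t‖) with hκ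
  have hκc : Continuous κ := by simp only [hκ]; fun_prop
  have hκ0 : ∀ t, 0 ≤ κ t := fun t => by simp only [hκ]; positivity
  have hNc : ContinuousOn (fun t => κ t * ∫ x, |f t x|) (Icc a b) :=
    hκc.continuousOn.mul (hf.continuousOn_integral_abs.mono fun t ht => ha.le.trans ht.1)
  obtain ⟨M, hM⟩ := isCompact_Icc.exists_bound_of_continuousOn hNc
  refine ⟨M * (b - a), fun ε hε χ hχ hχs h1 h2 h3 => ?_⟩
  rw [← mul_assoc]
  have key := Convex.norm_image_sub_le_of_norm_hasDerivWithin_le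
    (f := fun s => ∫ x, f s x * (χ x * planeWave (η s) θ x)) (s := Icc a b) (C := ε * M)
    (f' := fun s => ∫ x, f s x * cutoffError D C χ (planeWave (η s) θ) x)
    (fun t ht => (hasDerivAt_integral_mul_cutoff_planeWave hsymm hf hη θ hχ hχs
      (ha.trans_le ht.1)).hasDerivWithinAt) (fun t ht => ?_) (convex_Icc a b)
    (left_mem_Icc.mpr hab) (right_mem_Icc.mpr hab)
  · rwa [Real.norm_eq_abs, Real.norm_eq_abs, abs_of_nonneg (sub_nonneg.mpr hab)] at key
  · have hle := (le_abs_self _).trans (hM t ht)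
    calc ‖∫ x, f t x * cutoffError D C χ (planeWave (η t) θ) x‖
        ≤ ∫ x, |f t x| * (ε * κ t) := by
          refine (norm_integral_le_integral_norm _).trans (integral_mono_of_nonneg
            (Eventually.of_forall fun _ => norm_nonneg _)
            ((hf.integrable t (ha.le.trans ht.1)).abs.mul_const _)
            (Eventually.of_forall fun x => ?_))
          simp only [norm_mul, Real.norm_eq_abs]
          exact mul_le_mul_of_nonneg_left (abs_cutoffError_planeWave_le D C h1 h2 h3 _ _ _)
            (abs_nonneg _)
      _ = ε * (κ t * ∫ x, |f t x|) := by rw [integral_mul_const]; ring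
      _ ≤ ε * M := mul_le_mul_of_nonneg_left hle hε.le

/-- The pairing of a solution with a plane wave is conserved. The cutoff is removed by letting its
derivatives tend to zero. -/
theorem integral_mul_planeWave_eq_of_pos {d : ℕ} {D C : Matrix (Fin d) (Fin d) ℝ}
    (hsymm : D = (1 / 2 : ℝ) • (C + Cᵀ))
    {f₀ : EuclideanSpace ℝ (Fin d) → ℝ} {f : ℝ → EuclideanSpace ℝ (Fin d) → ℝ}
    (hf : IsFPSolution D C f₀ f) {η : ℝ → EuclideanSpace ℝ (Fin d)}
    (hη : ∀ t, HasDerivAt η (Matrix.toEuclideanCLM (𝕜 := ℝ) Cᵀ (η t)) t) (θ : ℝ)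
    {a b : ℝ} (ha : 0 < a) (hab : a ≤ b) :
    ∫ x, f a x * planeWave (η a) θ x = ∫ x, f b x * planeWave (η b) θ x := by
  obtain ⟨M, hM⟩ := integral_mul_cutoff_planeWave_sub_le hsymm hf hη θ ha hab
  choose χ hχ hχs hχ0 hχ1 hχR h1 h2 h3 using fun n : ℕ =>
    exists_cutoff (d := d) (1 / ((n : ℝ) + 1)) Nat.one_div_pos_of_nat (n : ℝ)
  have hlim : ∀ t, 0 ≤ t → Tendsto (fun n => ∫ x, f t x * (χ n x * planeWave (η t) θ x)) atTop
      (𝓝 (∫ x, f t x * planeWave (η t) θ x)) := by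
    intro t ht
    refine tendsto_integral_of_dominated_convergence
      (fun x => |f t x| * Real.exp (‖η t‖ ^ 2 / 2)) (fun n => ?_)
      ((hf.integrable t ht).abs.mul_const _) (fun n => Eventually.of_forall fun x => ?_)
      (Eventually.of_forall fun x => ?_)
    · exact (hf.integrable t ht).aestronglyMeasurable.mul
        ((hχ n).continuous.mul (contDiff_planeWave _ _).continuous).aestronglyMeasurable
    · rw [norm_mul, norm_mul, Real.norm_eq_abs, Real.norm_eq_abs, Real.norm_eq_abs,
        abs_of_nonneg (hχ0 n x)]
      exact mul_le_mul_of_nonneg_left ((mul_le_of_le_one_left (abs_nonneg _) (hχ1 n x)).trans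
        (abs_planeWave_le _ _ _)) (abs_nonneg _)
    · refine tendsto_const_nhds.congr' ?_
      filter_upwards [eventually_ge_atTop ⌈‖x‖⌉₊] with n hn
      rw [hχR n x (Nat.ceil_le.mp hn), one_mul]
  have hd := (hlim b (ha.le.trans hab)).sub (hlim a ha.le)
  have h0 : Tendsto (fun n : ℕ => 1 / ((n : ℝ) + 1) * M) atTop (𝓝 0) := by
    simpa using (tendsto_one_div_add_atTop_nhds_zero_nat (𝕜 := ℝ)).mul_const M
  have hz := squeeze_zero_norm
    (f := fun n : ℕ => (∫ x, f b x * (χ n x * planeWave (η b) θ x)) -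
      ∫ x, f a x * (χ n x * planeWave (η a) θ x)) (fun n : ℕ =>
      hM (1 / ((n : ℝ) + 1)) Nat.one_div_pos_of_nat (χ n)
    (by exact_mod_cast contDiff_infty.mp (hχ n) 2) (hχs n) (h1 n) (h2 n) (h3 n)) h0
  exact (sub_eq_zero.mp (tendsto_nhds_unique hd hz)).symm

/-- The conservation law holds from time `0` on, by continuity of the solution in `L¹`. -/
theorem integral_mul_planeWave_eq {d : ℕ} {D C : Matrix (Fin d) (Fin d) ℝ}
    (hsymm : D = (1 / 2 : ℝ) • (C + Cᵀ))
    {f₀ : EuclideanSpace ℝ (Fin d) → ℝ} {f : ℝ → EuclideanSpace ℝ (Fin d) → ℝ}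
    (hf : IsFPSolution D C f₀ f) {η : ℝ → EuclideanSpace ℝ (Fin d)}
    (hη : ∀ t, HasDerivAt η (Matrix.toEuclideanCLM (𝕜 := ℝ) Cᵀ (η t)) t) (θ : ℝ)
    {a b : ℝ} (ha : 0 ≤ a) (hab : a ≤ b) :
    ∫ x, f a x * planeWave (η a) θ x = ∫ x, f b x * planeWave (η b) θ x := by
  rcases ha.eq_or_lt with rfl | ha
  swap
  · exact integral_mul_planeWave_eq_of_pos hsymm hf hη θ ha hab
  rcases hab.eq_or_lt with rfl | hb
  · rfl
  have hηc : Continuous η := continuous_iff_continuousAt.mpr fun s => (hη s).continuousAt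
  have hlim := hf.tendsto_integral_mul (le_refl 0) (W := fun s => planeWave (η s) θ)
    (B := Real.exp (‖η 0‖ ^ 2 / 2) + 1) (fun s => (contDiff_planeWave _ _).continuous) ?_ ?_
  · have hlim' := hlim.mono_left (nhdsWithin_mono 0 Ioi_subset_Ici_self)
    refine tendsto_nhds_unique hlim' (tendsto_const_nhds.congr' ?_)
    filter_upwards [Ioo_mem_nhdsGT hb] with s hs
    exact (integral_mul_planeWave_eq_of_pos hsymm hf hη θ hs.1 hs.2.le).symm
  · have hc : Continuous fun s => Real.exp (‖η s‖ ^ 2 / 2) := by fun_prop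
    have := hc.continuousAt (x := (0 : ℝ)) |>.eventually_le_const
      (lt_add_one (Real.exp (‖η 0‖ ^ 2 / 2)))
    filter_upwards [nhdsWithin_le_nhds this] with s hs x
    exact (abs_planeWave_le _ _ _).trans hs
  · intro x
    have hc : Continuous fun s => planeWave (η s) θ x :=
      Continuous.comp (g := fun p : ℝ × EuclideanSpace ℝ (Fin d) => planeWave (η p.1) θ p.2)
        (f := fun s => (s, x)) (continuous_planeWave_uncurry hηc θ) (by fun_prop)
    exact (hc.tendsto 0).mono_left nhdsWithin_le_nhds

/-- The Fourier transform of a solution is transported along the adjoint linear flow, up to an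
explicit Gaussian factor. -/
theorem integral_mul_cexp_eq {d : ℕ} {D C : Matrix (Fin d) (Fin d) ℝ}
    (hsymm : D = (1 / 2 : ℝ) • (C + Cᵀ))
    {f₀ : EuclideanSpace ℝ (Fin d) → ℝ} {f : ℝ → EuclideanSpace ℝ (Fin d) → ℝ}
    (hf : IsFPSolution D C f₀ f) {η : ℝ → EuclideanSpace ℝ (Fin d)}
    (hη : ∀ t, HasDerivAt η (Matrix.toEuclideanCLM (𝕜 := ℝ) Cᵀ (η t)) t)
    {a b : ℝ} (ha : 0 ≤ a) (hab : a ≤ b) :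
    Complex.exp (‖η b‖ ^ 2 / 2) * ∫ x, (f b x : ℂ) * Complex.exp (inner ℝ x (η b) * Complex.I) =
      Complex.exp (‖η a‖ ^ 2 / 2) *
        ∫ x, (f a x : ℂ) * Complex.exp (inner ℝ x (η a) * Complex.I) := by
  -- The real and imaginary parts of the Fourier integral are pairings with plane waves of phase `0`
  -- and `-π/2`.
  have key : ∀ t, 0 ≤ t →
      Complex.exp (‖η t‖ ^ 2 / 2) * ∫ x, (f t x : ℂ) * Complex.exp (inner ℝ x (η t) * Complex.I) =
      ((∫ x, f t x * planeWave (η t) 0 x : ℝ) : ℂ) +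
        ((∫ x, f t x * planeWave (η t) (-(Real.pi / 2)) x : ℝ) : ℂ) * Complex.I := by
    intro t ht
    have hi : ∀ θ, Integrable fun x => f t x * planeWave (η t) θ x := fun θ =>
      (hf.integrable t ht).mul_bdd (c := Real.exp (‖η t‖ ^ 2 / 2))
        (contDiff_planeWave _ _).continuous.aestronglyMeasurable
        (Eventually.of_forall fun x => abs_planeWave_le _ _ _)
    rw [← integral_complex_ofReal, ← integral_complex_ofReal, ← integral_mul_const,
      ← integral_add (hi 0).ofReal ((hi _).ofReal.mul_const _), ← integral_const_mul]
    refine integral_congr_ae (Eventually.of_forall fun x => ?_)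
    simp only [planeWave, add_zero, ← sub_eq_add_neg, Real.cos_sub_pi_div_two,
      real_inner_comm (η t) x, Complex.exp_mul_I]
    push_cast
    ring
  rw [key a ha, key b (ha.trans hab), integral_mul_planeWave_eq hsymm hf hη _ ha hab,
    integral_mul_planeWave_eq hsymm hf hη _ ha hab]

/-! ### The linear flow of the drift -/

/-- The matrix exponential `e^{-tC}`, formed in the normed algebra of continuous endomorphisms of
Euclidean space, so that no norm on matrices has to be chosen. -/
noncomputable def driftFlow {d : ℕ} (C : Matrix (Fin d) (Fin d) ℝ) (t : ℝ) :
    Matrix (Fin d) (Fin d) ℝ :=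
  (Matrix.toEuclideanCLM (𝕜 := ℝ)).symm
    (NormedSpace.exp ((-t) • Matrix.toEuclideanCLM (𝕜 := ℝ) C))

theorem toEuclideanCLM_driftFlow {d : ℕ} (C : Matrix (Fin d) (Fin d) ℝ) (t : ℝ) :
    Matrix.toEuclideanCLM (𝕜 := ℝ) (driftFlow C t) =
      NormedSpace.exp ((-t) • Matrix.toEuclideanCLM (𝕜 := ℝ) C) := by
  rw [driftFlow, StarAlgEquiv.apply_symm_apply]

theorem driftFlow_zero {d : ℕ} (C : Matrix (Fin d) (Fin d) ℝ) : driftFlow C 0 = 1 := by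
  apply EquivLike.injective (Matrix.toEuclideanCLM (n := Fin d) (𝕜 := ℝ))
  rw [toEuclideanCLM_driftFlow, map_one, neg_zero]
  exact (congrArg NormedSpace.exp (zero_smul ℝ (Matrix.toEuclideanCLM (𝕜 := ℝ) C))).trans
    NormedSpace.exp_zero

theorem transpose_driftFlow {d : ℕ} (C : Matrix (Fin d) (Fin d) ℝ) (t : ℝ) :
    (driftFlow C t)ᵀ = driftFlow Cᵀ t := by
  apply EquivLike.injective (Matrix.toEuclideanCLM (n := Fin d) (𝕜 := ℝ))
  have h : ∀ M : Matrix (Fin d) (Fin d) ℝ, Mᵀ = star M := fun M => by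
    rw [Matrix.star_eq_conjTranspose, Matrix.conjTranspose_eq_transpose_of_trivial]
  rw [h, map_star, toEuclideanCLM_driftFlow, toEuclideanCLM_driftFlow, NormedSpace.star_exp, h,
    map_star, star_smul, star_trivial]

theorem isUnit_driftFlow {d : ℕ} (C : Matrix (Fin d) (Fin d) ℝ) (t : ℝ) :
    IsUnit (driftFlow C t) := by
  have h : IsUnit (Matrix.toEuclideanCLM (𝕜 := ℝ) (driftFlow C t)) := by
    rw [toEuclideanCLM_driftFlow]
    exact NormedSpace.isUnit_exp_of_mem_ball (𝕂 := ℝ)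
      (𝔸 := EuclideanSpace ℝ (Fin d) →L[ℝ] EuclideanSpace ℝ (Fin d))
      ((NormedSpace.expSeries_radius_eq_top ℝ
        (EuclideanSpace ℝ (Fin d) →L[ℝ] EuclideanSpace ℝ (Fin d))).symm ▸ edist_lt_top _ _)
  have h2 := h.map (Matrix.toEuclideanCLM (n := Fin d) (𝕜 := ℝ)).symm
  rwa [StarAlgEquiv.symm_apply_apply] at h2

theorem hasDerivAt_driftFlow {d : ℕ} (C : Matrix (Fin d) (Fin d) ℝ)
    (x : EuclideanSpace ℝ (Fin d)) (t : ℝ) :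
    HasDerivAt (fun s => Matrix.toEuclideanCLM (𝕜 := ℝ) (driftFlow C s) x)
      (- Matrix.toEuclideanCLM (𝕜 := ℝ) C
        (Matrix.toEuclideanCLM (𝕜 := ℝ) (driftFlow C t) x)) t := by
  simp only [toEuclideanCLM_driftFlow]
  have h := (hasDerivAt_exp_smul_const' (𝕂 := ℝ) (Matrix.toEuclideanCLM (𝕜 := ℝ) C) (-t)).scomp t
    (hasDerivAt_neg t)
  have h2 := h.clm_apply (hasDerivAt_const t x)
  refine h2.congr_deriv ?_
  rw [map_zero, add_zero, neg_one_smul]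
  rfl

/-- Exponential decay of a quadratic form `W` along `e^{-tC}` when `Cᵀ W + W C ≥ 2 μ W`. -/
theorem antitone_driftFlow_quadratic {d : ℕ} (C W : Matrix (Fin d) (Fin d) ℝ) (μ : ℝ)
    (h : (Cᵀ * W + W * C - (2 * μ) • W).PosSemidef) (x : EuclideanSpace ℝ (Fin d)) :
    Antitone fun t : ℝ => Real.exp (2 * μ * t) *
      inner ℝ (Matrix.toEuclideanCLM (𝕜 := ℝ) (driftFlow C t) x)
        (Matrix.toEuclideanCLM (𝕜 := ℝ) W (Matrix.toEuclideanCLM (𝕜 := ℝ) (driftFlow C t) x)) := by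
  set K := Matrix.toEuclideanCLM (𝕜 := ℝ) C with hK
  set Wc := Matrix.toEuclideanCLM (𝕜 := ℝ) W with hWc
  set y : ℝ → EuclideanSpace ℝ (Fin d) := fun t =>
    Matrix.toEuclideanCLM (𝕜 := ℝ) (driftFlow C t) x with hy
  have hd : ∀ t, HasDerivAt y (- K (y t)) t := fun t => hasDerivAt_driftFlow C x t
  have he : ∀ t, HasDerivAt (fun t : ℝ => Real.exp (2 * μ * t))
      (Real.exp (2 * μ * t) * (2 * μ)) t := fun t => by simpa using ((hasDerivAt_id t).const_mul (2 * μ)).exp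
  have hmain : ∀ t, HasDerivAt (fun t => Real.exp (2 * μ * t) * inner ℝ (y t) (Wc (y t)))
      (- (Real.exp (2 * μ * t) * ((y t).ofLp ⬝ᵥ
        ((Cᵀ * W + W * C - (2 * μ) • W) *ᵥ (y t).ofLp)))) t := by
    intro t
    refine ((he t).mul ((hd t).inner ℝ (Wc.hasFDerivAt.comp_hasDerivAt t (hd t)))).congr_deriv ?_
    have e1 : inner ℝ (K (y t)) (Wc (y t)) = (y t).ofLp ⬝ᵥ ((Cᵀ * W) *ᵥ (y t).ofLp) := by
      rw [real_inner_comm, hK, Matrix.inner_toEuclideanCLM, ← Matrix.mulVec_mulVec,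
        hWc, Matrix.ofLp_toEuclideanCLM, Matrix.mulVec_transpose, dotProduct_comm (y t).ofLp,
        ← Matrix.dotProduct_mulVec]
    have e2 : inner ℝ (y t) (Wc (K (y t))) = (y t).ofLp ⬝ᵥ ((W * C) *ᵥ (y t).ofLp) := by
      rw [hWc, Matrix.inner_toEuclideanCLM, hK, ← Matrix.mulVec_mulVec]
      exact congrArg (fun z => (y t).ofLp ⬝ᵥ (W *ᵥ z)) (Matrix.ofLp_toEuclideanCLM C (y t))
    have e3 : inner ℝ (y t) (Wc (y t)) = (y t).ofLp ⬝ᵥ (W *ᵥ (y t).ofLp) := by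
      rw [hWc, Matrix.inner_toEuclideanCLM]
    simp only [map_neg, inner_neg_left, inner_neg_right, Function.comp_apply, e1, e2, e3,
      Matrix.sub_mulVec, Matrix.add_mulVec, Matrix.smul_mulVec, dotProduct_sub, dotProduct_add,
      dotProduct_smul, smul_eq_mul]
    ring
  refine antitone_of_deriv_nonpos (fun t => (hmain t).differentiableAt) fun t => ?_
  rw [(hmain t).deriv]
  have := h.dotProduct_mulVec_nonneg (y t).ofLp
  rw [star_trivial] at this
  exact neg_nonpos.mpr (mul_nonneg (Real.exp_pos _).le this)

theorem driftFlow_quadratic_le {d : ℕ} {C P : Matrix (Fin d) (Fin d) ℝ} {l : ℝ}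
    (h : (Cᵀ * P + P * C - (2 * l) • P).PosSemidef) {t : ℝ} (ht : 0 ≤ t) (v : Fin d → ℝ) :
    (driftFlow C t *ᵥ v) ⬝ᵥ (P *ᵥ (driftFlow C t *ᵥ v)) ≤
      Real.exp (-2 * l * t) * (v ⬝ᵥ (P *ᵥ v)) := by
  have h1 := antitone_driftFlow_quadratic C P l h (WithLp.toLp 2 v) ht
  simp only [Matrix.inner_toEuclideanCLM, Matrix.ofLp_toEuclideanCLM, driftFlow_zero,
    Matrix.one_mulVec, mul_zero, Real.exp_zero, one_mul] at h1
  rw [show -2 * l * t = -(2 * l * t) by ring, Real.exp_neg]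
  rwa [le_inv_mul_iff₀ (Real.exp_pos _)]

theorem antitone_norm_sq_driftFlow {d : ℕ} {C D : Matrix (Fin d) (Fin d) ℝ}
    (hsymm : D = (1 / 2 : ℝ) • (C + Cᵀ)) (hD : D.PosSemidef) (x : EuclideanSpace ℝ (Fin d)) :
    Antitone fun t : ℝ => ‖Matrix.toEuclideanCLM (𝕜 := ℝ) (driftFlow C t) x‖ ^ 2 := by
  have h : (Cᵀ * 1 + 1 * C - (2 * (0 : ℝ)) • (1 : Matrix (Fin d) (Fin d) ℝ)).PosSemidef := by
    have : Cᵀ * 1 + 1 * C - (2 * (0 : ℝ)) • (1 : Matrix (Fin d) (Fin d) ℝ) = (2 : ℝ) • D := by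
      rw [hsymm, smul_smul]
      simp [add_comm]
    rw [this]
    exact hD.smul (by norm_num)
  have h1 := antitone_driftFlow_quadratic C 1 0 h x
  simpa using h1

theorem norm_driftFlow_le {d : ℕ} {C D : Matrix (Fin d) (Fin d) ℝ}
    (hsymm : D = (1 / 2 : ℝ) • (C + Cᵀ)) (hD : D.PosSemidef) {t : ℝ} (ht : 0 ≤ t)
    (x : EuclideanSpace ℝ (Fin d)) :
    ‖Matrix.toEuclideanCLM (𝕜 := ℝ) (driftFlow C t) x‖ ^ 2 ≤ ‖x‖ ^ 2 := by
  have h1 := antitone_norm_sq_driftFlow hsymm hD x ht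
  simpa [driftFlow_zero] using h1

theorem norm_driftFlow_transpose_le {d : ℕ} {C D : Matrix (Fin d) (Fin d) ℝ}
    (hsymm : D = (1 / 2 : ℝ) • (C + Cᵀ)) (hD : D.PosSemidef) {t : ℝ} (ht : 0 ≤ t)
    (x : EuclideanSpace ℝ (Fin d)) :
    ‖Matrix.toEuclideanCLM (𝕜 := ℝ) (driftFlow C t)ᵀ x‖ ^ 2 ≤ ‖x‖ ^ 2 := by
  rw [transpose_driftFlow]
  refine norm_driftFlow_le (D := D) ?_ hD ht x
  rw [hsymm, Matrix.transpose_transpose, add_comm]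

/-- Under the kernel condition the flow `e^{-tC}` is strictly contractive at every positive time.
Otherwise a trajectory `y` has constant norm on `[0, t]`. Then `D y = 0`, and differentiating in
time gives `D Cᵏ y = 0` for all `k`. The vectors with this property form a `Cᵀ`-invariant subspace of the
kernel of `D`, because `Cᵀ = 2 D - C`. -/
theorem norm_driftFlow_lt {d : ℕ} {C D : Matrix (Fin d) (Fin d) ℝ}
    (hDC : FokkerPlanckConditions D C) (hsymm : D = (1 / 2 : ℝ) • (C + Cᵀ)) {t : ℝ} (ht : 0 < t)
    {x : EuclideanSpace ℝ (Fin d)} (hx : x ≠ 0) :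
    ‖Matrix.toEuclideanCLM (𝕜 := ℝ) (driftFlow C t) x‖ ^ 2 < ‖x‖ ^ 2 := by
  refine lt_of_le_of_ne (norm_driftFlow_le hsymm hDC.posSemidef ht.le x) fun heq => hx ?_
  set y : ℝ → EuclideanSpace ℝ (Fin d) := fun t =>
    Matrix.toEuclideanCLM (𝕜 := ℝ) (driftFlow C t) x with hy
  have hd : ∀ t, HasDerivAt y (- Matrix.toEuclideanCLM (𝕜 := ℝ) C (y t)) t := fun t =>
    hasDerivAt_driftFlow C x t
  have hanti := antitone_norm_sq_driftFlow hsymm hDC.posSemidef x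
  have hconst : ∀ s ∈ Ioo 0 t, ‖y s‖ ^ 2 = ‖x‖ ^ 2 := fun s hs =>
    le_antisymm (norm_driftFlow_le hsymm hDC.posSemidef hs.1.le x)
      (heq.symm.le.trans (hanti hs.2.le))
  have h0 : ∀ s ∈ Ioo 0 t, D *ᵥ (y s).ofLp = 0 := by
    intro s hs
    have hz : HasDerivAt (fun s => ‖y s‖ ^ 2) 0 s :=
      (hasDerivAt_const s (‖x‖ ^ 2)).congr_of_eventuallyEq (by
        filter_upwards [Ioo_mem_nhds hs.1 hs.2] with r hr using hconst r hr)
    have h2 := hz.unique (hd s).norm_sq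
    rw [inner_neg_right, Matrix.inner_toEuclideanCLM] at h2
    refine (hDC.posSemidef.dotProduct_mulVec_zero_iff _).mp ?_
    rw [star_trivial, hsymm, Matrix.smul_mulVec, Matrix.add_mulVec, dotProduct_smul,
      dotProduct_add, Matrix.mulVec_transpose, ← dotProduct_comm (Matrix.vecMul _ _),
      ← Matrix.dotProduct_mulVec, smul_eq_mul]
    linarith
  have hk : ∀ k : ℕ, ∀ s ∈ Ioo 0 t, D *ᵥ ((C ^ k) *ᵥ (y s).ofLp) = 0 := by
    intro k
    induction k with
    | zero => simpa using h0
    | succ k ih =>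
      intro s hs
      have hM := (Matrix.toEuclideanCLM (𝕜 := ℝ) (D * C ^ k)).hasFDerivAt.comp_hasDerivAt s (hd s)
      have hz : HasDerivAt (fun s => Matrix.toEuclideanCLM (𝕜 := ℝ) (D * C ^ k) (y s)) 0 s := by
        refine (hasDerivAt_const s (0 : EuclideanSpace ℝ (Fin d))).congr_of_eventuallyEq ?_
        filter_upwards [Ioo_mem_nhds hs.1 hs.2] with r hr
        apply WithLp.ofLp_injective
        rw [Matrix.ofLp_toEuclideanCLM, ← Matrix.mulVec_mulVec, ih r hr]
        rfl
      have h3 := congrArg WithLp.ofLp (hz.unique hM)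
      rw [map_neg, WithLp.ofLp_neg, Matrix.ofLp_toEuclideanCLM, Matrix.ofLp_toEuclideanCLM,
        Matrix.mulVec_mulVec, mul_assoc, ← pow_succ, ← Matrix.mulVec_mulVec, WithLp.ofLp_zero,
        eq_comm, neg_eq_zero] at h3
      exact h3
  have hV := hDC.no_invariant
    { carrier := {v | ∀ k : ℕ, D *ᵥ ((C ^ k) *ᵥ v) = 0}
      add_mem' := fun {a b} ha hb k => by
        rw [Matrix.mulVec_add, Matrix.mulVec_add, ha k, hb k, add_zero]
      zero_mem' := fun k => by simp
      smul_mem' := fun c v hv k => by rw [Matrix.mulVec_smul, Matrix.mulVec_smul, hv k, smul_zero] }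
    (fun v hv => by simpa using hv 0) (fun v hv k => ?_)
  · have hmem : (y (t / 2)).ofLp ∈ (⊥ : Submodule ℝ (Fin d → ℝ)) := by
      rw [← hV]
      exact fun k => hk k (t / 2) ⟨by linarith, by linarith⟩
    have hy0 : y (t / 2) = 0 := WithLp.ofLp_injective 2 (by simpa using hmem)
    have hn := hconst (t / 2) ⟨by linarith, by linarith⟩
    rw [hy0, norm_zero] at hn
    exact norm_eq_zero.mp (pow_eq_zero_iff (two_ne_zero) |>.mp (by rw [← hn]; norm_num))
  · have hCt : Cᵀ = (2 : ℝ) • D - C := by rw [hsymm, smul_smul]; simp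
    have hv0 : D *ᵥ v = 0 := by simpa using hv 0
    rw [hCt, Matrix.sub_mulVec, Matrix.smul_mulVec, hv0, smul_zero, zero_sub, Matrix.mulVec_neg,
      Matrix.mulVec_neg, neg_eq_zero, Matrix.mulVec_mulVec v, ← pow_succ]
    exact hv (k + 1)

/-- The weighted Cauchy-Schwarz inequality in additive form. -/
theorem Matrix.PosSemidef.two_mul_dotProduct_le {n : Type*} [Fintype n] {P : Matrix n n ℝ}
    (hP : P.PosSemidef) {c : ℝ} (hc : 0 < c) (v w : n → ℝ) :
    2 * (v ⬝ᵥ (P *ᵥ w)) ≤ c⁻¹ * (v ⬝ᵥ (P *ᵥ v)) + c * (w ⬝ᵥ (P *ᵥ w)) := by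
  have hsym : w ⬝ᵥ (P *ᵥ v) = v ⬝ᵥ (P *ᵥ w) := by
    have ht : Pᵀ = P := by
      rw [← Matrix.conjTranspose_eq_transpose_of_trivial]; exact hP.isHermitian
    rw [Matrix.dotProduct_mulVec, dotProduct_comm, ← Matrix.mulVec_transpose, ht]
  have h := hP.dotProduct_mulVec_nonneg (v - c • w)
  rw [star_trivial, Matrix.mulVec_sub, Matrix.mulVec_smul, sub_dotProduct, dotProduct_sub,
    dotProduct_sub, smul_dotProduct, smul_dotProduct, dotProduct_smul, dotProduct_smul, hsym] at h
  simp only [smul_eq_mul] at h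
  rw [inv_mul_eq_div, ← sub_nonneg]
  have : v ⬝ᵥ (P *ᵥ v) / c + c * (w ⬝ᵥ (P *ᵥ w)) - 2 * (v ⬝ᵥ (P *ᵥ w)) =
      (v ⬝ᵥ (P *ᵥ v) - c * (v ⬝ᵥ (P *ᵥ w)) -
        (c * (v ⬝ᵥ (P *ᵥ w)) - c * (c * (w ⬝ᵥ (P *ᵥ w))))) / c := by
    field_simp; ring
  rw [this]
  exact div_nonneg h hc.le

/-- The transposed flow decays, by duality with the decay of the quadratic form `P` along the flow:
the `i`-th coordinate of `e^{-tCᵀ} x` is `⟨e^{-tC} eᵢ, P w⟩` with `P w = x`. -/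
theorem tendsto_driftFlow_transpose {d : ℕ} {C P : Matrix (Fin d) (Fin d) ℝ} {l : ℝ} (hl : 0 < l)
    (hP : P.PosDef) (h : (Cᵀ * P + P * C - (2 * l) • P).PosSemidef)
    (x : EuclideanSpace ℝ (Fin d)) :
    Tendsto (fun t => Matrix.toEuclideanCLM (𝕜 := ℝ) (driftFlow C t)ᵀ x) atTop (𝓝 0) := by
  have hsd := hP.posSemidef
  set w : Fin d → ℝ := P⁻¹ *ᵥ x.ofLp with hw
  have hPw : P *ᵥ w = x.ofLp := by
    rw [hw, Matrix.mulVec_mulVec, Matrix.mul_nonsing_inv _ ((Matrix.isUnit_iff_isUnit_det _).mp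
      hP.isUnit), Matrix.one_mulVec]
  have hcoord : ∀ i, Tendsto (fun t => ((driftFlow C t)ᵀ *ᵥ x.ofLp) i) atTop (𝓝 0) := by
    intro i
    set e : Fin d → ℝ := Pi.single i 1 with he
    have hlim : Tendsto (fun t => Real.exp (-(l * t)) *
        ((e ⬝ᵥ (P *ᵥ e) + w ⬝ᵥ (P *ᵥ w)) / 2)) atTop (𝓝 0) := by
      have h1 : Tendsto (fun t => Real.exp (-(l * t))) atTop (𝓝 0) :=
        Real.tendsto_exp_neg_atTop_nhds_zero.comp (tendsto_id.const_mul_atTop hl)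
      simpa using h1.mul_const ((e ⬝ᵥ (P *ᵥ e) + w ⬝ᵥ (P *ᵥ w)) / 2)
    refine squeeze_zero_norm' ?_ hlim
    filter_upwards [eventually_ge_atTop 0] with t ht
    have hb : ((driftFlow C t)ᵀ *ᵥ x.ofLp) i = (driftFlow C t *ᵥ e) ⬝ᵥ (P *ᵥ w) := by
      rw [hPw, he, Matrix.mulVec_single_one]
      simp [Matrix.mulVec, dotProduct]
    have hq := driftFlow_quadratic_le h ht e
    have hexp : Real.exp (-2 * l * t) = Real.exp (-(l * t)) * Real.exp (-(l * t)) := by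
      rw [← Real.exp_add]; ring_nf
    have hmain : ∀ u : Fin d → ℝ, u ⬝ᵥ (P *ᵥ u) = w ⬝ᵥ (P *ᵥ w) →
        (driftFlow C t *ᵥ e) ⬝ᵥ (P *ᵥ u) ≤
          Real.exp (-(l * t)) * ((e ⬝ᵥ (P *ᵥ e) + w ⬝ᵥ (P *ᵥ w)) / 2) := by
      intro u hu
      have h2 := hsd.two_mul_dotProduct_le (Real.exp_pos (-(l * t))) (driftFlow C t *ᵥ e) u
      have h3 : (Real.exp (-(l * t)))⁻¹ * ((driftFlow C t *ᵥ e) ⬝ᵥ (P *ᵥ (driftFlow C t *ᵥ e))) ≤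
          Real.exp (-(l * t)) * (e ⬝ᵥ (P *ᵥ e)) := by
        rw [inv_mul_le_iff₀ (Real.exp_pos _), ← mul_assoc, ← hexp]
        exact hq
      rw [hu] at h2
      linarith
    rw [Real.norm_eq_abs, hb, abs_le]
    constructor
    · have h4 := hmain (-w) (by simp [Matrix.mulVec_neg])
      rw [Matrix.mulVec_neg, dotProduct_neg] at h4
      linarith
    · exact hmain w rfl
  have hfun : Tendsto (fun t => (driftFlow C t)ᵀ *ᵥ x.ofLp) atTop (𝓝 0) :=
    tendsto_pi_nhds.mpr hcoord
  have := ((PiLp.continuous_toLp 2 (fun _ : Fin d => ℝ)).tendsto 0).comp hfun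
  refine this.congr fun t => ?_
  apply WithLp.ofLp_injective
  rw [Matrix.ofLp_toEuclideanCLM]
  rfl

/-- The Fourier transforms of a solution at two times are related through the transposed flow. -/
theorem integral_mul_cexp_driftFlow {d : ℕ} {D C : Matrix (Fin d) (Fin d) ℝ}
    (hsymm : D = (1 / 2 : ℝ) • (C + Cᵀ))
    {f₀ : EuclideanSpace ℝ (Fin d) → ℝ} {f : ℝ → EuclideanSpace ℝ (Fin d) → ℝ}
    (hf : IsFPSolution D C f₀ f) {a b : ℝ} (ha : 0 ≤ a) (hab : a ≤ b)
    (ξ : EuclideanSpace ℝ (Fin d)) :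
    Complex.exp (‖ξ‖ ^ 2 / 2) * ∫ x, (f b x : ℂ) * Complex.exp (inner ℝ x ξ * Complex.I) =
      Complex.exp (‖Matrix.toEuclideanCLM (𝕜 := ℝ) (driftFlow C (b - a))ᵀ ξ‖ ^ 2 / 2) *
        ∫ x, (f a x : ℂ) * Complex.exp
          (inner ℝ x (Matrix.toEuclideanCLM (𝕜 := ℝ) (driftFlow C (b - a))ᵀ ξ) * Complex.I) := by
  have hη : ∀ t, HasDerivAt (fun s => Matrix.toEuclideanCLM (𝕜 := ℝ) (driftFlow Cᵀ (b - s)) ξ)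
      (Matrix.toEuclideanCLM (𝕜 := ℝ) Cᵀ
        (Matrix.toEuclideanCLM (𝕜 := ℝ) (driftFlow Cᵀ (b - t)) ξ)) t := by
    intro t
    have h := (hasDerivAt_driftFlow Cᵀ ξ (b - t)).scomp t ((hasDerivAt_id t).const_sub b)
    rw [neg_one_smul, neg_neg] at h
    exact h
  have h := integral_mul_cexp_eq hsymm hf hη ha hab
  simpa only [transpose_driftFlow, sub_self, driftFlow_zero, map_one,
    one_apply_eq_self] using h

/-! ### The Gaussian equilibrium -/

section

open ProbabilityTheory

/-- Injectivity of the Fourier transform on `L¹`. The positive and negative parts of `F - G` are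
densities of finite measures with the same characteristic function. -/
theorem ae_eq_of_forall_integral_mul_cexp_eq {d : ℕ} {F G : EuclideanSpace ℝ (Fin d) → ℝ}
    (hF : Integrable F) (hG : Integrable G)
    (h : ∀ ξ : EuclideanSpace ℝ (Fin d),
      ∫ x, (F x : ℂ) * Complex.exp (inner ℝ x ξ * Complex.I) =
        ∫ x, (G x : ℂ) * Complex.exp (inner ℝ x ξ * Complex.I)) : F =ᵐ[volume] G := by
  set k : EuclideanSpace ℝ (Fin d) → ℝ := fun x => F x - G x with hk
  have hki : Integrable k := hF.sub hG
  have hmeas : ∀ u : EuclideanSpace ℝ (Fin d) → ℝ, Integrable u →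
      AEMeasurable (fun x => ENNReal.ofReal (u x)) := fun u hu =>
    hu.aemeasurable.ennreal_ofReal
  have hlt : ∀ u : EuclideanSpace ℝ (Fin d) → ℝ, Integrable u →
      ∫⁻ x, ENNReal.ofReal (u x) ≠ ⊤ := fun u hu =>
    (lt_of_le_of_lt (lintegral_mono fun x => Real.ofReal_le_enorm (u x)) hu.hasFiniteIntegral).ne
  have hchar : ∀ u : EuclideanSpace ℝ (Fin d) → ℝ, Integrable u → ∀ ξ,
      charFun (volume.withDensity fun x => ENNReal.ofReal (u x)) ξ =
        ∫ x, ((max (u x) 0 : ℝ) : ℂ) * Complex.exp (inner ℝ x ξ * Complex.I) := by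
    intro u hu ξ
    rw [charFun_apply, integral_withDensity_eq_integral_toReal_smul₀ (hmeas u hu)
      (Eventually.of_forall fun x => ENNReal.ofReal_lt_top)]
    refine integral_congr_ae (Eventually.of_forall fun x => ?_)
    simp only [ENNReal.toReal_ofReal', Complex.real_smul]
  have hbdd : ∀ (u : EuclideanSpace ℝ (Fin d) → ℝ) (ξ : EuclideanSpace ℝ (Fin d)), Integrable u →
      Integrable fun x => (u x : ℂ) * Complex.exp (inner ℝ x ξ * Complex.I) := fun u ξ hu =>
    hu.ofReal.mul_bdd (c := 1) (by fun_prop)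
      (Eventually.of_forall fun x => (Complex.norm_exp_ofReal_mul_I _).le)
  have : IsFiniteMeasure (volume.withDensity fun x => ENNReal.ofReal (k x)) :=
    isFiniteMeasure_withDensity (hlt k hki)
  have : IsFiniteMeasure (volume.withDensity fun x => ENNReal.ofReal (-k x)) :=
    isFiniteMeasure_withDensity (hlt _ hki.neg)
  have heq : (volume.withDensity fun x => ENNReal.ofReal (k x)) =
      volume.withDensity fun x => ENNReal.ofReal (-k x) := by
    refine Measure.ext_of_charFun (funext fun ξ => ?_)
    rw [hchar k hki, hchar (fun x => -k x) hki.neg, ← sub_eq_zero,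
      ← integral_sub (hbdd _ ξ hki.pos_part) (hbdd _ ξ hki.neg_part)]
    have hξ := h ξ
    rw [← sub_eq_zero, ← integral_sub (hbdd F ξ hF) (hbdd G ξ hG)] at hξ
    rw [← hξ]
    refine integral_congr_ae (Eventually.of_forall fun x => ?_)
    simp only [hk, ← sub_mul, ← Complex.ofReal_sub]
    congr 2
    rcases le_total (F x - G x) 0 with hx | hx
    · rw [max_eq_right hx, max_eq_left (by linarith)]; ring
    · rw [max_eq_left hx, max_eq_right (by linarith)]; ring
  have hae := (withDensity_eq_iff (hmeas k hki) (hmeas _ hki.neg) (hlt k hki)).mp heq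
  filter_upwards [hae] with x hx
  rw [Pi.neg_apply] at hx
  rw [← sub_eq_zero]
  change k x = 0
  rcases le_total (k x) 0 with h0 | h0
  · rw [ENNReal.ofReal_of_nonpos h0, eq_comm, ENNReal.ofReal_eq_zero] at hx
    linarith
  · rw [ENNReal.ofReal_of_nonpos (neg_nonpos.mpr h0), ENNReal.ofReal_eq_zero] at hx
    linarith

/-- The density `(2π)^{-d/2} exp (-|x|²/2)` of the standard Gaussian measure. -/
noncomputable def gaussDensity {d : ℕ} (x : EuclideanSpace ℝ (Fin d)) : ℝ :=
  ((2 * Real.pi) ^ ((d : ℝ) / 2))⁻¹ * Real.exp (-(‖x‖ ^ 2 / 2))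

theorem gaussDensity_pos {d : ℕ} (x : EuclideanSpace ℝ (Fin d)) : 0 < gaussDensity x := by
  unfold gaussDensity
  positivity

theorem continuous_gaussDensity {d : ℕ} :
    Continuous (gaussDensity : EuclideanSpace ℝ (Fin d) → ℝ) := by
  unfold gaussDensity
  fun_prop

theorem integrable_gaussDensity {d : ℕ} :
    Integrable (gaussDensity : EuclideanSpace ℝ (Fin d) → ℝ) := by
  have h := GaussianFourier.integrable_cexp_neg_mul_sq_norm_add (V := EuclideanSpace ℝ (Fin d))
    (b := 1 / 2) (by norm_num) 0 0
  have h2 := h.re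
  refine (h2.const_mul ((2 * Real.pi) ^ ((d : ℝ) / 2))⁻¹).congr (Eventually.of_forall fun x => ?_)
  simp only [gaussDensity]
  congr 1
  have : (-(1 / 2) * (‖x‖ : ℂ) ^ 2 + 0 * ((inner ℝ (0 : EuclideanSpace ℝ (Fin d)) x : ℝ) : ℂ)) =
      ((-(‖x‖ ^ 2 / 2) : ℝ) : ℂ) := by
    push_cast; ring
  rw [this]
  exact Complex.exp_ofReal_re _

theorem integral_gaussDensity_mul_cexp {d : ℕ} (ξ : EuclideanSpace ℝ (Fin d)) :
    ∫ x, (gaussDensity x : ℂ) * Complex.exp (inner ℝ x ξ * Complex.I) =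
      Complex.exp (-‖ξ‖ ^ 2 / 2) := by
  have h := GaussianFourier.integral_cexp_neg_mul_sq_norm_add (V := EuclideanSpace ℝ (Fin d))
    (b := 1 / 2) (by norm_num) Complex.I ξ
  have hc : ((((2 * Real.pi) ^ ((d : ℝ) / 2))⁻¹ : ℝ) : ℂ) *
      ((Real.pi : ℂ) / (1 / 2)) ^ ((Module.finrank ℝ (EuclideanSpace ℝ (Fin d)) : ℂ) / 2) = 1 := by
    have h2 : ((Real.pi : ℂ) / (1 / 2)) = ((2 * Real.pi : ℝ) : ℂ) := by push_cast; ring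
    have h3 : ((Module.finrank ℝ (EuclideanSpace ℝ (Fin d)) : ℂ) / 2) =
        (((d : ℝ) / 2 : ℝ) : ℂ) := by
      simp
    rw [h2, h3, ← Complex.ofReal_cpow (by positivity), ← Complex.ofReal_mul,
      inv_mul_cancel₀ (by positivity), Complex.ofReal_one]
  calc ∫ x, (gaussDensity x : ℂ) * Complex.exp (inner ℝ x ξ * Complex.I)
      = ((((2 * Real.pi) ^ ((d : ℝ) / 2))⁻¹ : ℝ) : ℂ) *
          ∫ x : EuclideanSpace ℝ (Fin d),
            Complex.exp (-(1 / 2) * ‖x‖ ^ 2 + Complex.I * inner ℝ ξ x) := by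
        rw [← integral_const_mul]
        refine integral_congr_ae (Eventually.of_forall fun x => ?_)
        simp only [gaussDensity, Complex.ofReal_mul, mul_assoc, Complex.ofReal_exp,
          ← Complex.exp_add]
        congr 2
        rw [real_inner_comm]
        push_cast
        ring
    _ = Complex.exp (-‖ξ‖ ^ 2 / 2) := by
        rw [h, ← mul_assoc, hc, one_mul]
        congr 1
        rw [Complex.I_sq]
        ring

theorem stdGaussian_eq_withDensity {d : ℕ} : stdGaussian (EuclideanSpace ℝ (Fin d)) =
    volume.withDensity fun x => ENNReal.ofReal (gaussDensity x) := by
  have : IsFiniteMeasure (volume.withDensity fun x : EuclideanSpace ℝ (Fin d) =>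
      ENNReal.ofReal (gaussDensity x)) :=
    isFiniteMeasure_withDensity (lt_of_le_of_lt
      (lintegral_mono fun x => Real.ofReal_le_enorm _) integrable_gaussDensity.hasFiniteIntegral).ne
  refine Measure.ext_of_charFun (funext fun ξ => ?_)
  rw [charFun_stdGaussian, charFun_apply, integral_withDensity_eq_integral_toReal_smul
    (by exact continuous_gaussDensity.measurable.ennreal_ofReal)
    (Eventually.of_forall fun x => ENNReal.ofReal_lt_top),
    ← integral_gaussDensity_mul_cexp]
  refine integral_congr_ae (Eventually.of_forall fun x => ?_)
  simp only [ENNReal.toReal_ofReal (gaussDensity_pos x).le, Complex.real_smul]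

/-- Integrals against the standard Gaussian measure in terms of its density. -/
theorem integral_stdGaussian {d : ℕ} {F : Type*} [NormedAddCommGroup F] [NormedSpace ℝ F]
    (h : EuclideanSpace ℝ (Fin d) → F) :
    ∫ x, h x ∂(stdGaussian (EuclideanSpace ℝ (Fin d))) = ∫ x, gaussDensity x • h x := by
  rw [stdGaussian_eq_withDensity, integral_withDensity_eq_integral_toReal_smul
    (by exact continuous_gaussDensity.measurable.ennreal_ofReal)
    (Eventually.of_forall fun x => ENNReal.ofReal_lt_top)]
  simp only [ENNReal.toReal_ofReal (gaussDensity_pos _).le]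

theorem integrable_stdGaussian_iff {d : ℕ} {F : Type*} [NormedAddCommGroup F] [NormedSpace ℝ F]
    {h : EuclideanSpace ℝ (Fin d) → F} :
    Integrable h (stdGaussian (EuclideanSpace ℝ (Fin d))) ↔
      Integrable fun x => gaussDensity x • h x := by
  rw [stdGaussian_eq_withDensity, integrable_withDensity_iff_integrable_smul'
    (by exact continuous_gaussDensity.measurable.ennreal_ofReal)
    (Eventually.of_forall fun x => ENNReal.ofReal_lt_top)]
  simp only [ENNReal.toReal_ofReal (gaussDensity_pos _).le]

theorem volume_absolutelyContinuous_stdGaussian {d : ℕ} :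
    (volume : Measure (EuclideanSpace ℝ (Fin d))) ≪ stdGaussian (EuclideanSpace ℝ (Fin d)) := by
  rw [stdGaussian_eq_withDensity]
  refine withDensity_absolutelyContinuous'
    (by exact continuous_gaussDensity.measurable.ennreal_ofReal.aemeasurable) ?_
  exact Eventually.of_forall fun x => (ENNReal.ofReal_pos.mpr (gaussDensity_pos x)).ne'

theorem stdGaussian_absolutelyContinuous_volume {d : ℕ} :
    stdGaussian (EuclideanSpace ℝ (Fin d)) ≪ (volume : Measure (EuclideanSpace ℝ (Fin d))) := by
  rw [stdGaussian_eq_withDensity]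
  exact withDensity_absolutelyContinuous _ _

/-- The equilibrium of unit mass is the standard Gaussian density: it is itself a solution, and
its Fourier transform at `ξ` is determined by letting `t → ∞` in the evolution of the Fourier
transform. -/
theorem IsEquilibrium.eq_gaussDensity {d : ℕ} {D C P : Matrix (Fin d) (Fin d) ℝ}
    (hsymm : D = (1 / 2 : ℝ) • (C + Cᵀ)) {l : ℝ} (hl : 0 < l) (hP : P.PosDef)
    (hCP : (Cᵀ * P + P * C - (2 * l) • P).PosSemidef)
    {fInf : EuclideanSpace ℝ (Fin d) → ℝ} (h : IsEquilibrium D C fInf) : fInf = gaussDensity := by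
  have hsol : IsFPSolution D C fInf (fun _ => fInf) :=
    { initial := ae_eq_refl _
      integrable := fun _ _ => h.integrable
      continuous_L1 := fun t _ => by simpa using tendsto_const_nhds
      contDiffOn := (h.contDiff.comp contDiff_snd).contDiffOn
      equation := fun t _ x => by
        rw [h.stationary x]
        exact hasDerivAt_const t (fInf x) }
  refine (h.contDiff.continuous.ae_eq_iff_eq _ continuous_gaussDensity).mp
    (ae_eq_of_forall_integral_mul_cexp_eq h.integrable integrable_gaussDensity fun ξ => ?_)
  rw [integral_gaussDensity_mul_cexp]
  have hA := tendsto_driftFlow_transpose hl hP hCP ξ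
  have hint : Continuous fun ζ : EuclideanSpace ℝ (Fin d) =>
      Complex.exp (‖ζ‖ ^ 2 / 2) * ∫ x, (fInf x : ℂ) * Complex.exp (inner ℝ x ζ * Complex.I) := by
    refine Continuous.mul (by fun_prop) ?_
    refine continuous_of_dominated (bound := fun x => |fInf x|) ?_ ?_ h.integrable.abs ?_
    · intro ζ
      exact h.integrable.ofReal.aestronglyMeasurable.mul (by fun_prop)
    · intro ζ
      refine Eventually.of_forall fun x => ?_
      rw [norm_mul, Complex.norm_exp_ofReal_mul_I, mul_one, Complex.norm_real, Real.norm_eq_abs]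
    · exact Eventually.of_forall fun x => by fun_prop
  have hlim := (hint.tendsto 0).comp hA
  have hconst : ∀ᶠ t in atTop, Complex.exp (‖ξ‖ ^ 2 / 2) *
      ∫ x, (fInf x : ℂ) * Complex.exp (inner ℝ x ξ * Complex.I) =
      ((fun ζ : EuclideanSpace ℝ (Fin d) => Complex.exp (‖ζ‖ ^ 2 / 2) *
        ∫ x, (fInf x : ℂ) * Complex.exp (inner ℝ x ζ * Complex.I)) ∘
        fun t => Matrix.toEuclideanCLM (𝕜 := ℝ) (driftFlow C t)ᵀ ξ) t := by
    filter_upwards [eventually_ge_atTop 0] with t ht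
    have := integral_mul_cexp_driftFlow hsymm hsol le_rfl ht ξ
    rwa [sub_zero] at this
  have heq := tendsto_nhds_unique (tendsto_const_nhds.congr' hconst) hlim
  simp only [norm_zero, inner_zero_right, Complex.ofReal_zero, zero_mul, Complex.exp_zero, mul_one,
    integral_complex_ofReal, h.unit_mass, Complex.ofReal_one] at heq
  rw [neg_div, Complex.exp_neg, ← mul_right_inj' (Complex.exp_ne_zero (‖ξ‖ ^ 2 / 2 : ℂ)), heq,
    mul_inv_cancel₀ (Complex.exp_ne_zero _)]
  norm_num

/-! ### The Mehler representation -/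

theorem inner_toEuclideanCLM_transpose {d : ℕ} (A : Matrix (Fin d) (Fin d) ℝ)
    (x y : EuclideanSpace ℝ (Fin d)) :
    inner ℝ (Matrix.toEuclideanCLM (𝕜 := ℝ) Aᵀ x) y =
      inner ℝ x (Matrix.toEuclideanCLM (𝕜 := ℝ) A y) := by
  rw [real_inner_comm, Matrix.inner_toEuclideanCLM, Matrix.inner_toEuclideanCLM,
    Matrix.mulVec_transpose, dotProduct_comm, ← Matrix.dotProduct_mulVec]

theorem dotProduct_one_sub_mul_transpose {d : ℕ} (A : Matrix (Fin d) (Fin d) ℝ)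
    (x : EuclideanSpace ℝ (Fin d)) :
    x.ofLp ⬝ᵥ ((1 - A * Aᵀ) *ᵥ x.ofLp) =
      ‖x‖ ^ 2 - ‖Matrix.toEuclideanCLM (𝕜 := ℝ) Aᵀ x‖ ^ 2 := by
  rw [← Matrix.inner_toEuclideanCLM, map_sub, map_one, map_mul, sub_apply,
    one_apply_eq_self, inner_sub_right, real_inner_self_eq_norm_sq, ← real_inner_self_eq_norm_sq
    (Matrix.toEuclideanCLM (𝕜 := ℝ) Aᵀ x), inner_toEuclideanCLM_transpose]
  rfl

theorem posSemidef_one_sub_mul_transpose {d : ℕ} {A : Matrix (Fin d) (Fin d) ℝ}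
    (h : ∀ x : EuclideanSpace ℝ (Fin d), ‖Matrix.toEuclideanCLM (𝕜 := ℝ) Aᵀ x‖ ^ 2 ≤ ‖x‖ ^ 2) :
    (1 - A * Aᵀ).PosSemidef := by
  refine Matrix.PosSemidef.of_dotProduct_mulVec_nonneg ?_ fun x => ?_
  · refine Matrix.isHermitian_one.sub ?_
    rw [← Matrix.conjTranspose_eq_transpose_of_trivial]
    exact Matrix.isHermitian_mul_conjTranspose_self A
  · have := dotProduct_one_sub_mul_transpose A (WithLp.toLp 2 x)
    rw [star_trivial]
    rw [this]
    linarith [h (WithLp.toLp 2 x)]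

theorem posDef_one_sub_mul_transpose {d : ℕ} {A : Matrix (Fin d) (Fin d) ℝ}
    (h : ∀ x : EuclideanSpace ℝ (Fin d), x ≠ 0 →
      ‖Matrix.toEuclideanCLM (𝕜 := ℝ) Aᵀ x‖ ^ 2 < ‖x‖ ^ 2) : (1 - A * Aᵀ).PosDef := by
  refine Matrix.PosDef.of_dotProduct_mulVec_pos ?_ fun x hx => ?_
  · refine Matrix.isHermitian_one.sub ?_
    rw [← Matrix.conjTranspose_eq_transpose_of_trivial]
    exact Matrix.isHermitian_mul_conjTranspose_self A
  · have := dotProduct_one_sub_mul_transpose A (WithLp.toLp 2 x)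
    rw [star_trivial]
    rw [this]
    linarith [h (WithLp.toLp 2 x) fun h0 => hx (congrArg WithLp.ofLp h0)]

theorem charFun_multivariateGaussian_one_sub {d : ℕ} {A : Matrix (Fin d) (Fin d) ℝ}
    (h : (1 - A * Aᵀ).PosSemidef) (x : EuclideanSpace ℝ (Fin d)) :
    charFun (multivariateGaussian 0 (1 - A * Aᵀ)) x =
      Complex.exp (-(((‖x‖ ^ 2 - ‖Matrix.toEuclideanCLM (𝕜 := ℝ) Aᵀ x‖ ^ 2 : ℝ) : ℂ) / 2)) := by
  rw [charFun_multivariateGaussian h, dotProduct_one_sub_mul_transpose, inner_zero_right]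
  congr 1
  push_cast
  ring

/-- Time reversal of the Ornstein-Uhlenbeck transition. Let `X`, `Y`, `Z`, `W` be centred Gaussian,
`X` and `Z` standard, `Y` and `W` independent of `X` and `Z` with covariances `1 - A Aᵀ` and
`1 - Aᵀ A`. Then `(A X + Y, X)` and `(Z, Aᵀ Z + W)` have the same law. -/
theorem map_prod_multivariateGaussian_swap {d : ℕ} {A : Matrix (Fin d) (Fin d) ℝ}
    (h₁ : (1 - A * Aᵀ).PosSemidef) (h₂ : (1 - Aᵀ * A).PosSemidef) :
    ((stdGaussian (EuclideanSpace ℝ (Fin d))).prod (multivariateGaussian 0 (1 - A * Aᵀ))).map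
        (fun p => (Matrix.toEuclideanCLM (𝕜 := ℝ) A p.1 + p.2, p.1)) =
      ((stdGaussian (EuclideanSpace ℝ (Fin d))).prod (multivariateGaussian 0 (1 - Aᵀ * A))).map
        (fun p => (p.1, Matrix.toEuclideanCLM (𝕜 := ℝ) Aᵀ p.1 + p.2)) := by
  have h₂' : (1 - Aᵀ * Aᵀᵀ).PosSemidef := by rwa [Matrix.transpose_transpose]
  have hc₂ := charFun_multivariateGaussian_one_sub h₂'
  rw [Matrix.transpose_transpose] at hc₂
  let T : EuclideanSpace ℝ (Fin d) × EuclideanSpace ℝ (Fin d) →L[ℝ]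
      EuclideanSpace ℝ (Fin d) × EuclideanSpace ℝ (Fin d) :=
    ((Matrix.toEuclideanCLM (𝕜 := ℝ) A).comp
        (ContinuousLinearMap.fst ℝ (EuclideanSpace ℝ (Fin d)) (EuclideanSpace ℝ (Fin d))) +
      ContinuousLinearMap.snd ℝ (EuclideanSpace ℝ (Fin d)) (EuclideanSpace ℝ (Fin d))).prod
        (ContinuousLinearMap.fst ℝ (EuclideanSpace ℝ (Fin d)) (EuclideanSpace ℝ (Fin d)))
  let T' : EuclideanSpace ℝ (Fin d) × EuclideanSpace ℝ (Fin d) →L[ℝ]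
      EuclideanSpace ℝ (Fin d) × EuclideanSpace ℝ (Fin d) :=
    (ContinuousLinearMap.fst ℝ (EuclideanSpace ℝ (Fin d)) (EuclideanSpace ℝ (Fin d))).prod
      ((Matrix.toEuclideanCLM (𝕜 := ℝ) Aᵀ).comp
          (ContinuousLinearMap.fst ℝ (EuclideanSpace ℝ (Fin d)) (EuclideanSpace ℝ (Fin d))) +
        ContinuousLinearMap.snd ℝ (EuclideanSpace ℝ (Fin d)) (EuclideanSpace ℝ (Fin d)))
  change Measure.map T _ = Measure.map T' _
  have : IsProbabilityMeasure (((stdGaussian (EuclideanSpace ℝ (Fin d))).prod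
      (multivariateGaussian 0 (1 - A * Aᵀ))).map T) :=
    Measure.isProbabilityMeasure_map T.continuous.aemeasurable
  have : IsProbabilityMeasure (((stdGaussian (EuclideanSpace ℝ (Fin d))).prod
      (multivariateGaussian 0 (1 - Aᵀ * A))).map T') :=
    Measure.isProbabilityMeasure_map T'.continuous.aemeasurable
  refine Measure.ext_of_charFunDual (funext fun L => ?_)
  obtain ⟨η, hη⟩ : ∃ η : EuclideanSpace ℝ (Fin d), ∀ x, L (x, 0) = inner ℝ η x :=
    ⟨(InnerProductSpace.toDual ℝ _).symm (L.comp (.inl ℝ _ _)), fun x => by simp⟩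
  obtain ⟨ξ, hξ⟩ : ∃ ξ : EuclideanSpace ℝ (Fin d), ∀ x, L (0, x) = inner ℝ ξ x :=
    ⟨(InnerProductSpace.toDual ℝ _).symm (L.comp (.inr ℝ _ _)), fun x => by simp⟩
  have hL : ∀ x y, L (x, y) = inner ℝ η x + inner ℝ ξ y := fun x y => by
    rw [← hη, ← hξ, ← map_add]; simp
  rw [charFunDual_map, charFunDual_map, charFunDual_prod, charFunDual_prod]
  have e1 : (L.comp T).comp (.inl ℝ _ _) = InnerProductSpace.toDualMap ℝ _
      (Matrix.toEuclideanCLM (𝕜 := ℝ) Aᵀ η + ξ) := by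
    ext x
    simp [T, hL, inner_toEuclideanCLM_transpose]
  have e2 : (L.comp T).comp (.inr ℝ _ _) = InnerProductSpace.toDualMap ℝ _ η := by
    ext x
    simp [T, hL]
  have e3 : (L.comp T').comp (.inl ℝ _ _) = InnerProductSpace.toDualMap ℝ _
      (η + Matrix.toEuclideanCLM (𝕜 := ℝ) A ξ) := by
    ext x
    have := inner_toEuclideanCLM_transpose Aᵀ ξ x
    rw [Matrix.transpose_transpose] at this
    simp [T', hL, this]
  have e4 : (L.comp T').comp (.inr ℝ _ _) = InnerProductSpace.toDualMap ℝ _ ξ := by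
    ext x
    simp [T', hL]
  rw [e1, e2, e3, e4]
  simp only [← charFun_eq_charFunDual_toDualMap]
  rw [charFun_stdGaussian, charFun_stdGaussian, charFun_multivariateGaussian_one_sub h₁, hc₂,
    ← Complex.exp_add, ← Complex.exp_add]
  congr 1
  simp only [← Complex.ofReal_pow, norm_add_sq_real, inner_toEuclideanCLM_transpose]
  push_cast
  ring

/-- The standard Gaussian measure is invariant under the transition operator. -/
theorem measurePreserving_mehler {d : ℕ} {A : Matrix (Fin d) (Fin d) ℝ}
    (h₁ : (1 - A * Aᵀ).PosSemidef) (h₂ : (1 - Aᵀ * A).PosSemidef) :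
    MeasurePreserving (fun p : EuclideanSpace ℝ (Fin d) × EuclideanSpace ℝ (Fin d) =>
        Matrix.toEuclideanCLM (𝕜 := ℝ) A p.1 + p.2)
      ((stdGaussian (EuclideanSpace ℝ (Fin d))).prod (multivariateGaussian 0 (1 - A * Aᵀ)))
      (stdGaussian (EuclideanSpace ℝ (Fin d))) := by
  refine ⟨by fun_prop, ?_⟩
  have h := congrArg (Measure.map Prod.fst) (map_prod_multivariateGaussian_swap h₁ h₂)
  rw [Measure.map_map (by fun_prop) (by fun_prop), Measure.map_map (by fun_prop) (by fun_prop)] at h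
  refine h.trans ?_
  exact (Measure.map_fst_prod).trans (by simp)

/-- The Ornstein-Uhlenbeck transition operator `h ↦ E[h(A x + Y)]` with `Y` centred Gaussian of
covariance `1 - A Aᵀ` (Mehler's formula). -/
noncomputable def mehler {d : ℕ} {F : Type*} [NormedAddCommGroup F] [NormedSpace ℝ F]
    (A : Matrix (Fin d) (Fin d) ℝ) (h : EuclideanSpace ℝ (Fin d) → F)
    (x : EuclideanSpace ℝ (Fin d)) : F :=
  ∫ y, h (Matrix.toEuclideanCLM (𝕜 := ℝ) A x + y) ∂(multivariateGaussian 0 (1 - A * Aᵀ))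

theorem integrable_comp_mehler {d : ℕ} {F : Type*} [NormedAddCommGroup F]
    {A : Matrix (Fin d) (Fin d) ℝ} (h₁ : (1 - A * Aᵀ).PosSemidef) (h₂ : (1 - Aᵀ * A).PosSemidef)
    {h : EuclideanSpace ℝ (Fin d) → F} (hh : Integrable h (stdGaussian _)) :
    Integrable (fun p : EuclideanSpace ℝ (Fin d) × EuclideanSpace ℝ (Fin d) =>
        h (Matrix.toEuclideanCLM (𝕜 := ℝ) A p.1 + p.2))
      ((stdGaussian (EuclideanSpace ℝ (Fin d))).prod (multivariateGaussian 0 (1 - A * Aᵀ))) :=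
  (measurePreserving_mehler h₁ h₂).integrable_comp_of_integrable hh

theorem integrable_mehler {d : ℕ} {F : Type*} [NormedAddCommGroup F] [NormedSpace ℝ F]
    {A : Matrix (Fin d) (Fin d) ℝ} (h₁ : (1 - A * Aᵀ).PosSemidef) (h₂ : (1 - Aᵀ * A).PosSemidef)
    {h : EuclideanSpace ℝ (Fin d) → F} (hh : Integrable h (stdGaussian _)) :
    Integrable (mehler A h) (stdGaussian _) :=
  (integrable_comp_mehler h₁ h₂ hh).integral_prod_left

/-- The effect of the transition operator on Fourier transforms. After time reversal the integral
factorises, and the Gaussian noise contributes its characteristic function. -/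
theorem integral_mehler_mul_cexp {d : ℕ} {A : Matrix (Fin d) (Fin d) ℝ}
    (h₁ : (1 - A * Aᵀ).PosSemidef) (h₂ : (1 - Aᵀ * A).PosSemidef)
    {h : EuclideanSpace ℝ (Fin d) → ℝ} (hh : Integrable h (stdGaussian _))
    (ξ : EuclideanSpace ℝ (Fin d)) :
    Complex.exp (‖ξ‖ ^ 2 / 2) * ∫ x, ((mehler A h x : ℝ) : ℂ) *
        Complex.exp (inner ℝ x ξ * Complex.I) ∂(stdGaussian _) =
      Complex.exp (‖Matrix.toEuclideanCLM (𝕜 := ℝ) A ξ‖ ^ 2 / 2) * ∫ z, (h z : ℂ) *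
        Complex.exp (inner ℝ z (Matrix.toEuclideanCLM (𝕜 := ℝ) A ξ) * Complex.I)
        ∂(stdGaussian _) := by
  have h₂' : (1 - Aᵀ * Aᵀᵀ).PosSemidef := by rwa [Matrix.transpose_transpose]
  have hc := charFun_multivariateGaussian_one_sub h₂'
  rw [Matrix.transpose_transpose] at hc
  set T := fun p : EuclideanSpace ℝ (Fin d) × EuclideanSpace ℝ (Fin d) =>
    (Matrix.toEuclideanCLM (𝕜 := ℝ) A p.1 + p.2, p.1) with hT
  set T' := fun p : EuclideanSpace ℝ (Fin d) × EuclideanSpace ℝ (Fin d) =>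
    (p.1, Matrix.toEuclideanCLM (𝕜 := ℝ) Aᵀ p.1 + p.2) with hT'
  have hswap := map_prod_multivariateGaussian_swap h₁ h₂
  have hTm : Measurable T := by fun_prop
  have hTm' : Measurable T' := by fun_prop
  set π := ((stdGaussian (EuclideanSpace ℝ (Fin d))).prod
    (multivariateGaussian 0 (1 - Aᵀ * A))).map T' with hπ
  have hfst : MeasurePreserving Prod.fst π (stdGaussian (EuclideanSpace ℝ (Fin d))) := by
    refine ⟨measurable_fst, ?_⟩
    rw [hπ, Measure.map_map measurable_fst hTm']
    exact (Measure.map_fst_prod).trans (by simp)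
  set H : EuclideanSpace ℝ (Fin d) × EuclideanSpace ℝ (Fin d) → ℂ := fun p =>
    (h p.1 : ℂ) * Complex.exp (inner ℝ p.2 ξ * Complex.I) with hH
  have hHi : Integrable H π :=
    (hfst.integrable_comp_of_integrable hh).ofReal.mul_bdd (c := 1) (by fun_prop)
      (Eventually.of_forall fun x => (Complex.norm_exp_ofReal_mul_I _).le)
  have e1 : ∫ x, ((mehler A h x : ℝ) : ℂ) * Complex.exp (inner ℝ x ξ * Complex.I)
      ∂(stdGaussian _) =
      ∫ p, H p ∂π := by
    rw [← hswap, integral_map hTm.aemeasurable (by rw [hswap]; exact hHi.aestronglyMeasurable)]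
    have hi : Integrable (fun p => H (T p)) ((stdGaussian (EuclideanSpace ℝ (Fin d))).prod
        (multivariateGaussian 0 (1 - A * Aᵀ))) := by
      rw [← hswap] at hHi
      exact hHi.comp_measurable hTm
    rw [integral_prod _ hi]
    refine integral_congr_ae (Eventually.of_forall fun x => ?_)
    simp only [hH, hT, mehler]
    rw [integral_mul_const, integral_complex_ofReal]
  have e2 : ∫ p, H p ∂π = (∫ z, (h z : ℂ) *
      Complex.exp (inner ℝ z (Matrix.toEuclideanCLM (𝕜 := ℝ) A ξ) * Complex.I) ∂(stdGaussian _)) *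
      charFun (multivariateGaussian 0 (1 - Aᵀ * A)) ξ := by
    rw [hπ, integral_map hTm'.aemeasurable hHi.aestronglyMeasurable, charFun_apply,
      ← integral_prod_mul]
    refine integral_congr_ae (Eventually.of_forall fun p => ?_)
    simp only [hH, hT', inner_add_left, inner_toEuclideanCLM_transpose, Complex.ofReal_add, add_mul,
      Complex.exp_add, mul_assoc]
  rw [e1, e2, hc, mul_comm (∫ z, _ ∂_), ← mul_assoc, ← Complex.exp_add]
  congr 2
  push_cast
  ring

/-- A Fourier relation between two functions identifies the second one as the image of the first
one under the transition operator. -/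
theorem div_gaussDensity_ae_eq_mehler {d : ℕ} {A : Matrix (Fin d) (Fin d) ℝ}
    (h₁ : (1 - A * Aᵀ).PosSemidef) (h₂ : (1 - Aᵀ * A).PosSemidef)
    {ga gb : EuclideanSpace ℝ (Fin d) → ℝ} (ha : Integrable ga) (hb : Integrable gb)
    (h : ∀ ξ : EuclideanSpace ℝ (Fin d),
      Complex.exp (‖ξ‖ ^ 2 / 2) * ∫ x, (gb x : ℂ) * Complex.exp (inner ℝ x ξ * Complex.I) =
        Complex.exp (‖Matrix.toEuclideanCLM (𝕜 := ℝ) A ξ‖ ^ 2 / 2) * ∫ x, (ga x : ℂ) *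
          Complex.exp (inner ℝ x (Matrix.toEuclideanCLM (𝕜 := ℝ) A ξ) * Complex.I)) :
    (fun x => gb x / gaussDensity x) =ᵐ[volume] mehler A fun x => ga x / gaussDensity x := by
  have hcancel : ∀ (g : EuclideanSpace ℝ (Fin d) → ℝ) x,
      gaussDensity x * (g x / gaussDensity x) = g x := fun g x =>
    mul_div_cancel₀ _ (gaussDensity_pos x).ne'
  have hia : Integrable (fun x => ga x / gaussDensity x) (stdGaussian _) := by
    rw [integrable_stdGaussian_iff]
    simpa only [smul_eq_mul, hcancel] using ha
  have hm := integrable_stdGaussian_iff.mp (integrable_mehler h₁ h₂ hia)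
  have hae : gb =ᵐ[volume] fun x => gaussDensity x *
      mehler A (fun x => ga x / gaussDensity x) x := by
    refine ae_eq_of_forall_integral_mul_cexp_eq hb hm fun ξ => ?_
    have hξ := integral_mehler_mul_cexp h₁ h₂ hia ξ
    rw [integral_stdGaussian, integral_stdGaussian] at hξ
    have e1 : ∫ x, gaussDensity x • (((ga x / gaussDensity x : ℝ) : ℂ) *
        Complex.exp (inner ℝ x (Matrix.toEuclideanCLM (𝕜 := ℝ) A ξ) * Complex.I)) =
        ∫ x, (ga x : ℂ) *
          Complex.exp (inner ℝ x (Matrix.toEuclideanCLM (𝕜 := ℝ) A ξ) * Complex.I) := by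
      refine integral_congr_ae (Eventually.of_forall fun x => ?_)
      simp only [Complex.real_smul]
      rw [← mul_assoc, ← Complex.ofReal_mul, hcancel]
    rw [e1, ← h ξ] at hξ
    rw [← mul_left_cancel₀ (Complex.exp_ne_zero _) hξ]
    refine integral_congr_ae (Eventually.of_forall fun x => ?_)
    simp only [Complex.real_smul]
    push_cast
    ring
  filter_upwards [hae] with x hx
  rw [hx, mul_div_cancel_left₀ _ (gaussDensity_pos x).ne']

open scoped MatrixOrder in
theorem volume_absolutelyContinuous_multivariateGaussian {d : ℕ} {S : Matrix (Fin d) (Fin d) ℝ}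
    (hS : S.PosDef) :
    (volume : Measure (EuclideanSpace ℝ (Fin d))) ≪ multivariateGaussian 0 S := by
  set B := Matrix.toEuclideanCLM (𝕜 := ℝ) (CFC.sqrt S) with hB
  have hdet : LinearMap.det (B : EuclideanSpace ℝ (Fin d) →ₗ[ℝ] EuclideanSpace ℝ (Fin d)) ≠ 0 := by
    have hS2 := CFC.sqrt_mul_sqrt_self S hS.posSemidef.nonneg
    have hu : IsUnit (CFC.sqrt S) := by
      rw [Matrix.isUnit_iff_isUnit_det]
      refine isUnit_of_mul_isUnit_left (y := (CFC.sqrt S).det) ?_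
      rw [← Matrix.det_mul, hS2]
      exact (Matrix.isUnit_iff_isUnit_det S).mp hS.isUnit
    have hB1 : IsUnit B := hu.map (Matrix.toEuclideanCLM (n := Fin d) (𝕜 := ℝ))
    have hB2 := (hB1.map (ContinuousLinearMap.toLinearMapRingHom :
      (EuclideanSpace ℝ (Fin d) →L[ℝ] EuclideanSpace ℝ (Fin d)) →+* _)).map LinearMap.det
    exact hB2.ne_zero
  refine Measure.AbsolutelyContinuous.mk fun s hs h0 => ?_
  rw [multivariateGaussian, Measure.map_apply (by fun_prop) hs] at h0
  simp only [zero_add] at h0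
  have h1 := volume_absolutelyContinuous_stdGaussian h0
  have h2 := Measure.addHaar_preimage_linearMap (volume : Measure (EuclideanSpace ℝ (Fin d))) hdet s
  rw [show (B : EuclideanSpace ℝ (Fin d) →ₗ[ℝ] EuclideanSpace ℝ (Fin d)) ⁻¹' s = B ⁻¹' s from rfl]
    at h2
  rw [show volume (B ⁻¹' s) = 0 from h1, eq_comm, mul_eq_zero] at h2
  refine h2.resolve_left ?_
  simpa using hdet

/-- The transition operator with nondegenerate noise is positivity improving: where the average of
`u ≥ 0` vanishes, `u` vanishes almost everywhere. -/
theorem mehler_pos_ae {d : ℕ} {A : Matrix (Fin d) (Fin d) ℝ}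
    (h₁ : (1 - A * Aᵀ).PosDef) (h₂ : (1 - Aᵀ * A).PosSemidef)
    {u : EuclideanSpace ℝ (Fin d) → ℝ} (hu : Integrable u (stdGaussian _))
    (hu0 : ∀ᵐ x ∂(stdGaussian (EuclideanSpace ℝ (Fin d))), 0 ≤ u x)
    (hne : ∫ x, u x ∂(stdGaussian _) ≠ 0) :
    ∀ᵐ x ∂(stdGaussian (EuclideanSpace ℝ (Fin d))), 0 < mehler A u x := by
  have hmp := measurePreserving_mehler h₁.posSemidef h₂
  have hnn := Measure.ae_ae_of_ae_prod (hmp.quasiMeasurePreserving.ae hu0)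
  have hint := (integrable_comp_mehler h₁.posSemidef h₂ hu).prod_right_ae
  filter_upwards [hnn, hint] with x hx hxi
  refine lt_of_le_of_ne (integral_nonneg_of_ae hx) fun h0 => hne ?_
  have h0' := (integral_eq_zero_iff_of_nonneg_ae hx hxi).mp h0.symm
  have h3 : ∀ᵐ y, u (Matrix.toEuclideanCLM (𝕜 := ℝ) A x + y) = 0 :=
    (volume_absolutelyContinuous_multivariateGaussian h₁).ae_le h0'
  have h4 := (measurePreserving_add_left (volume : Measure (EuclideanSpace ℝ (Fin d)))
    (-(Matrix.toEuclideanCLM (𝕜 := ℝ) A x))).quasiMeasurePreserving.ae h3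
  simp only [add_neg_cancel_left] at h4
  exact integral_eq_zero_of_ae (stdGaussian_absolutelyContinuous_volume.ae_le h4)

/-! ### Entropy generators and Jensen's inequality -/

theorem IsEntropyGenerator.hasDerivAt_iteratedDeriv {ψ : ℝ → ℝ} (hψ : IsEntropyGenerator ψ)
    {n : ℕ} (hn : n < 4) {y : ℝ} (hy : 0 < y) :
    HasDerivAt (iteratedDeriv n ψ) (iteratedDeriv (n + 1) ψ y) y := by
  rw [iteratedDeriv_succ]
  refine DifferentiableAt.hasDerivAt ?_
  have h := (hψ.contDiffOn.differentiableOn_iteratedDerivWithin (m := n) (mod_cast hn)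
    (uniqueDiffOn_Ioi 0)) y hy
  have h2 := h.differentiableAt (Ioi_mem_nhds hy)
  refine h2.congr_of_eventuallyEq ?_
  filter_upwards [Ioi_mem_nhds hy] with z hz
  exact (iteratedDerivWithin_of_isOpen isOpen_Ioi hz).symm

/-- The admissibility condition says that `1 / ψ''` is concave on `(0, ∞)`. -/
theorem IsEntropyGenerator.concaveOn_inv {ψ : ℝ → ℝ} (hψ : IsEntropyGenerator ψ) :
    ConcaveOn ℝ (Ioi 0) fun y => (iteratedDeriv 2 ψ y)⁻¹ := by
  have h1 : ∀ y : ℝ, 0 < y → HasDerivAt (fun y => (iteratedDeriv 2 ψ y)⁻¹)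
      (-iteratedDeriv 3 ψ y / iteratedDeriv 2 ψ y ^ 2) y := fun y hy =>
    (hψ.hasDerivAt_iteratedDeriv (n := 2) (by norm_num) hy).fun_inv (hψ.second_pos y hy).ne'
  have hev : ∀ y : ℝ, 0 < y → deriv (fun y => (iteratedDeriv 2 ψ y)⁻¹) =ᶠ[𝓝 y]
      fun y => -iteratedDeriv 3 ψ y / iteratedDeriv 2 ψ y ^ 2 := fun y hy => by
    filter_upwards [Ioi_mem_nhds hy] with z hz using (h1 z hz).deriv
  have h2 : ∀ y : ℝ, 0 < y → HasDerivAt (deriv fun y => (iteratedDeriv 2 ψ y)⁻¹)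
      ((-iteratedDeriv 4 ψ y * iteratedDeriv 2 ψ y ^ 2 -
        -iteratedDeriv 3 ψ y * (2 * iteratedDeriv 2 ψ y * iteratedDeriv 3 ψ y)) /
          (iteratedDeriv 2 ψ y ^ 2) ^ 2) y := fun y hy => by
    have hd2 := hψ.hasDerivAt_iteratedDeriv (n := 2) (by norm_num) hy
    have hd3 := hψ.hasDerivAt_iteratedDeriv (n := 3) (by norm_num) hy
    have hpos := hψ.second_pos y hy
    have := (hd3.neg.div (hd2.pow 2) (pow_ne_zero 2 hpos.ne')).congr_of_eventuallyEq (hev y hy)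
    refine this.congr_deriv ?_
    simp
  refine concaveOn_of_deriv2_nonpos' (convex_Ioi 0)
    (fun y hy => (h1 y hy).differentiableAt.differentiableWithinAt)
    (fun y hy => (h2 y hy).differentiableAt.differentiableWithinAt) fun y hy => ?_
  rw [Function.iterate_succ, Function.iterate_one, Function.comp_apply, (h2 y hy).deriv]
  refine div_nonpos_of_nonpos_of_nonneg ?_ (by positivity)
  have h3 := hψ.third_sq_le y hy
  have hpos := hψ.second_pos y hy
  nlinarith [mul_le_mul_of_nonneg_left h3 hpos.le]

/-- A concave function lies below its tangent lines. -/
theorem IsEntropyGenerator.exists_tangent {ψ : ℝ → ℝ} (hψ : IsEntropyGenerator ψ) {a : ℝ}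
    (ha : 0 < a) : ∃ k : ℝ, ∀ u : ℝ, 0 < u →
      (iteratedDeriv 2 ψ u)⁻¹ ≤ (iteratedDeriv 2 ψ a)⁻¹ + k * (u - a) := by
  have hd := (hψ.hasDerivAt_iteratedDeriv (n := 2) (by norm_num) ha).fun_inv
    (hψ.second_pos a ha).ne'
  refine ⟨-iteratedDeriv 3 ψ a / iteratedDeriv 2 ψ a ^ 2, fun u hu => ?_⟩
  rcases lt_trichotomy u a with h | rfl | h
  · have := hψ.concaveOn_inv.le_slope_of_hasDerivAt hu ha h hd
    rw [slope_def_field, le_div_iff₀ (sub_pos.mpr h)] at this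
    linarith
  · simp
  · have := hψ.concaveOn_inv.slope_le_of_hasDerivAt ha hu h hd
    rw [slope_def_field, div_le_iff₀ (sub_pos.mpr h)] at this
    linarith

theorem measurable_fisherIntegrand (ψ : ℝ → ℝ) {d : ℕ} (P : Matrix (Fin d) (Fin d) ℝ) :
    Measurable fun p : ℝ × (Fin d → ℝ) => iteratedDeriv 2 ψ p.1 * (p.2 ⬝ᵥ (P *ᵥ p.2)) := by
  have h1 : Measurable (iteratedDeriv 2 ψ) := by
    rw [iteratedDeriv_succ]
    exact measurable_deriv _
  have h2 : Continuous fun v : Fin d → ℝ => v ⬝ᵥ (P *ᵥ v) := by fun_prop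
  exact (h1.comp measurable_fst).mul (h2.measurable.comp measurable_snd)

theorem IsEntropyGenerator.two_mul_dotProduct_le {ψ : ℝ → ℝ} (hψ : IsEntropyGenerator ψ) {d : ℕ}
    {P : Matrix (Fin d) (Fin d) ℝ} (hP : P.PosSemidef) {u : ℝ} (hu : 0 < u) (v w : Fin d → ℝ) :
    2 * (v ⬝ᵥ (P *ᵥ w)) ≤ iteratedDeriv 2 ψ u * (v ⬝ᵥ (P *ᵥ v)) +
      (iteratedDeriv 2 ψ u)⁻¹ * (w ⬝ᵥ (P *ᵥ w)) := by
  have := hP.two_mul_dotProduct_le (inv_pos.mpr (hψ.second_pos u hu)) v w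
  rwa [inv_inv] at this

theorem Matrix.PosSemidef.dotProduct_mulVec_self_nonneg {d : ℕ} {P : Matrix (Fin d) (Fin d) ℝ}
    (hP : P.PosSemidef) (v : Fin d → ℝ) : 0 ≤ v ⬝ᵥ (P *ᵥ v) := by
  simpa using hP.dotProduct_mulVec_nonneg v

/-- A vector field with finite weighted Fisher information is integrable, since `1 / ψ''` grows at
most linearly. -/
theorem IsEntropyGenerator.integrable_of_lintegral_lt_top {ψ : ℝ → ℝ} (hψ : IsEntropyGenerator ψ)
    {d : ℕ} {P : Matrix (Fin d) (Fin d) ℝ} (hP : P.PosDef) {Ω : Type*} [MeasurableSpace Ω]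
    {μ : Measure Ω} [IsFiniteMeasure μ] {u : Ω → ℝ} {v : Ω → Fin d → ℝ} (hu : Integrable u μ)
    (hu0 : ∀ᵐ x ∂μ, 0 < u x) (hv : AEStronglyMeasurable v μ)
    (hfin : ∫⁻ x, ENNReal.ofReal (iteratedDeriv 2 ψ (u x) * (v x ⬝ᵥ (P *ᵥ v x))) ∂μ < ⊤) :
    Integrable v μ := by
  have hF : Integrable (fun x => iteratedDeriv 2 ψ (u x) * (v x ⬝ᵥ (P *ᵥ v x))) μ := by
    have hmeas : AEStronglyMeasurable
        (fun x => iteratedDeriv 2 ψ (u x) * (v x ⬝ᵥ (P *ᵥ v x))) μ :=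
      ((measurable_fisherIntegrand ψ P).comp_aemeasurable
        (hu.aemeasurable.prodMk hv.aemeasurable)).aestronglyMeasurable
    refine ⟨hmeas, ?_⟩
    rw [hasFiniteIntegral_iff_ofReal]
    · exact hfin
    · filter_upwards [hu0] with x hx
      exact mul_nonneg (hψ.second_pos _ hx).le (hP.posSemidef.dotProduct_mulVec_self_nonneg _)
  obtain ⟨k, hk⟩ := hψ.exists_tangent one_pos
  have hlin : ∀ w : Fin d → ℝ, Integrable (fun x => v x ⬝ᵥ (P *ᵥ w)) μ := by
    intro w
    have hb : Integrable (fun x => iteratedDeriv 2 ψ (u x) * (v x ⬝ᵥ (P *ᵥ v x)) +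
        ((iteratedDeriv 2 ψ 1)⁻¹ + k * (u x - 1)) * (w ⬝ᵥ (P *ᵥ w))) μ :=
      hF.add (((integrable_const _).add ((hu.sub (integrable_const 1)).const_mul k)).mul_const _)
    refine hb.mono' ?_ ?_
    · have hc : Continuous fun z : Fin d → ℝ => z ⬝ᵥ (P *ᵥ w) := by fun_prop
      exact hc.comp_aestronglyMeasurable hv
    · filter_upwards [hu0] with x hx
      have hq := hP.posSemidef.dotProduct_mulVec_self_nonneg w
      have hq' := mul_nonneg (hψ.second_pos _ hx).le
        (hP.posSemidef.dotProduct_mulVec_self_nonneg (v x))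
      have h1 := mul_le_mul_of_nonneg_right (hk (u x) hx) hq
      have h0 := mul_nonneg (inv_pos.mpr (hψ.second_pos _ hx)).le hq
      have h2 := hψ.two_mul_dotProduct_le hP.posSemidef hx (v x) w
      have h3 := hψ.two_mul_dotProduct_le hP.posSemidef hx (v x) (-w)
      simp only [Matrix.mulVec_neg, dotProduct_neg, neg_dotProduct, neg_neg] at h3
      rw [Real.norm_eq_abs, abs_le]
      constructor <;> linarith
  -- The `i`-th component of `v` is `⟨v, P w⟩` with `P w = eᵢ`.
  refine Integrable.of_eval fun i => ?_
  have hw := hlin (P⁻¹ *ᵥ Pi.single i 1)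
  rw [Matrix.mulVec_mulVec, Matrix.mul_nonsing_inv _ ((Matrix.isUnit_iff_isUnit_det _).mp
    hP.isUnit), Matrix.one_mulVec] at hw
  simpa using hw

theorem integral_pos_of_ae_pos {Ω : Type*} [MeasurableSpace Ω] {μ : Measure Ω}
    [IsProbabilityMeasure μ] {u : Ω → ℝ} (hu : Integrable u μ) (hu0 : ∀ᵐ x ∂μ, 0 < u x) :
    0 < ∫ x, u x ∂μ := by
  refine lt_of_le_of_ne (integral_nonneg_of_ae (hu0.mono fun x hx => hx.le)) fun h => ?_
  have h0 := (integral_eq_zero_iff_of_nonneg_ae (hu0.mono fun x hx => hx.le) hu).mp h.symm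
  obtain ⟨x, hx1, hx2⟩ := (hu0.and h0).exists
  exact hx1.ne' hx2

/-- Jensen's inequality for `(u, v) ↦ ψ''(u) vᵀ P v`. It follows from the inequality
`ψ''(u) vᵀ P v ≥ 2 vᵀ P w - wᵀ P w / ψ''(u)` with `w = ψ''(a) b`, where `a` and `b` are the means
of `u` and `v`, together with a tangent line to the concave function `1 / ψ''` at `a`. -/
theorem IsEntropyGenerator.jensen {ψ : ℝ → ℝ} (hψ : IsEntropyGenerator ψ) {d : ℕ}
    {P : Matrix (Fin d) (Fin d) ℝ} (hP : P.PosSemidef) {Ω : Type*} [MeasurableSpace Ω]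
    {μ : Measure Ω} [IsProbabilityMeasure μ] {u : Ω → ℝ} {v : Ω → Fin d → ℝ}
    (hu : Integrable u μ) (hu0 : ∀ᵐ x ∂μ, 0 < u x) (hv : Integrable v μ) :
    ENNReal.ofReal (iteratedDeriv 2 ψ (∫ x, u x ∂μ) *
      ((∫ x, v x ∂μ) ⬝ᵥ (P *ᵥ ∫ x, v x ∂μ))) ≤
      ∫⁻ x, ENNReal.ofReal (iteratedDeriv 2 ψ (u x) * (v x ⬝ᵥ (P *ᵥ v x))) ∂μ := by
  set a := ∫ x, u x ∂μ with ha
  set b := ∫ x, v x ∂μ with hb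
  have ha0 : 0 < a := integral_pos_of_ae_pos hu hu0
  obtain ⟨k, hk⟩ := hψ.exists_tangent ha0
  have hpos := hψ.second_pos a ha0
  set w := iteratedDeriv 2 ψ a • b with hw
  let ℓ : (Fin d → ℝ) →L[ℝ] ℝ := LinearMap.toContinuousLinearMap
    { toFun := fun z => z ⬝ᵥ (P *ᵥ w)
      map_add' := fun x y => add_dotProduct x y _
      map_smul' := fun c x => smul_dotProduct c x _ }
  have hℓ : ∀ z, ℓ z = z ⬝ᵥ (P *ᵥ w) := fun z => rfl
  set G : Ω → ℝ := fun x =>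
    2 * ℓ (v x) - ((iteratedDeriv 2 ψ a)⁻¹ + k * (u x - a)) * (w ⬝ᵥ (P *ᵥ w)) with hG
  have hi1 : Integrable (fun x => 2 * ℓ (v x)) μ := (ℓ.integrable_comp hv).const_mul 2
  have hi2 : Integrable (fun x => (iteratedDeriv 2 ψ a)⁻¹ + k * (u x - a)) μ :=
    (integrable_const _).add ((hu.sub (integrable_const a)).const_mul k)
  have hGi : Integrable G μ := hi1.sub (hi2.mul_const _)
  have hGint : ∫ x, G x ∂μ = iteratedDeriv 2 ψ a * (b ⬝ᵥ (P *ᵥ b)) := by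
    have e1 : ∫ x, 2 * ℓ (v x) ∂μ = 2 * ℓ b := by
      rw [integral_const_mul, ℓ.integral_comp_comm hv]
    have hi3 : Integrable (fun x => k * (u x - a)) μ :=
      (hu.sub (integrable_const a)).const_mul k
    have e2 : ∫ x, ((iteratedDeriv 2 ψ a)⁻¹ + k * (u x - a)) ∂μ = (iteratedDeriv 2 ψ a)⁻¹ := by
      rw [integral_add (integrable_const _) hi3, integral_const_mul,
        integral_sub hu (integrable_const a)]
      simp [← ha]
    simp only [hG]
    rw [integral_sub hi1 (hi2.mul_const _), integral_mul_const, e1, e2, hℓ, hw]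
    simp only [Matrix.mulVec_smul, dotProduct_smul, smul_dotProduct, smul_eq_mul]
    field_simp
    ring
  have hle : ∀ᵐ x ∂μ, G x ≤ iteratedDeriv 2 ψ (u x) * (v x ⬝ᵥ (P *ᵥ v x)) := by
    filter_upwards [hu0] with x hx
    have h1 := hψ.two_mul_dotProduct_le hP hx (v x) w
    have h2 := mul_le_mul_of_nonneg_right (hk (u x) hx) (hP.dotProduct_mulVec_self_nonneg w)
    simp only [hG, hℓ]
    linarith
  rw [← hGint]
  calc ENNReal.ofReal (∫ x, G x ∂μ)
      ≤ ENNReal.ofReal (∫ x, max (G x) 0 ∂μ) :=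
        ENNReal.ofReal_le_ofReal (integral_mono hGi hGi.pos_part fun x => le_max_left _ _)
    _ = ∫⁻ x, ENNReal.ofReal (max (G x) 0) ∂μ :=
        ofReal_integral_eq_lintegral_ofReal hGi.pos_part
          (Eventually.of_forall fun x => le_max_right _ _)
    _ ≤ _ := by
        refine lintegral_mono_ae ?_
        filter_upwards [hle, hu0] with x hx hx0
        exact ENNReal.ofReal_le_ofReal (max_le hx (mul_nonneg (hψ.second_pos _ hx0).le
          (hP.dotProduct_mulVec_self_nonneg _)))

/-! ### Weak gradients and the transition operator -/

theorem HasWeakGradient.congr {d : ℕ} {u u' : EuclideanSpace ℝ (Fin d) → ℝ}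
    {v : EuclideanSpace ℝ (Fin d) → Fin d → ℝ} (h : HasWeakGradient u v) (huu : u =ᵐ[volume] u') :
    HasWeakGradient u' v where
  locallyIntegrable := h.locallyIntegrable.congr huu
  gradient_locallyIntegrable := h.gradient_locallyIntegrable
  integral_eq φ hφ hc i := by
    rw [← h.integral_eq φ hφ hc i]
    refine integral_congr_ae ?_
    filter_upwards [huu] with x hx
    rw [hx]

theorem locallyIntegrable_of_integrable_stdGaussian {d : ℕ} {F : Type*} [NormedAddCommGroup F]
    [NormedSpace ℝ F] {h : EuclideanSpace ℝ (Fin d) → F} (hh : Integrable h (stdGaussian _)) :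
    LocallyIntegrable h volume := by
  have h1 := (integrable_stdGaussian_iff.mp hh).locallyIntegrable
  have h2 := h1.continuous_smul (g := fun x => (gaussDensity x)⁻¹)
    (continuous_gaussDensity.inv₀ fun x => (gaussDensity_pos x).ne')
  refine h2.congr (Eventually.of_forall fun x => ?_)
  simp only
  rw [inv_smul_smul₀ (gaussDensity_pos x).ne']

/-- Fubini's theorem for the pairing of `mehler A F` with a test function in Lebesgue measure. It is
proved by passing to the Gaussian measure, for which the bounded weight is `φ` over the density. -/
theorem integral_mehler_mul {d : ℕ} {A : Matrix (Fin d) (Fin d) ℝ}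
    (h₁ : (1 - A * Aᵀ).PosSemidef) (h₂ : (1 - Aᵀ * A).PosSemidef)
    {F : EuclideanSpace ℝ (Fin d) → ℝ} (hF : Integrable F (stdGaussian _))
    {φ : EuclideanSpace ℝ (Fin d) → ℝ} (hφ : Continuous φ) (hc : HasCompactSupport φ) :
    ∫ x, mehler A F x * φ x = ∫ y, (∫ x, F (Matrix.toEuclideanCLM (𝕜 := ℝ) A x + y) * φ x)
      ∂(multivariateGaussian 0 (1 - A * Aᵀ)) := by
  set θ : EuclideanSpace ℝ (Fin d) → ℝ := fun x => φ x * (gaussDensity x)⁻¹ with hθ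
  have hθc : Continuous θ :=
    hφ.mul (continuous_gaussDensity.inv₀ fun x => (gaussDensity_pos x).ne')
  have hθs : HasCompactSupport θ := hc.mul_right
  obtain ⟨B, hB⟩ := hθs.exists_bound_of_continuous hθc
  have hcancel : ∀ (a : ℝ) x, gaussDensity x • (a * θ x) = a * φ x := fun a x => by
    have := (gaussDensity_pos x).ne'
    simp only [hθ, smul_eq_mul]
    field_simp
  have hint : Integrable (Function.uncurry fun x y =>
      F (Matrix.toEuclideanCLM (𝕜 := ℝ) A x + y) * θ x)
      ((stdGaussian (EuclideanSpace ℝ (Fin d))).prod (multivariateGaussian 0 (1 - A * Aᵀ))) :=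
    (integrable_comp_mehler h₁ h₂ hF).mul_bdd (c := B)
      (Continuous.comp (g := θ) (f := Prod.fst) hθc continuous_fst).aestronglyMeasurable
      (Eventually.of_forall fun p => hB p.1)
  calc ∫ x, mehler A F x * φ x
      = ∫ x, mehler A F x * θ x ∂(stdGaussian _) := by
        rw [integral_stdGaussian]
        simp only [hcancel]
    _ = ∫ x, (∫ y, F (Matrix.toEuclideanCLM (𝕜 := ℝ) A x + y) * θ x
          ∂(multivariateGaussian 0 (1 - A * Aᵀ))) ∂(stdGaussian _) := by
        simp only [mehler, integral_mul_const]
    _ = ∫ y, (∫ x, F (Matrix.toEuclideanCLM (𝕜 := ℝ) A x + y) * θ x ∂(stdGaussian _))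
          ∂(multivariateGaussian 0 (1 - A * Aᵀ)) := integral_integral_swap hint
    _ = _ := by
        simp only [integral_stdGaussian, hcancel]

theorem integral_comp_affine {d : ℕ} (L : EuclideanSpace ℝ (Fin d) ≃L[ℝ] EuclideanSpace ℝ (Fin d))
    (y : EuclideanSpace ℝ (Fin d)) (G : EuclideanSpace ℝ (Fin d) → ℝ) :
    ∫ z, G z = |(L : EuclideanSpace ℝ (Fin d) →L[ℝ] EuclideanSpace ℝ (Fin d)).det| *
      ∫ x, G (L x + y) := by
  have h := integral_image_eq_integral_abs_det_fderiv_smul volume (s := univ)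
    (f := fun x => L x + y) (f' := fun _ => L) MeasurableSet.univ
    (fun x _ => (L.hasFDerivAt.add_const y).hasFDerivWithinAt)
    (fun a _ b _ hab => L.injective (add_right_cancel hab)) G
  have hs : (fun x => L x + y) '' univ = univ := by
    rw [image_univ, range_eq_univ]
    intro z
    exact ⟨L.symm (z - y), by simp⟩
  rw [hs, Measure.restrict_univ] at h
  simp only [smul_eq_mul] at h
  rw [h, integral_const_mul]

/-- Chain rule for weak gradients under an affine change of variables. -/
theorem HasWeakGradient.integral_comp_affine {d : ℕ} {h : EuclideanSpace ℝ (Fin d) → ℝ}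
    {v : EuclideanSpace ℝ (Fin d) → Fin d → ℝ} (hv : HasWeakGradient h v)
    {A : Matrix (Fin d) (Fin d) ℝ} (hA : IsUnit A) (y : EuclideanSpace ℝ (Fin d))
    {φ : EuclideanSpace ℝ (Fin d) → ℝ} (hφ : ContDiff ℝ ∞ φ) (hc : HasCompactSupport φ)
    (i : Fin d) :
    ∫ x, h (Matrix.toEuclideanCLM (𝕜 := ℝ) A x + y) * partialDeriv i φ x =
      - ∫ x, (Aᵀ *ᵥ v (Matrix.toEuclideanCLM (𝕜 := ℝ) A x + y)) i * φ x := by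
  have hdet := (Matrix.isUnit_iff_isUnit_det A).mp hA
  have hinv : ∀ M N : Matrix (Fin d) (Fin d) ℝ, M * N = 1 → ∀ x : EuclideanSpace ℝ (Fin d),
      Matrix.toEuclideanCLM (𝕜 := ℝ) M (Matrix.toEuclideanCLM (𝕜 := ℝ) N x) = x := by
    intro M N hMN x
    have := congrArg (fun Q => Matrix.toEuclideanCLM (n := Fin d) (𝕜 := ℝ) Q x) hMN
    simp only [map_mul, map_one, one_apply_eq_self] at this
    exact this
  let L : EuclideanSpace ℝ (Fin d) ≃L[ℝ] EuclideanSpace ℝ (Fin d) :=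
    ContinuousLinearEquiv.equivOfInverse (Matrix.toEuclideanCLM (𝕜 := ℝ) A)
      (Matrix.toEuclideanCLM (𝕜 := ℝ) A⁻¹) (hinv _ _ (A.nonsing_inv_mul hdet))
      (hinv _ _ (A.mul_nonsing_inv hdet))
  have hL : ∀ x, Matrix.toEuclideanCLM (𝕜 := ℝ) A x = L x := fun x => rfl
  set χ : EuclideanSpace ℝ (Fin d) → ℝ := fun z => φ (L.symm (z - y)) with hχ
  have hχs : ContDiff ℝ ∞ χ :=
    ContDiff.comp (g := φ) (f := fun z => L.symm (z - y)) hφ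
      (L.symm.contDiff.comp (contDiff_id.sub contDiff_const))
  have hχc : HasCompactSupport χ :=
    hc.comp_homeomorph ((Homeomorph.subRight y).trans L.symm.toHomeomorph)
  have hχφ : ∀ x, χ (L x + y) = φ x := fun x => by simp [hχ]
  have hpd : ∀ x, partialDeriv i φ x = ∑ j, A j i * partialDeriv j χ (L x + y) := by
    intro x
    have h1 : HasFDerivAt χ (fderiv ℝ χ (L x + y)) (L x + y) :=
      ((hχs.differentiable (by simp)) _).hasFDerivAt
    have h2 : HasFDerivAt (fun x => L x + y)
      (L : EuclideanSpace ℝ (Fin d) →L[ℝ] EuclideanSpace ℝ (Fin d)) x :=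
      L.hasFDerivAt.add_const y
    have h3 : HasFDerivAt φ ((fderiv ℝ χ (L x + y)).comp
        (L : EuclideanSpace ℝ (Fin d) →L[ℝ] EuclideanSpace ℝ (Fin d))) x :=
      (HasFDerivAt.comp (g := χ) (f := fun x => L x + y) x h1 h2).congr_of_eventuallyEq
        (Eventually.of_forall fun z => (hχφ z).symm)
    rw [partialDeriv_eq_of_hasFDerivAt i h3]
    have h4 : L (EuclideanSpace.single i 1) = ∑ j, A j i • EuclideanSpace.single j (1 : ℝ) := by
      rw [← hL]
      ext k
      simp [Matrix.ofLp_toEuclideanCLM, Pi.single_apply]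
    rw [ContinuousLinearMap.comp_apply, ContinuousLinearEquiv.coe_coe, h4, map_sum]
    simp only [map_smul, smul_eq_mul, partialDeriv]
  have hdetL : |(L : EuclideanSpace ℝ (Fin d) →L[ℝ] EuclideanSpace ℝ (Fin d)).det| ≠ 0 :=
    abs_ne_zero.mpr L.toLinearEquiv.isUnit_det'.ne_zero
  refine mul_left_cancel₀ hdetL ?_
  simp only [hL, hpd]
  have e1 := _root_.integral_comp_affine L y fun z => h z * ∑ j, A j i * partialDeriv j χ z
  have e2 := _root_.integral_comp_affine L y fun z => (Aᵀ *ᵥ v z) i * χ z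
  simp only [hχφ] at e2
  rw [mul_neg, ← e1, ← e2]
  have hvj : ∀ j, LocallyIntegrable (fun z => v z j) volume := fun j x =>
    let ⟨s, hs, hi⟩ := hv.gradient_locallyIntegrable x
    ⟨s, hs, hi.eval j⟩
  have i1 : ∀ j, Integrable (fun z => h z * partialDeriv j χ z) := fun j =>
    hv.locallyIntegrable.integrable_smul_right_of_hasCompactSupport
      (hχs.partialDeriv (m := 0) (by simp) j).continuous (hχc.partialDeriv j)
  have i2 : ∀ j, Integrable (fun z => v z j * χ z) := fun j =>
    (hvj j).integrable_smul_right_of_hasCompactSupport hχs.continuous hχc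
  calc ∫ z, h z * ∑ j, A j i * partialDeriv j χ z
      = ∑ j, A j i * ∫ z, h z * partialDeriv j χ z := by
        simp only [Finset.mul_sum, ← integral_const_mul]
        rw [← integral_finsetSum _ fun j _ => (i1 j).const_mul _]
        refine integral_congr_ae (Eventually.of_forall fun z => Finset.sum_congr rfl fun j _ => ?_)
        ring
    _ = - ∑ j, A j i * ∫ z, v z j * χ z := by
        simp only [hv.integral_eq χ hχs hχc, mul_neg, Finset.sum_neg_distrib]
    _ = _ := by
        congr 1
        simp only [← integral_const_mul]
        rw [← integral_finsetSum _ fun j _ => (i2 j).const_mul _]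
        refine integral_congr_ae (Eventually.of_forall fun z => ?_)
        simp only [Matrix.mulVec, dotProduct, Matrix.transpose_apply, Finset.sum_mul, mul_assoc]

/-- The commutation relation `∇ (mehler A h) = Aᵀ (mehler A (∇ h))`. -/
theorem HasWeakGradient.mehler {d : ℕ} {h : EuclideanSpace ℝ (Fin d) → ℝ}
    {v : EuclideanSpace ℝ (Fin d) → Fin d → ℝ} (hv : HasWeakGradient h v)
    {A : Matrix (Fin d) (Fin d) ℝ} (hA : IsUnit A)
    (h₁ : (1 - A * Aᵀ).PosSemidef) (h₂ : (1 - Aᵀ * A).PosSemidef)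
    (hhi : Integrable h (stdGaussian _)) (hvi : Integrable v (stdGaussian _)) :
    HasWeakGradient (mehler A h) (fun x => Aᵀ *ᵥ mehler A v x) where
  locallyIntegrable := locallyIntegrable_of_integrable_stdGaussian (integrable_mehler h₁ h₂ hhi)
  gradient_locallyIntegrable := locallyIntegrable_of_integrable_stdGaussian
    ((LinearMap.toContinuousLinearMap Aᵀ.mulVecLin).integrable_comp
      (integrable_mehler h₁ h₂ hvi))
  integral_eq φ hφ hc i := by
    let ℓ : (Fin d → ℝ) →L[ℝ] ℝ := (ContinuousLinearMap.proj i).comp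
      (LinearMap.toContinuousLinearMap Aᵀ.mulVecLin)
    have hℓ : ∀ z, (Aᵀ *ᵥ z) i = ℓ z := fun z => rfl
    have e1 := integral_mehler_mul h₁ h₂ hhi (hφ.partialDeriv (m := 0) (by simp) i).continuous
      (hc.partialDeriv i)
    have e2 := integral_mehler_mul h₁ h₂ (ℓ.integrable_comp hvi) hφ.continuous hc
    rw [e1]
    simp only [hv.integral_comp_affine hA _ hφ hc i, hℓ]
    rw [integral_neg, ← e2]
    congr 1
    refine integral_congr_ae ?_
    filter_upwards [volume_absolutelyContinuous_stdGaussian.ae_le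
      (integrable_comp_mehler h₁ h₂ hvi).prod_right_ae] with x hx
    congr 1
    exact ℓ.integral_comp_comm hx

/-! ### Decay of the generalised Fisher information -/

theorem lintegral_ofReal_mul_gaussDensity {d : ℕ} (F : EuclideanSpace ℝ (Fin d) → ℝ) :
    ∫⁻ x, ENNReal.ofReal (F x * gaussDensity x) =
      ∫⁻ x, ENNReal.ofReal (F x) ∂(stdGaussian (EuclideanSpace ℝ (Fin d))) := by
  rw [stdGaussian_eq_withDensity, lintegral_withDensity_eq_lintegral_mul_non_measurable _
    (by exact continuous_gaussDensity.measurable.ennreal_ofReal)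
    (Eventually.of_forall fun x => ENNReal.ofReal_lt_top)]
  refine lintegral_congr fun x => ?_
  rw [Pi.mul_apply, mul_comm, ENNReal.ofReal_mul (gaussDensity_pos x).le]

theorem integrable_div_gaussDensity {d : ℕ} {g : EuclideanSpace ℝ (Fin d) → ℝ}
    (hg : Integrable g) : Integrable (fun x => g x / gaussDensity x) (stdGaussian _) := by
  rw [integrable_stdGaussian_iff]
  refine hg.congr (Eventually.of_forall fun x => ?_)
  exact (mul_div_cancel₀ _ (gaussDensity_pos x).ne').symm

/-- The Fisher information without the gradient commutation factor does not increase: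
Jensen's inequality is applied to the Gaussian average at each point, and the Gaussian measure is
invariant. -/
theorem lintegral_mehler_le {d : ℕ} {ψ : ℝ → ℝ} (hψ : IsEntropyGenerator ψ)
    {P : Matrix (Fin d) (Fin d) ℝ} (hP : P.PosSemidef) {A : Matrix (Fin d) (Fin d) ℝ}
    (h₁ : (1 - A * Aᵀ).PosSemidef) (h₂ : (1 - Aᵀ * A).PosSemidef)
    {u : EuclideanSpace ℝ (Fin d) → ℝ} {v : EuclideanSpace ℝ (Fin d) → Fin d → ℝ}
    (hu : Integrable u (stdGaussian _)) (hu0 : ∀ᵐ x ∂(stdGaussian _), 0 < u x)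
    (hv : Integrable v (stdGaussian _)) :
    ∫⁻ x, ENNReal.ofReal (iteratedDeriv 2 ψ (mehler A u x) *
        (mehler A v x ⬝ᵥ (P *ᵥ mehler A v x))) ∂(stdGaussian _) ≤
      ∫⁻ x, ENNReal.ofReal (iteratedDeriv 2 ψ (u x) * (v x ⬝ᵥ (P *ᵥ v x)))
        ∂(stdGaussian (EuclideanSpace ℝ (Fin d))) := by
  have hmp := measurePreserving_mehler h₁ h₂
  set J : EuclideanSpace ℝ (Fin d) → ℝ≥0∞ := fun x =>
    ENNReal.ofReal (iteratedDeriv 2 ψ (u x) * (v x ⬝ᵥ (P *ᵥ v x))) with hJ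
  have hJm : AEMeasurable J (stdGaussian _) :=
    ((measurable_fisherIntegrand ψ P).comp_aemeasurable
      (hu.aemeasurable.prodMk hv.aestronglyMeasurable.aemeasurable)).ennreal_ofReal
  have hJm' : AEMeasurable (fun p : EuclideanSpace ℝ (Fin d) × EuclideanSpace ℝ (Fin d) =>
      J (Matrix.toEuclideanCLM (𝕜 := ℝ) A p.1 + p.2))
      ((stdGaussian (EuclideanSpace ℝ (Fin d))).prod (multivariateGaussian 0 (1 - A * Aᵀ))) :=
    hJm.comp_quasiMeasurePreserving hmp.quasiMeasurePreserving
  calc _ ≤ ∫⁻ x, (∫⁻ y, J (Matrix.toEuclideanCLM (𝕜 := ℝ) A x + y)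
          ∂(multivariateGaussian 0 (1 - A * Aᵀ))) ∂(stdGaussian _) := by
        refine lintegral_mono_ae ?_
        filter_upwards [Measure.ae_ae_of_ae_prod (hmp.quasiMeasurePreserving.ae hu0),
          (integrable_comp_mehler h₁ h₂ hu).prod_right_ae,
          (integrable_comp_mehler h₁ h₂ hv).prod_right_ae] with x hx0 hxu hxv
        exact hψ.jensen hP hxu hx0 hxv
    _ = ∫⁻ p, J (Matrix.toEuclideanCLM (𝕜 := ℝ) A p.1 + p.2)
          ∂((stdGaussian (EuclideanSpace ℝ (Fin d))).prod
            (multivariateGaussian 0 (1 - A * Aᵀ))) := (lintegral_prod _ hJm').symm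
    _ = ∫⁻ x, J x ∂(stdGaussian _) :=
        (lintegral_map' (by rwa [hmp.map_eq]) hmp.aemeasurable).symm.trans (by rw [hmp.map_eq])

/-- Contraction of the Fisher information under the transition operator. The factor `c` comes from
the matrix `Aᵀ` in the commutation relation with the weak gradient. -/
theorem genFisherInfo_mehler_le {d : ℕ} {ψ : ℝ → ℝ} (hψ : IsEntropyGenerator ψ)
    {P : Matrix (Fin d) (Fin d) ℝ} (hP : P.PosDef) {A : Matrix (Fin d) (Fin d) ℝ} (hA : IsUnit A)
    (h₁ : (1 - A * Aᵀ).PosSemidef) (h₂ : (1 - Aᵀ * A).PosSemidef) {c : ℝ} (hc : 0 < c)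
    (hAP : ∀ v : Fin d → ℝ, (Aᵀ *ᵥ v) ⬝ᵥ (P *ᵥ (Aᵀ *ᵥ v)) ≤ c * (v ⬝ᵥ (P *ᵥ v)))
    {fa fb ga gb : EuclideanSpace ℝ (Fin d) → ℝ} (hfa : Integrable fa) (hga : Integrable ga)
    (hfa0 : ∀ᵐ x, 0 < fa x)
    (hf : (fun x => fb x / gaussDensity x) =ᵐ[volume] mehler A fun x => fa x / gaussDensity x)
    (hg : (fun x => gb x / gaussDensity x) =ᵐ[volume] mehler A fun x => ga x / gaussDensity x) :
    genFisherInfo ψ P fb gb gaussDensity ≤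
      genFisherInfo ψ P fa ga gaussDensity * ENNReal.ofReal c := by
  have hc0 : ENNReal.ofReal c ≠ 0 := (ENNReal.ofReal_pos.mpr hc).ne'
  rw [← ENNReal.div_le_iff hc0 ENNReal.ofReal_ne_top, genFisherInfo.eq_def _ _ fa]
  refine le_iInf₂ fun v hv => ?_
  rw [ENNReal.div_le_iff hc0 ENNReal.ofReal_ne_top, lintegral_ofReal_mul_gaussDensity]
  set J := ∫⁻ x, ENNReal.ofReal (iteratedDeriv 2 ψ (fa x / gaussDensity x) *
    (v x ⬝ᵥ (P *ᵥ v x))) ∂(stdGaussian (EuclideanSpace ℝ (Fin d))) with hJ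
  rcases eq_or_ne J ⊤ with hJt | hJt
  · rw [hJt, ENNReal.top_mul hc0]
    exact le_top
  have hu := integrable_div_gaussDensity hfa
  have hu0 : ∀ᵐ x ∂(stdGaussian (EuclideanSpace ℝ (Fin d))), 0 < fa x / gaussDensity x := by
    filter_upwards [stdGaussian_absolutelyContinuous_volume.ae_le hfa0] with x hx
    exact div_pos hx (gaussDensity_pos x)
  have hvm : AEStronglyMeasurable v (stdGaussian _) :=
    hv.gradient_locallyIntegrable.aestronglyMeasurable.mono_ac
      stdGaussian_absolutelyContinuous_volume
  have hvi := hψ.integrable_of_lintegral_lt_top hP hu hu0 hvm hJt.lt_top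
  have hw := (hv.mehler hA h₁ h₂ (integrable_div_gaussDensity hga) hvi).congr hg.symm
  refine (iInf₂_le _ hw).trans ?_
  rw [lintegral_ofReal_mul_gaussDensity]
  have hmpos : ∀ᵐ x ∂(stdGaussian (EuclideanSpace ℝ (Fin d))),
      0 ≤ iteratedDeriv 2 ψ (mehler A (fun x => fa x / gaussDensity x) x) := by
    filter_upwards [Measure.ae_ae_of_ae_prod
      ((measurePreserving_mehler h₁ h₂).quasiMeasurePreserving.ae hu0),
      (integrable_comp_mehler h₁ h₂ hu).prod_right_ae] with x hx hxi
    exact (hψ.second_pos _ (integral_pos_of_ae_pos hxi hx)).le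
  calc _ ≤ ∫⁻ x, ENNReal.ofReal (iteratedDeriv 2 ψ (mehler A (fun x => fa x / gaussDensity x) x) *
        (mehler A v x ⬝ᵥ (P *ᵥ mehler A v x))) * ENNReal.ofReal c ∂(stdGaussian _) := by
        refine lintegral_mono_ae ?_
        filter_upwards [stdGaussian_absolutelyContinuous_volume.ae_le hf, hmpos] with x hx hx0
        rw [hx, ← ENNReal.ofReal_mul' hc.le]
        refine ENNReal.ofReal_le_ofReal ?_
        calc _ ≤ _ := mul_le_mul_of_nonneg_left (hAP (mehler A v x)) hx0
          _ = _ := by ring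
    _ = (∫⁻ x, ENNReal.ofReal (iteratedDeriv 2 ψ (mehler A (fun x => fa x / gaussDensity x) x) *
        (mehler A v x ⬝ᵥ (P *ᵥ mehler A v x))) ∂(stdGaussian _)) * ENNReal.ofReal c :=
        lintegral_mul_const' _ _ ENNReal.ofReal_ne_top
    _ ≤ J * ENNReal.ofReal c := by
        gcongr
        exact lintegral_mehler_le hψ hP.posSemidef h₁ h₂ hu hu0 hvi

/-- The quotient `f / f∞` of a solution evolves by the transition operator. -/
theorem IsFPSolution.div_gaussDensity_ae_eq_mehler {d : ℕ} {D C : Matrix (Fin d) (Fin d) ℝ}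
    (hsymm : D = (1 / 2 : ℝ) • (C + Cᵀ)) (hD : D.PosSemidef)
    {f₀ : EuclideanSpace ℝ (Fin d) → ℝ} {f : ℝ → EuclideanSpace ℝ (Fin d) → ℝ}
    (hf : IsFPSolution D C f₀ f) {a b : ℝ} (ha : 0 ≤ a) (hab : a ≤ b) :
    (fun x => f b x / gaussDensity x) =ᵐ[volume]
      mehler (driftFlow C (b - a))ᵀ fun x => f a x / gaussDensity x :=
  _root_.div_gaussDensity_ae_eq_mehler
    (posSemidef_one_sub_mul_transpose fun x => by
      rw [Matrix.transpose_transpose]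
      exact norm_driftFlow_le hsymm hD (sub_nonneg.mpr hab) x)
    (by
      have := posSemidef_one_sub_mul_transpose (A := driftFlow C (b - a))
        fun x => norm_driftFlow_transpose_le hsymm hD (sub_nonneg.mpr hab) x
      rwa [Matrix.transpose_transpose])
    (hf.integrable a ha) (hf.integrable b (ha.trans hab))
    (integral_mul_cexp_driftFlow hsymm hf ha hab)

/-- A nonnegative solution of unit mass is positive at every positive time: the noise is
nondegenerate by the strict contractivity of the drift flow. -/
theorem IsFPSolution.ae_pos {d : ℕ} {D C : Matrix (Fin d) (Fin d) ℝ}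
    (hDC : FokkerPlanckConditions D C) (hsymm : D = (1 / 2 : ℝ) • (C + Cᵀ))
    {f₀ : EuclideanSpace ℝ (Fin d) → ℝ} {f : ℝ → EuclideanSpace ℝ (Fin d) → ℝ}
    (hf : IsFPSolution D C f₀ f) (hf₀ : ∀ᵐ x, 0 ≤ f₀ x) (hmass : ∫ x, f₀ x = 1) {t : ℝ}
    (ht : 0 < t) : ∀ᵐ x, 0 < f t x := by
  have h₁ := posDef_one_sub_mul_transpose (A := (driftFlow C t)ᵀ) fun x hx => by
    rw [Matrix.transpose_transpose]
    exact norm_driftFlow_lt hDC hsymm ht hx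
  have h₂ := posSemidef_one_sub_mul_transpose (A := driftFlow C t)
    fun x => norm_driftFlow_transpose_le hsymm hDC.posSemidef ht.le x
  have heq := hf.div_gaussDensity_ae_eq_mehler hsymm hDC.posSemidef le_rfl ht.le
  rw [sub_zero] at heq
  have hpos := mehler_pos_ae (u := fun x => f 0 x / gaussDensity x) h₁
    (by rwa [Matrix.transpose_transpose]) (integrable_div_gaussDensity (hf.integrable 0 le_rfl))
    (by
      filter_upwards [stdGaussian_absolutelyContinuous_volume.ae_le hf₀,
        stdGaussian_absolutelyContinuous_volume.ae_le hf.initial] with x hx hx'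
      rw [hx']
      exact div_nonneg hx (gaussDensity_pos x).le)
    (by
      have hcancel : ∀ x : EuclideanSpace ℝ (Fin d),
          gaussDensity x • (f 0 x / gaussDensity x) = f 0 x := fun x =>
        mul_div_cancel₀ _ (gaussDensity_pos x).ne'
      simp only [integral_stdGaussian, hcancel]
      rw [integral_congr_ae hf.initial, hmass]
      exact one_ne_zero)
  filter_upwards [heq, volume_absolutelyContinuous_stdGaussian.ae_le hpos] with x hx hx'
  rw [← hx] at hx'
  exact (div_pos_iff_of_pos_right (gaussDensity_pos x)).mp hx'

/-- Exponential decay of the generalised Fisher information between any two times. -/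
theorem genFisherInfo_le_mul_exp {d : ℕ} {D C P : Matrix (Fin d) (Fin d) ℝ}
    (hsymm : D = (1 / 2 : ℝ) • (C + Cᵀ)) (hD : D.PosSemidef)
    {ψ : ℝ → ℝ} (hψ : IsEntropyGenerator ψ) {l : ℝ} (hP : P.PosDef)
    (hCP : (Cᵀ * P + P * C - (2 * l) • P).PosSemidef)
    {f₀ g₀ : EuclideanSpace ℝ (Fin d) → ℝ} {f g : ℝ → EuclideanSpace ℝ (Fin d) → ℝ}
    (hf : IsFPSolution D C f₀ f) (hg : IsFPSolution D C g₀ g) {a b : ℝ} (ha : 0 ≤ a)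
    (hab : a ≤ b) (hpos : ∀ᵐ x, 0 < f a x) :
    genFisherInfo ψ P (f b) (g b) gaussDensity ≤ genFisherInfo ψ P (f a) (g a) gaussDensity *
      ENNReal.ofReal (Real.exp (-2 * l * (b - a))) := by
  refine genFisherInfo_mehler_le hψ hP (A := (driftFlow C (b - a))ᵀ) ?_ ?_ ?_ (Real.exp_pos _) ?_
    (hf.integrable a ha) (hg.integrable a ha) hpos
    (hf.div_gaussDensity_ae_eq_mehler hsymm hD ha hab)
    (hg.div_gaussDensity_ae_eq_mehler hsymm hD ha hab)
  · rw [Matrix.isUnit_transpose]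
    exact isUnit_driftFlow C _
  · refine posSemidef_one_sub_mul_transpose fun x => ?_
    rw [Matrix.transpose_transpose]
    exact norm_driftFlow_le hsymm hD (sub_nonneg.mpr hab) x
  · have := posSemidef_one_sub_mul_transpose (A := driftFlow C (b - a))
        fun x => norm_driftFlow_transpose_le hsymm hD (sub_nonneg.mpr hab) x
    rwa [Matrix.transpose_transpose]
  · intro v
    rw [Matrix.transpose_transpose]
    exact driftFlow_quadratic_le hCP (sub_nonneg.mpr hab) v

/-- The comparison function for the difference quotients, from both sides of `t`, is
`s ↦ e^{-2l(s-t)} F(t)`. -/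
theorem slope_le_of_le_mul_exp {F : ℝ → ℝ} {l t₀ : ℝ}
    (hF : ∀ a b : ℝ, t₀ ≤ a → a ≤ b → F b ≤ F a * Real.exp (-2 * l * (b - a))) {s t : ℝ}
    (hs : t₀ ≤ s) (ht : t₀ ≤ t) :
    (F s - F t) / (s - t) ≤ slope (fun s => F t * Real.exp (-2 * l * (s - t))) t s := by
  rw [slope_def_field, sub_self, mul_zero, Real.exp_zero, mul_one]
  rcases le_total t s with h | h
  · exact div_le_div_of_nonneg_right (sub_le_sub_right (hF t s ht h) _) (sub_nonneg.mpr h)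
  · refine div_le_div_of_nonpos_of_le (sub_nonpos.mpr h) (sub_le_sub_right ?_ _)
    rw [show -2 * l * (s - t) = -(-2 * l * (t - s)) by ring, Real.exp_neg,
      mul_inv_le_iff₀ (Real.exp_pos _)]
    exact hF s t hs h

theorem tendsto_slope_mul_exp (c l t : ℝ) :
    Tendsto (slope (fun s => c * Real.exp (-2 * l * (s - t))) t) (𝓝[≠] t) (𝓝 (-2 * l * c)) := by
  have h : HasDerivAt (fun s => c * Real.exp (-2 * l * (s - t))) (-2 * l * c) t := by
    have h1 : HasDerivAt (fun s => -2 * l * (s - t)) (-2 * l * 1) t :=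
      ((hasDerivAt_id t).sub_const t).const_mul _
    refine (h1.exp.const_mul c).congr_deriv ?_
    simp
    ring
  exact hasDerivAt_iff_tendsto_slope.mp h

theorem upperDeriv_le_of_le_mul_exp {F : ℝ → ℝ} {l t₀ : ℝ}
    (hF : ∀ a b : ℝ, t₀ ≤ a → a ≤ b → F b ≤ F a * Real.exp (-2 * l * (b - a))) {t : ℝ}
    (ht : t₀ < t) : upperDeriv F t ≤ ((-2 * l * F t : ℝ) : EReal) := by
  have h := (continuous_coe_real_ereal.tendsto _).comp (tendsto_slope_mul_exp (F t) l t)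
  rw [← h.limsup_eq]
  refine limsup_le_limsup ?_
  filter_upwards [nhdsWithin_le_nhds (Ioi_mem_nhds ht)] with s hs
  exact EReal.coe_le_coe_iff.mpr (slope_le_of_le_mul_exp hF (le_of_lt hs) ht.le)

theorem deriv_le_of_le_mul_exp {F : ℝ → ℝ} {l t₀ : ℝ}
    (hF : ∀ a b : ℝ, t₀ ≤ a → a ≤ b → F b ≤ F a * Real.exp (-2 * l * (b - a))) {t : ℝ}
    (ht : t₀ < t) (hd : DifferentiableAt ℝ F t) : deriv F t ≤ -2 * l * F t := by
  refine le_of_tendsto_of_tendsto (hasDerivAt_iff_tendsto_slope.mp hd.hasDerivAt)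
    (tendsto_slope_mul_exp (F t) l t) ?_
  filter_upwards [nhdsWithin_le_nhds (Ioi_mem_nhds ht)] with s hs
  rw [slope_def_field]
  exact slope_le_of_le_mul_exp hF (le_of_lt hs) ht.le

theorem ae_differentiableAt_of_le_mul_exp {F : ℝ → ℝ} {l t₀ : ℝ} (hl : 0 ≤ l)
    (hF : ∀ a b : ℝ, t₀ ≤ a → a ≤ b → F b ≤ F a * Real.exp (-2 * l * (b - a)))
    (hF0 : ∀ t, 0 ≤ F t) : ∀ᵐ t : ℝ, t₀ < t → DifferentiableAt ℝ F t := by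
  have hanti : MonotoneOn (fun t => -F t) (Ici t₀) := by
    intro a ha b hb hab
    have h1 : Real.exp (-2 * l * (b - a)) ≤ 1 :=
      Real.exp_le_one_iff.mpr (by nlinarith [mul_nonneg hl (sub_nonneg.mpr hab)])
    have h2 := mul_le_mul_of_nonneg_left h1 (hF0 a)
    have h3 := hF a b ha hab
    dsimp only
    linarith
  filter_upwards [hanti.ae_differentiableWithinAt_of_mem] with t ht htt
  have := (ht (le_of_lt htt)).differentiableAt (Ici_mem_nhds htt)
  exact differentiableAt_fun_neg_iff.mp this

end

theorem theorem3p1 {d : ℕ} (D C P : Matrix (Fin d) (Fin d) ℝ)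
    (hDC : FokkerPlanckConditions D C)
    (hdiag : D.IsDiag)
    (hsymm : D = (1 / 2 : ℝ) • (C + Cᵀ))
    (fInf : EuclideanSpace ℝ (Fin d) → ℝ) (hfInf : IsEquilibrium D C fInf)
    (ψ : ℝ → ℝ) (hψ : IsEntropyGenerator ψ)
    (l : ℝ) (hl : 0 < l)
    (hP : P.PosDef) (hCP : (Cᵀ * P + P * C - (2 * l) • P).PosSemidef)
    (f₀ g₀ : EuclideanSpace ℝ (Fin d) → ℝ)
    (hf₀ : Integrable f₀ volume) (hf₀_nonneg : ∀ᵐ x, 0 ≤ f₀ x) (hf₀_mass : ∫ x, f₀ x = 1)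
    (hg₀ : Integrable g₀ volume)
    (f g : ℝ → EuclideanSpace ℝ (Fin d) → ℝ)
    (hf : IsFPSolution D C f₀ f) (hg : IsFPSolution D C g₀ g)
    (t₀ : ℝ) (ht₀ : 0 ≤ t₀)
    -- for `t₀ = 0` the initial pair has to be in the domain of the functional
    (hdom : t₀ = 0 → (∀ᵐ x, 0 < f₀ x) ∧ MemH1loc g₀)
    (hfin : genFisherInfo ψ P (f t₀) (g t₀) fInf < ⊤) :
    (∀ t : ℝ, t₀ ≤ t → genFisherInfo ψ P (f t) (g t) fInf < ⊤) ∧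
    (∀ t : ℝ, t₀ < t →
      upperDeriv (fun s => (genFisherInfo ψ P (f s) (g s) fInf).toReal) t
        ≤ ((-2 * l * (genFisherInfo ψ P (f t) (g t) fInf).toReal : ℝ) : EReal)) ∧
    (∀ᵐ t : ℝ, t₀ < t →
      DifferentiableAt ℝ (fun s => (genFisherInfo ψ P (f s) (g s) fInf).toReal) t ∧
      deriv (fun s => (genFisherInfo ψ P (f s) (g s) fInf).toReal) t
        ≤ -2 * l * (genFisherInfo ψ P (f t) (g t) fInf).toReal) ∧
    (∀ t : ℝ, t₀ ≤ t →
      genFisherInfo ψ P (f t) (g t) fInf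
        ≤ genFisherInfo ψ P (f t₀) (g t₀) fInf
          * ENNReal.ofReal (Real.exp (-2 * l * (t - t₀)))) := by
  obtain rfl := hfInf.eq_gaussDensity hsymm hl hP hCP
  have hpos : ∀ t, t₀ ≤ t → ∀ᵐ x, 0 < f t x := by
    intro t ht
    rcases (ht₀.trans ht).eq_or_lt with h | h
    · subst h
      filter_upwards [(hdom (le_antisymm ht ht₀)).1, hf.initial] with x hx hx'
      rwa [hx']
    · exact hf.ae_pos hDC hsymm hf₀_nonneg hf₀_mass h
  have hdecay : ∀ a b : ℝ, t₀ ≤ a → a ≤ b → genFisherInfo ψ P (f b) (g b) gaussDensity ≤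
      genFisherInfo ψ P (f a) (g a) gaussDensity *
        ENNReal.ofReal (Real.exp (-2 * l * (b - a))) := fun a b ha hab =>
    genFisherInfo_le_mul_exp hsymm hDC.posSemidef hψ hP hCP hf hg (ht₀.trans ha) hab (hpos a ha)
  have hfinite : ∀ t : ℝ, t₀ ≤ t → genFisherInfo ψ P (f t) (g t) gaussDensity < ⊤ := fun t ht =>
    (hdecay t₀ t le_rfl ht).trans_lt (ENNReal.mul_lt_top hfin ENNReal.ofReal_lt_top)
  have hreal : ∀ a b : ℝ, t₀ ≤ a → a ≤ b →
      (genFisherInfo ψ P (f b) (g b) gaussDensity).toReal ≤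
        (genFisherInfo ψ P (f a) (g a) gaussDensity).toReal * Real.exp (-2 * l * (b - a)) := by
    intro a b ha hab
    have h := ENNReal.toReal_mono
      (ENNReal.mul_lt_top (hfinite a ha) ENNReal.ofReal_lt_top).ne (hdecay a b ha hab)
    rwa [ENNReal.toReal_mul, ENNReal.toReal_ofReal (Real.exp_pos _).le] at h
  refine ⟨hfinite, fun t ht => upperDeriv_le_of_le_mul_exp hreal ht, ?_,
    fun t ht => hdecay t₀ t le_rfl ht⟩
  filter_upwards [ae_differentiableAt_of_le_mul_exp hl.le hreal fun _ => ENNReal.toReal_nonneg]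
    with t h ht
  exact ⟨h ht, deriv_le_of_le_mul_exp hreal ht (h ht)⟩
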